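/- Let $S$ be an infinite set, and let $\mathcal C$ be one of the following two categories. (LRF) *Labeled rooted forests.* Objects are finite rooted forests (possibly empty) whose vertices are labeled injectively by elements of $S$; isomorphisms preserve roots and edges, but not necessarily labels. An admissible cut $c$ of a forest $F$ chooses for each tree either the full cut or a set of edges at most one of which lies on each path from a leaf to the root. The subobjects of $F$ are the forests $P_c(F)$ below the admissible cuts $c$, and $F/P_c(F)$ is the remaining part $R_c(F)$ above the cut (for the full cut of a tree $T$, the part below is $T$ and the part above is empty). (LFG) *Labeled Feynman graphs ($\phi^3$-theory).* Objects are finite graphs (possibly empty, loops and multiple edges allowed), presented by vertices and half-edges and with labeled half-edges, such that every vertex is incident to exactly three half-edges and every connected component is one-particle irreducible (removing any one internal edge leaves it connected), has $2$ or $3$ external edges (unpaired half-edges), and has at least one loop ($H_1\neq 0$). Isomorphisms preserve incidences, but not necessarily labels. A subobject $\gamma\subset\Gamma$ is a Feynman graph consisting of some vertices of $\Gamma$, all half-edges at these vertices, and some of the internal edges of $\Gamma$ between them (the other half-edges are external in $\gamma$). The quotient $\Gamma/\gamma$ is obtained from $\Gamma$ by contracting each connected component of $\gamma$ with three external edges to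 a trivalent vertex and replacing each one with two external edges by an edge; a component of $\gamma$ that is a whole connected component of $\Gamma$ is deleted. In both cases $\oplus$ is disjoint union. Let $\mathrm H_{\mathcal C}$ be the space of finitely supported functions $\mathrm{Iso}(\mathcal C)\to\mathbb Q$, with basis the delta functions $\delta_A=X_A$ and with product $(f\times g)(M)=\sum_{N\subset M}f(N)\,g(M/N)$, the sum being over subobjects $N$ of $M$. Let $\mathfrak n_{\mathcal C}\subset\mathrm H_{\mathcal C}$ be the space of primitive elements, i.e. of the $f$ with $f(A\oplus B)=f(A)\delta_\emptyset(B)+\delta_\emptyset(A)f(B)$ for all $A,B$, with bracket $[X,Y]=X\times Y-Y\times X$. Let $\phi_A$ be the functional on $\mathrm H_{\mathcal C}$ dual to $\delta_A$, let $\mathrm H^*_{\mathcal C}$ be the span of all the $\phi_A$, and for a functional $\phi$ on $\mathrm H_{\mathcal C}$ put $(\phi\cdot X)(f)=-\phi(f\times X)$ (the top-elimination action). **Theorem.** (1) $\mathfrak n_{\mathcal C}$ is closed under the bracket and is a Lie algebra. (2) For all $A,B\in\mathrm{Iso}(\mathcal C)$, $$\phi_B\cdot X_A=-\sum_{C\subset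 B,\ B/C\cong A}\phi_C ,$$ the sum being over the subobjects $C$ of $B$ (so isomorphism classes are counted with multiplicity). (3) $\mathrm H^*_{\mathcal C}$ is a (right) representation of $\mathfrak n_{\mathcal C}$ under this action: it is stable under $\mathfrak n_{\mathcal C}$, and $\phi\cdot[X,Y]=(\phi\cdot X)\cdot Y-(\phi\cdot Y)\cdot X$ for all $\phi\in\mathrm H^*_{\mathcal C}$ and $X,Y\in\mathfrak n_{\mathcal C}$. (4) For every $M\in\mathrm{Iso}(\mathcal C)$, the subspace $\mathrm H_{\le M}\subset\mathrm H^*_{\mathcal C}$ spanned by the $\phi_A$ with $A$ the isomorphism class of a subobject of $M$ is finite-dimensional and stable under $\mathfrak n_{\mathcal C}$; it is thus a finite-dimensional subrepresentation of the top-elimination representation. -/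

import Mathlib

universe u

noncomputable section

/-! ### The data of a category that enter its Ringel-Hall algebra -/

/-- The data of a category which enter its Ringel-Hall algebra: objects, isomorphism of objects,
the zero object, direct sums, the finite set of subobjects of each object, and quotients.
The last field says that each pair of objects has finitely many extensions up to isomorphism.
This is only a common interface for the two concrete categories `LRF S` and `LFG` below. -/
structure HallCat where
  /-- objects -/
  Obj : Type (u + 1)
  /-- isomorphism of objects -/
  iso : Setoid Obj
  /-- the zero object -/
  zero : Obj
  /-- `IsSum A B M`: the object `M` is isomorphic to `A ⊕ B` -/
  IsSum : Obj → Obj → Obj → Prop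
  /-- the subobjects of an object -/
  Sub : Obj → Type u
  sub_finite : ∀ M, Finite (Sub M)
  /-- a subobject, regarded as an object -/
  sub : (M : Obj) → Sub M → Obj
  /-- `IsQuot M N B`: the quotient `M / N` is isomorphic to `B` -/
  IsQuot : (M : Obj) → Sub M → Obj → Prop
  finite_ext : ∀ A B : Obj, {c : Quotient iso | ∃ N : Sub c.out,
    iso.r (sub c.out N) A ∧ IsQuot c.out N B}.Finite

namespace HallCat

variable (C : HallCat.{u})

/-- The set `Iso(C)` of isomorphism classes of objects. -/
abbrev Iso : Type (u + 1) := Quotient C.iso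

/-- The isomorphism class of an object. -/
def cls (A : C.Obj) : C.Iso := Quotient.mk C.iso A

/-- The space `H_C` of finitely supported rational functions on `Iso(C)`. -/
abbrev H : Type (u + 1) := C.Iso →₀ ℚ

/-- The delta function `δ_A`, also written `X_A`. -/
def delta (A : C.Iso) : C.H := Finsupp.single A 1

/-- The subobjects `N ⊂ M` with `M / N ≅ B`. -/
def subsWithQuot (M B : C.Iso) : Set (C.Sub M.out) := {N | C.IsQuot M.out N B.out}

/-- The Hall number `#{N ⊂ M | N ≅ A, M / N ≅ B}`. -/
def hallNumber (A B M : C.Iso) : ℕ :=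
  Nat.card {N : C.Sub M.out // C.cls (C.sub M.out N) = A ∧ N ∈ C.subsWithQuot M B}

theorem hallNumber_support_finite (A B : C.Iso) :
    (Function.support fun M => (C.hallNumber A B M : ℚ)).Finite := by
  refine (C.finite_ext A.out B.out).subset ?_
  intro M hM
  have h0 : C.hallNumber A B M ≠ 0 := by
    intro h
    apply hM
    simp [h]
  obtain ⟨⟨N, h1, h2⟩⟩ := (Nat.card_ne_zero.mp h0).1
  refine ⟨N, ?_, h2⟩
  apply Quotient.exact (s := C.iso)
  rw [Quotient.out_eq]
  exact h1

/-- The product `δ_A × δ_B = ∑_M #{N ⊂ M | N ≅ A, M / N ≅ B} δ_M`. -/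
def deltaMul (A B : C.Iso) : C.H :=
  Finsupp.ofSupportFinite (fun M => (C.hallNumber A B M : ℚ)) (C.hallNumber_support_finite A B)

/-- The Hall product on `H_C`, the bilinear extension of `δ_A × δ_B`; in other words
`(f × g)(M) = ∑_{N ⊂ M} f(N) g(M / N)`. -/
def hallMul : C.H →ₗ[ℚ] C.H →ₗ[ℚ] C.H :=
  Finsupp.linearCombination ℚ fun A => Finsupp.linearCombination ℚ fun B => C.deltaMul A B

/-- The commutator `[X, Y] = X × Y - Y × X`. -/
def bracket (X Y : C.H) : C.H := C.hallMul X Y - C.hallMul Y X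

/-- The Ringel-Hall Lie algebra `n_C`: the primitive elements of `H_C`, that is, those `f` with
`Δ f = f ⊗ 1 + 1 ⊗ f`, where `(Δ f)(A, B) = f (A ⊕ B)` and `1 = δ_∅`. -/
def n : Submodule ℚ C.H where
  carrier := {f | ∀ A B M : C.Obj, C.IsSum A B M →
    f (C.cls M) = f (C.cls A) * C.delta (C.cls C.zero) (C.cls B)
      + C.delta (C.cls C.zero) (C.cls A) * f (C.cls B)}
  zero_mem' := by intro A B M _; simp
  add_mem' := by
    intro f g hf hg A B M h
    simp only [Finsupp.add_apply, hf A B M h, hg A B M h]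
    ring
  smul_mem' := by
    intro c f hf A B M h
    simp only [Finsupp.smul_apply, smul_eq_mul, hf A B M h]
    ring

/-- The functional `φ_A` on `H_C`, dual to `δ_A`. -/
def phi (A : C.Iso) : Module.Dual ℚ C.H := Finsupp.lapply A

/-- The restricted dual `H*_C` of `H_C`, spanned by all the `φ_A`. -/
def restrictedDual : Submodule ℚ (Module.Dual ℚ C.H) := Submodule.span ℚ (Set.range C.phi)

/-- The top-elimination action `φ · X`, dual to the right action of `H_C` on itself:
`(φ · X)(f) = - φ (f × X)`. -/
def topElim (φ : Module.Dual ℚ C.H) (X : C.H) : Module.Dual ℚ C.H :=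
  -(φ ∘ₗ C.hallMul.flip X)

/-- The isomorphism classes of subobjects of `M`. -/
def subClasses (M : C.Iso) : Set C.Iso := Set.range fun N : C.Sub M.out => C.cls (C.sub M.out N)

/-- The space `H_{≤ M}` spanned by the `φ_A` for `A` a subobject of `M`. -/
def below (M : C.Iso) : Submodule ℚ (Module.Dual ℚ C.H) :=
  Submodule.span ℚ (C.phi '' C.subClasses M)

end HallCat

theorem finite_of_code {α : Type*} {T : Type*} [Finite T] (s : Setoid α) (P : Set (Quotient s))
    (R : α → T → Prop) (h1 : ∀ c ∈ P, ∃ t, R c.out t)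
    (h2 : ∀ a b t, R a t → R b t → s.r a b) : P.Finite := by
  choose f hf using h1
  have : Finite P := by
    refine Finite.of_injective (fun c : P => f c.1 c.2) ?_
    intro c d h
    have h3 := hf c.1 c.2
    have h4 := hf d.1 d.2
    dsimp only at h
    rw [h] at h3
    apply Subtype.ext
    rw [← Quotient.out_eq c.1, ← Quotient.out_eq d.1]
    exact Quotient.sound (h2 _ _ _ h3 h4)
  exact Set.toFinite P

/-! ### Labeled rooted forests -/

/-- A finite rooted forest, given by its vertices and the parent of each vertex
(`none` for a root). -/
structure Forest where
  V : Type u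
  finV : Finite V
  parent : V → Option V
  wf : WellFounded fun a b => parent b = some a

namespace Forest

/-- An isomorphism of forests: a bijection of the vertices that preserves roots and edges. -/
structure Equiv (F G : Forest.{u}) where
  e : F.V ≃ G.V
  parent_eq : ∀ v, G.parent (e v) = (F.parent v).map e

/-- `F.Anc v w`: `v` lies on the path from `w` to the root of its tree (`v = w` is allowed). -/
def Anc (F : Forest.{u}) : F.V → F.V → Prop :=
  Relation.ReflTransGen fun a b => F.parent b = some a

/-- An admissible cut. The edge from a vertex up to its parent is recorded by that lower vertex,
and the full cut of a tree is recorded by its root. The condition says that at most one member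
of the cut is met on any path from a leaf to a root. -/
def Cut (F : Forest.{u}) : Type u := {c : Set F.V // IsAntichain F.Anc c}

/-- The vertices below the cut. -/
def Cut.lower {F : Forest.{u}} (c : F.Cut) : Set F.V := {w | ∃ v ∈ c.1, F.Anc v w}

open Classical in
/-- The forest induced on a set of vertices. -/
def restrict (F : Forest.{u}) (U : Set F.V) : Forest.{u} where
  V := U
  finV := by have := F.finV; infer_instance
  parent := fun v => (F.parent v.1).bind fun p => if h : p ∈ U then some ⟨p, h⟩ else none
  wf := by
    refine Subrelation.wf ?_ (InvImage.wf (fun v : U => v.1) F.wf)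
    intro a b h
    obtain ⟨p, hp, h2⟩ := Option.bind_eq_some_iff.mp h
    split_ifs at h2 with hU
    simp only [Option.some.injEq] at h2
    subst h2
    exact hp

/-- The disjoint union of two forests. -/
def disjUnion (F G : Forest.{u}) : Forest.{u} where
  V := F.V ⊕ G.V
  finV := by have := F.finV; have := G.finV; infer_instance
  parent := Sum.elim (fun v => (F.parent v).map Sum.inl) (fun v => (G.parent v).map Sum.inr)
  wf := by
    have hl : ∀ v : F.V, Acc (fun a b : F.V ⊕ G.V => (Sum.elim
        (fun v => (F.parent v).map Sum.inl) (fun v => (G.parent v).map Sum.inr) b) = some a)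
        (Sum.inl v) := by
      intro v
      induction v using F.wf.induction with
      | _ v ih =>
        refine Acc.intro _ ?_
        intro a ha
        simp only [Sum.elim_inl, Option.map_eq_some_iff] at ha
        obtain ⟨p, hp, rfl⟩ := ha
        exact ih p hp
    have hr : ∀ v : G.V, Acc (fun a b : F.V ⊕ G.V => (Sum.elim
        (fun v => (F.parent v).map Sum.inl) (fun v => (G.parent v).map Sum.inr) b) = some a)
        (Sum.inr v) := by
      intro v
      induction v using G.wf.induction with
      | _ v ih =>
        refine Acc.intro _ ?_
        intro a ha
        simp only [Sum.elim_inr, Option.map_eq_some_iff] at ha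
        obtain ⟨p, hp, rfl⟩ := ha
        exact ih p hp
    exact ⟨fun v => by cases v with
      | inl v => exact hl v
      | inr v => exact hr v⟩

/-- The empty forest. -/
def empty : Forest.{u} where
  V := PEmpty
  finV := inferInstance
  parent := fun v => v.elim
  wf := ⟨fun v => v.elim⟩

end Forest

/-- A rooted forest whose vertices are labeled injectively by elements of `S`. -/
structure LabeledForest (S : Type u) where
  forest : Forest.{u}
  label : forest.V ↪ S

namespace LabeledForest

variable {S : Type u}

/-- Isomorphism of labeled forests (labels need not be preserved). -/
def isoSetoid (S : Type u) : Setoid (LabeledForest S) where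
  r F G := Nonempty (F.forest.Equiv G.forest)
  iseqv := by
    refine ⟨fun F => ⟨⟨_root_.Equiv.refl _, ?_⟩⟩, ?_, ?_⟩
    · intro v
      simp
    · rintro F G ⟨f⟩
      refine ⟨⟨f.e.symm, ?_⟩⟩
      intro v
      have h := f.parent_eq (f.e.symm v)
      rw [f.e.apply_symm_apply] at h
      rw [h]
      simp [Option.map_map]
    · rintro F G K ⟨f⟩ ⟨g⟩
      refine ⟨⟨f.e.trans g.e, ?_⟩⟩
      intro v
      simp [g.parent_eq, f.parent_eq, Option.map_map]

/-- The labeled forest induced on a set of vertices. -/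
def restrict (F : LabeledForest S) (U : Set F.forest.V) : LabeledForest S where
  forest := F.forest.restrict U
  label := (Function.Embedding.subtype _).trans F.label

theorem finite_card_le (k : ℕ) :
    {c : Quotient (isoSetoid S) | Nat.card c.out.forest.V ≤ k}.Finite := by
  refine finite_of_code (T := Σ m : Fin (k + 1), (Fin m → Option (Fin m))) (isoSetoid S) _
    (fun F t => ∃ e : F.forest.V ≃ Fin t.1, ∀ v, t.2 (e v) = (F.forest.parent v).map e) ?_ ?_
  · intro c hc
    have := c.out.forest.finV
    let e := Finite.equivFin c.out.forest.V
    refine ⟨⟨⟨_, Nat.lt_succ_of_le hc⟩, fun i => (c.out.forest.parent (e.symm i)).map e⟩, e, ?_⟩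
    intro v
    simp
  · rintro F G t ⟨e, he⟩ ⟨g, hg⟩
    refine ⟨⟨e.trans g.symm, ?_⟩⟩
    intro v
    have h1 := hg (g.symm (e v))
    rw [g.apply_symm_apply, he] at h1
    have h2 := congrArg (Option.map g.symm) h1
    simp only [Option.map_map, Equiv.symm_comp_self, Option.map_id, id] at h2
    simp only [Equiv.trans_apply]
    rw [← h2]
    rfl

end LabeledForest

/-- The category of rooted forests labeled by `S`. The subobjects of `F` are the parts
`P_c(F)` below the admissible cuts `c` of `F`, the quotient of `F` by `P_c(F)` is the part
`R_c(F)` above the cut, and `⊕` is the disjoint union. -/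
def LRF (S : Type u) : HallCat.{u} where
  Obj := LabeledForest S
  iso := LabeledForest.isoSetoid S
  zero := ⟨Forest.empty, ⟨fun v => v.elim, fun v => v.elim⟩⟩
  IsSum A B M := Nonempty (M.forest.Equiv (A.forest.disjUnion B.forest))
  Sub F := F.forest.Cut
  sub_finite F := by
    have := F.forest.finV
    unfold Forest.Cut
    infer_instance
  sub F c := F.restrict c.lower
  IsQuot F c B := (LabeledForest.isoSetoid S).r (F.restrict c.lowerᶜ) B
  finite_ext A B := by
    refine (LabeledForest.finite_card_le (Nat.card A.forest.V + Nat.card B.forest.V)).subset ?_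
    rintro c ⟨N, ⟨f⟩, ⟨g⟩⟩
    have := c.out.forest.finV
    have h1 : Nat.card N.lower = Nat.card A.forest.V := Nat.card_congr f.e
    have h2 : Nat.card (N.lowerᶜ : Set _) = Nat.card B.forest.V := Nat.card_congr g.e
    have h3 := Set.ncard_add_ncard_compl N.lower
    simp only [Set.mem_ofPred_eq]
    rw [← h1, ← h2]
    exact h3.symm.le

/-! ### Labeled Feynman graphs -/

/-- A finite graph: half-edges `H`, vertices `V`, each half-edge being adjacent to exactly one
vertex `vert h` and to at most one other half-edge. -/
structure FGraph where
  V : Type u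
  H : Type u
  finV : Finite V
  finH : Finite H
  vert : H → V
  adj : H → H → Prop
  adj_symm : ∀ a b, adj a b → adj b a
  adj_irrefl : ∀ a, ¬ adj a a
  adj_unique : ∀ a b c, adj a b → adj a c → b = c

namespace FGraph

/-- An isomorphism of graphs: bijections of vertices and half-edges preserving all incidences. -/
structure Equiv (G K : FGraph.{u}) where
  eV : G.V ≃ K.V
  eH : G.H ≃ K.H
  vert_eq : ∀ h, K.vert (eH h) = eV (G.vert h)
  adj_iff : ∀ a b, K.adj (eH a) (eH b) ↔ G.adj a b

/-- The equivalence relation on vertices of being connected through those pairs of half-edges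
that satisfy `R`. -/
def connBy (G : FGraph.{u}) (R : G.H → G.H → Prop) : Setoid G.V :=
  Relation.EqvGen.setoid fun v w => ∃ a b, R a b ∧ G.vert a = v ∧ G.vert b = w

/-- Two vertices lie in the same connected component. -/
def Conn (G : FGraph.{u}) (v w : G.V) : Prop := (G.connBy G.adj).r v w

/-- Two vertices can be connected without using the internal edge `{a, b}`. -/
def ConnWithout (G : FGraph.{u}) (a b : G.H) (v w : G.V) : Prop :=
  (G.connBy fun x y => G.adj x y ∧ x ≠ a ∧ x ≠ b).r v w

/-- External edges: the half-edges that are not adjacent to another half-edge. -/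
def External (G : FGraph.{u}) (h : G.H) : Prop := ∀ k, ¬ G.adj h k

/-- A (one-particle irreducible, trivalent) Feynman graph. -/
structure IsFeynman (G : FGraph.{u}) : Prop where
  /-- each vertex is incident to exactly three half-edges -/
  trivalent : ∀ v, Nat.card {h // G.vert h = v} = 3
  /-- each connected component has two or three external edges -/
  legs : ∀ v, Nat.card {h // G.External h ∧ G.Conn v (G.vert h)} = 2 ∨
    Nat.card {h // G.External h ∧ G.Conn v (G.vert h)} = 3
  /-- each connected component has a loop, that is, an internal edge whose ends remain connected
  after the edge is removed -/
  loop : ∀ v, ∃ a b, G.adj a b ∧ G.Conn v (G.vert a) ∧ G.ConnWithout a b (G.vert a) (G.vert b)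
  /-- each connected component remains connected after removing any internal edge -/
  irred : ∀ a b, G.adj a b → ∀ v w, G.Conn v w → G.ConnWithout a b v w

/-- The graph with vertex set `W`, with all half-edges at these vertices, and with those
adjacencies of `G` that involve the half-edges in `J`. -/
def part (G : FGraph.{u}) (W : Set G.V) (J : Set G.H) : FGraph.{u} where
  V := W
  H := {h // G.vert h ∈ W}
  finV := by have := G.finV; infer_instance
  finH := by have := G.finH; infer_instance
  vert h := ⟨G.vert h.1, h.2⟩
  adj a b := G.adj a.1 b.1 ∧ a.1 ∈ J ∧ b.1 ∈ J
  adj_symm _ _ h := ⟨G.adj_symm _ _ h.1, h.2.2, h.2.1⟩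
  adj_irrefl _ h := G.adj_irrefl _ h.1
  adj_unique _ _ _ h k := Subtype.ext (G.adj_unique _ _ _ h.1 k.1)

/-- A Feynman subgraph: it is given by its set of vertices `W`, with all half-edges at
them, and by its set of internal edges, recorded as the set `J` of their half-edges.
An internal edge of `G` between vertices of the subgraph need not be internal in the subgraph;
if it is not, then its halves are external edges of the subgraph. -/
structure Subgraph (G : FGraph.{u}) where
  W : Set G.V
  J : Set G.H
  vert_mem : ∀ h ∈ J, G.vert h ∈ W
  adj_mem : ∀ h ∈ J, ∃ k ∈ J, G.adj h k
  isFeynman : (G.part W J).IsFeynman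

namespace Subgraph

variable {G : FGraph.{u}} (γ : G.Subgraph)

/-- Two vertices of `G` are identified when they lie in the same connected component of `γ`;
a vertex outside `γ` is identified only with itself. -/
def comp : Setoid G.V := G.connBy fun a b => G.adj a b ∧ a ∈ γ.J

/-- The half-edges that leave a class of `comp`: the external edges of a connected component
of `γ`, or all half-edges at a vertex outside `γ`. -/
def leaving (c : Quotient γ.comp) : Set G.H := {h | h ∉ γ.J ∧ Quotient.mk γ.comp (G.vert h) = c}

/-- The vertices of `G / γ`: the vertices outside `γ`, and one vertex for each connected
component of `γ` with three external edges. A component of `γ` that is a whole connected component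
of `G` (all of its external edges are external in `G`) leaves nothing behind. -/
def quotV : Set (Quotient γ.comp) :=
  {c | (γ.leaving c).ncard = 3 ∧ ∃ h ∈ γ.leaving c, ¬ G.External h}

/-- The half-edges `a`, `b` are the two external edges of a connected component of `γ` which has
exactly two external edges. -/
def Partner (a b : G.H) : Prop :=
  a ≠ b ∧ ∃ c, (γ.leaving c).ncard = 2 ∧ a ∈ γ.leaving c ∧ b ∈ γ.leaving c

/-- `a` is joined to `b` by an edge of `G`, or by a chain of edges of `G` that passes through
components of `γ` with two external edges. -/
inductive Chain : G.H → G.H → Prop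
  | edge (a b : G.H) : G.adj a b → Chain a b
  | step (a k l b : G.H) : G.adj a k → γ.Partner k l → Chain l b → Chain a b

variable {γ}

theorem Partner.symm {a b : G.H} (h : γ.Partner a b) : γ.Partner b a := by
  obtain ⟨h1, c, h2, h3, h4⟩ := h
  exact ⟨h1.symm, c, h2, h4, h3⟩

theorem Partner.unique {a b c : G.H} (h : γ.Partner a b) (k : γ.Partner a c) : b = c := by
  obtain ⟨h1, x, h2, h3, h4⟩ := h
  obtain ⟨k1, y, k2, k3, k4⟩ := k
  obtain rfl : x = y := h3.2.symm.trans k3.2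
  obtain ⟨p, q, _, hpq⟩ := Set.ncard_eq_two.mp h2
  rw [hpq] at h3 h4 k4
  simp only [Set.mem_insert_iff, Set.mem_singleton_iff] at h3 h4 k4
  grind

theorem Partner.notMem {a b : G.H} (h : γ.Partner a b) :
    Quotient.mk γ.comp (G.vert a) ∉ γ.quotV := by
  obtain ⟨_, x, h2, h3, _⟩ := h
  intro h4
  have h5 := h4.1
  rw [h3.2] at h5
  omega

theorem Chain.snoc {a b k l : G.H} (h : γ.Chain a k) (p : γ.Partner k l) (e : G.adj l b) :
    γ.Chain a b := by
  induction h with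
  | edge a k h => exact .step a k l b h p (.edge l b e)
  | step a k' l' k h q _ ih => exact .step a k' l' b h q (ih p)

theorem Chain.symm {a b : G.H} (h : γ.Chain a b) : γ.Chain b a := by
  induction h with
  | edge a b h => exact .edge b a (G.adj_symm _ _ h)
  | step a k l b h p _ ih => exact ih.snoc p.symm (G.adj_symm _ _ h)

theorem Chain.unique {a b c : G.H} (h : γ.Chain a b) (k : γ.Chain a c)
    (hb : Quotient.mk γ.comp (G.vert b) ∈ γ.quotV)
    (hc : Quotient.mk γ.comp (G.vert c) ∈ γ.quotV) : b = c := by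
  induction h with
  | edge a b h =>
    cases k with
    | edge _ _ k => exact G.adj_unique _ _ _ h k
    | step _ x y _ k p _ =>
      obtain rfl := G.adj_unique _ _ _ h k
      exact absurd hb p.notMem
  | step a x y b h p _ ih =>
    cases k with
    | edge _ _ k =>
      obtain rfl := G.adj_unique _ _ _ h k
      exact absurd hc p.notMem
    | step _ x' y' _ k p' r =>
      obtain rfl := G.adj_unique _ _ _ h k
      obtain rfl := p.unique p'
      exact ih r hb

variable (γ)

/-- The quotient graph `G / γ`. Each connected component of `γ` with three external edges is
contracted to a vertex to which these three are joined, each one with two external edges is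
replaced by an edge, and each one that is a whole connected component of `G` is removed. -/
def quot : FGraph.{u} where
  V := γ.quotV
  H := {h // h ∉ γ.J ∧ Quotient.mk γ.comp (G.vert h) ∈ γ.quotV}
  finV := by have := G.finV; infer_instance
  finH := by have := G.finH; infer_instance
  vert h := ⟨_, h.2.2⟩
  adj a b := a ≠ b ∧ γ.Chain a.1 b.1
  adj_symm _ _ h := ⟨h.1.symm, h.2.symm⟩
  adj_irrefl _ h := h.1 rfl
  adj_unique _ b c h k := Subtype.ext (h.2.unique k.2 b.2.2 c.2.2)

end Subgraph

/-- The disjoint union of two graphs. -/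
def disjUnion (G K : FGraph.{u}) : FGraph.{u} where
  V := G.V ⊕ K.V
  H := G.H ⊕ K.H
  finV := by have := G.finV; have := K.finV; infer_instance
  finH := by have := G.finH; have := K.finH; infer_instance
  vert := Sum.map G.vert K.vert
  adj := Sum.LiftRel G.adj K.adj
  adj_symm := by
    rintro _ _ (⟨h⟩ | ⟨h⟩)
    · exact .inl (G.adj_symm _ _ h)
    · exact .inr (K.adj_symm _ _ h)
  adj_irrefl := by
    rintro _ (⟨h⟩ | ⟨h⟩)
    · exact G.adj_irrefl _ h
    · exact K.adj_irrefl _ h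
  adj_unique := by
    rintro _ _ _ (⟨h⟩ | ⟨h⟩) (⟨k⟩ | ⟨k⟩)
    · rw [G.adj_unique _ _ _ h k]
    · rw [K.adj_unique _ _ _ h k]

/-- The empty graph. -/
def empty : FGraph.{u} where
  V := PEmpty
  H := PEmpty
  finV := inferInstance
  finH := inferInstance
  vert h := h
  adj _ _ := False
  adj_symm _ _ h := h
  adj_irrefl _ h := h
  adj_unique _ _ _ h := h.elim

theorem empty_isFeynman : FGraph.empty.{u}.IsFeynman where
  trivalent v := v.elim
  legs v := v.elim
  loop v := v.elim
  irred a := a.elim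

/-- In a Feynman graph every vertex is incident to an internal edge. -/
theorem IsFeynman.exists_internal {G : FGraph.{u}} (hG : G.IsFeynman) (v : G.V) :
    ∃ h, G.vert h = v ∧ ¬ G.External h := by
  have key : ∀ x y : G.V, Relation.EqvGen
      (fun v w => ∃ a b, G.adj a b ∧ G.vert a = v ∧ G.vert b = w) x y →
      x = y ∨ ((∃ h, G.vert h = x ∧ ¬ G.External h) ∧ ∃ h, G.vert h = y ∧ ¬ G.External h) := by
    intro x y h
    induction h with
    | rel x y h =>
      obtain ⟨a, b, h, rfl, rfl⟩ := h
      exact .inr ⟨⟨a, rfl, fun k => k b h⟩, ⟨b, rfl, fun k => k a (G.adj_symm _ _ h)⟩⟩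
    | refl x => exact .inl rfl
    | symm x y _ ih => exact ih.imp Eq.symm And.symm
    | trans x y z _ _ h1 h2 =>
      rcases h1 with rfl | h1
      · exact h2
      · rcases h2 with rfl | h2
        · exact .inr h1
        · exact .inr ⟨h1.1, h2.2⟩
  obtain ⟨a, b, h, h1, _⟩ := hG.loop v
  rcases key _ _ h1 with h2 | h2
  · exact ⟨a, h2.symm, fun k => k b h⟩
  · exact h2.1

theorem IsFeynman.card_H {G : FGraph.{u}} (hG : G.IsFeynman) :
    Nat.card G.H = Nat.card G.V * 3 := by
  have := G.finV
  have := G.finH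
  have := Fintype.ofFinite G.V
  rw [← Nat.card_congr (_root_.Equiv.sigmaFiberEquiv G.vert), Nat.card_sigma]
  simp [hG.trivalent, Nat.card_eq_fintype_card]

theorem Subgraph.mem_quotV {G : FGraph.{u}} (hG : G.IsFeynman) (γ : G.Subgraph) (v : G.V)
    (hv : v ∉ γ.W) :
    Quotient.mk γ.comp v ∈ γ.quotV ∧
      ∀ w, Quotient.mk γ.comp w = Quotient.mk γ.comp v → w = v := by
  have key : ∀ x y : G.V, Relation.EqvGen
      (fun v w => ∃ a b, (G.adj a b ∧ a ∈ γ.J) ∧ G.vert a = v ∧ G.vert b = w) x y →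
      x = y ∨ (x ∈ γ.W ∧ y ∈ γ.W) := by
    intro x y h
    induction h with
    | rel x y h =>
      obtain ⟨a, b, ⟨h, ha⟩, rfl, rfl⟩ := h
      obtain ⟨k, hk, h'⟩ := γ.adj_mem a ha
      obtain rfl := G.adj_unique _ _ _ h h'
      exact .inr ⟨γ.vert_mem _ ha, γ.vert_mem _ hk⟩
    | refl x => exact .inl rfl
    | symm x y _ ih => exact ih.imp Eq.symm And.symm
    | trans x y z _ _ h1 h2 => grind
  have h1 : ∀ w, Quotient.mk γ.comp w = Quotient.mk γ.comp v → w = v := by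
    intro w hw
    rcases key _ _ (Quotient.exact (s := γ.comp) hw) with h | h
    · exact h
    · exact absurd h.2 hv
  have h2 : γ.leaving (Quotient.mk γ.comp v) = {h | G.vert h = v} := by
    ext h
    constructor
    · rintro ⟨_, h3⟩
      exact h1 _ h3
    · rintro rfl
      exact ⟨fun h3 => hv (γ.vert_mem _ h3), rfl⟩
  refine ⟨⟨?_, ?_⟩, h1⟩
  · rw [h2]
    exact hG.trivalent v
  · rw [h2]
    exact hG.exists_internal v

theorem Subgraph.card_le {G : FGraph.{u}} (hG : G.IsFeynman) (γ : G.Subgraph) :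
    Nat.card G.V ≤ Nat.card (G.part γ.W γ.J).V + Nat.card γ.quot.V := by
  have := G.finV
  have := γ.quot.finV
  have h : Nat.card (γ.Wᶜ : Set G.V) ≤ Nat.card γ.quot.V := by
    refine Nat.card_le_card_of_injective
      (fun v => (⟨Quotient.mk γ.comp v.1, (γ.mem_quotV hG v.1 v.2).1⟩ : γ.quotV)) ?_
    intro v w hvw
    exact Subtype.ext ((γ.mem_quotV hG w.1 w.2).2 _ (Subtype.ext_iff.mp hvw))
  have h3 := Set.ncard_add_ncard_compl γ.W
  rw [← h3]
  exact Nat.add_le_add_left h _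

end FGraph

/-- A labeled Feynman graph: a Feynman graph together with a set `S` and a bijection of the set of
half-edges with `S`. The empty graph is included. -/
structure LabeledFeynmanGraph where
  graph : FGraph.{u}
  isFeynman : graph.IsFeynman
  S : Type u
  label : graph.H ≃ S

namespace LabeledFeynmanGraph

/-- Isomorphism of labeled Feynman graphs (labels need not be preserved). -/
def isoSetoid : Setoid LabeledFeynmanGraph.{u} where
  r G K := Nonempty (G.graph.Equiv K.graph)
  iseqv := by
    refine ⟨fun G => ⟨⟨Equiv.refl _, Equiv.refl _, fun _ => rfl, fun _ _ => Iff.rfl⟩⟩, ?_, ?_⟩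
    · rintro G K ⟨f⟩
      refine ⟨⟨f.eV.symm, f.eH.symm, ?_, ?_⟩⟩
      · intro h
        rw [Equiv.eq_symm_apply, ← f.vert_eq, Equiv.apply_symm_apply]
      · intro a b
        rw [← f.adj_iff, Equiv.apply_symm_apply, Equiv.apply_symm_apply]
    · rintro G K L ⟨f⟩ ⟨g⟩
      refine ⟨⟨f.eV.trans g.eV, f.eH.trans g.eH, ?_, ?_⟩⟩
      · intro h
        simp [g.vert_eq, f.vert_eq]
      · intro a b
        simp [g.adj_iff, f.adj_iff]

/-- A Feynman subgraph with the inherited labels. -/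
def sub (G : LabeledFeynmanGraph.{u}) (γ : G.graph.Subgraph) : LabeledFeynmanGraph.{u} where
  graph := G.graph.part γ.W γ.J
  isFeynman := γ.isFeynman
  S := {s : G.S // G.graph.vert (G.label.symm s) ∈ γ.W}
  label := G.label.subtypeEquiv (by simp)

theorem finite_card_le (k l : ℕ) :
    {c : Quotient isoSetoid.{u} | Nat.card c.out.graph.V ≤ k ∧
      Nat.card c.out.graph.H ≤ l}.Finite := by
  refine finite_of_code (T := Σ m : Fin (k + 1), Σ n : Fin (l + 1),
      (Fin n → Fin m) × (Fin n → Fin n → Prop)) isoSetoid _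
    (fun G t => ∃ (eV : G.graph.V ≃ Fin t.1) (eH : G.graph.H ≃ Fin t.2.1),
      (∀ h, t.2.2.1 (eH h) = eV (G.graph.vert h)) ∧
      ∀ a b, t.2.2.2 (eH a) (eH b) ↔ G.graph.adj a b) ?_ ?_
  · rintro c ⟨hc, hd⟩
    have := c.out.graph.finV
    have := c.out.graph.finH
    let e := Finite.equivFin c.out.graph.V
    let g := Finite.equivFin c.out.graph.H
    refine ⟨⟨⟨_, Nat.lt_succ_of_le hc⟩, ⟨_, Nat.lt_succ_of_le hd⟩,
      fun i => e (c.out.graph.vert (g.symm i)),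
      fun i j => c.out.graph.adj (g.symm i) (g.symm j)⟩, e, g, ?_, ?_⟩
    · intro h
      simp
    · intro a b
      simp
  · rintro F G t ⟨e, f, h1, h2⟩ ⟨e', f', h1', h2'⟩
    refine ⟨⟨e.trans e'.symm, f.trans f'.symm, ?_, ?_⟩⟩
    · intro h
      simp only [Equiv.trans_apply]
      rw [Equiv.eq_symm_apply, ← h1', Equiv.apply_symm_apply, h1]
    · intro a b
      rw [← h2, ← h2']
      simp

end LabeledFeynmanGraph

/-- The category of labeled Feynman graphs. The subobjects of `G` are its Feynman subgraphs `γ`,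
quotients are the quotient graphs `G / γ`, and `⊕` is the disjoint union. -/
def LFG : HallCat.{u} where
  Obj := LabeledFeynmanGraph
  iso := LabeledFeynmanGraph.isoSetoid
  zero := ⟨FGraph.empty, FGraph.empty_isFeynman, PEmpty, Equiv.refl _⟩
  IsSum A B M := Nonempty (M.graph.Equiv (A.graph.disjUnion B.graph))
  Sub G := G.graph.Subgraph
  sub_finite G := by
    have := G.graph.finV
    have := G.graph.finH
    refine Finite.of_injective
      (fun γ : G.graph.Subgraph => ((γ.W, γ.J) : Set G.graph.V × Set G.graph.H)) ?_
    rintro ⟨W, J, _, _, _⟩ ⟨W', J', _, _, _⟩ h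
    simp only [Prod.mk.injEq] at h
    obtain ⟨rfl, rfl⟩ := h
    rfl
  sub G γ := G.sub γ
  IsQuot _ γ B := Nonempty (γ.quot.Equiv B.graph)
  finite_ext A B := by
    refine (LabeledFeynmanGraph.finite_card_le (Nat.card A.graph.V + Nat.card B.graph.V)
      ((Nat.card A.graph.V + Nat.card B.graph.V) * 3)).subset ?_
    rintro c ⟨γ, ⟨f⟩, ⟨g⟩⟩
    have h1 := γ.card_le c.out.isFeynman
    have h2 : Nat.card (c.out.graph.part γ.W γ.J).V = Nat.card A.graph.V := Nat.card_congr f.eV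
    have h3 : Nat.card γ.quot.V = Nat.card B.graph.V := Nat.card_congr g.eV
    have h4 := c.out.isFeynman.card_H
    simp only [Set.mem_ofPred_eq]
    omega

end

/-! Both categories satisfy the same short list of properties, collected in `HallCat.Laws`, and the
theorem is formal once they are known. A flag K ⊂ N ⊂ M amounts to a subobject K of M together with
the subobject N/K of M/K, and the subquotients agree. Summing over flags in these two ways makes the
Hall product associative (`hallMul_assoc`), which gives the Jacobi identity and the representation
identity. Subobjects of A ⊕ B are sums of subobjects of A and of B. Hence X × Y, for primitive X and
Y, fails to be primitive on A ⊕ B only by X(A)Y(B) + X(B)Y(A), which is symmetric in X and Y and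
cancels in the bracket (`hallMul_primitive_apply`). The formula for the action compares Hall numbers
on delta functions. It shows that the span of the φ_A is stable whenever the set of classes A is
closed under subobjects (`topElim_mem_span`).

For forests, an admissible cut is the same as a descendant-closed set of vertices
(`Forest.cutEquiv`), and the laws become identities between sets.

For Feynman graphs, a subgraph is determined by the set J of halves of its internal edges, and the
sets that occur are those satisfying `Good`. Half-edges of G/J are joined by chains alternating
between edges of G and passages through components of J with two legs. Both kinds of step are
partial involutions, so a chain has at most two ends (`ZigEqv.ends_unique`). The crux is that good
sets S ⊇ J in G correspond to good sets in G/J. One-particle irreducibility forces S to contain both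
or neither of the legs of a two-legged component of J (`Good.compat`), and then connectivity, legs
and irreducibility pass down to G/J (`IsQuot.good_preimage`) and back up
(`IsQuot.good_of_preimage`). The subquotients are compared in `quot_part_equiv` and
`quot_quot_equiv`. Isomorphisms are obtained by presenting both objects inside one ambient set
(`Presents.equiv`), which avoids explicit maps between nested subtypes and quotients. -/

noncomputable section

/-! ### Hall algebras from abstract laws for subobjects and quotients -/

namespace HallCat

variable (C : HallCat.{u})

/-- Structural laws satisfied by the subobjects and quotients of a category, sufficient for its
Ringel-Hall algebra to be associative and for its primitive elements to form a Lie algebra. -/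
structure Laws where
  /-- a chosen quotient object -/
  quo : (M : C.Obj) → C.Sub M → C.Obj
  isQuot_iff : ∀ M N B, C.IsQuot M N B ↔ C.iso.r (quo M N) B
  transport : ∀ M M', C.iso.r M M' → ∃ e : C.Sub M ≃ C.Sub M', ∀ N,
    C.iso.r (C.sub M N) (C.sub M' (e N)) ∧ C.iso.r (quo M N) (quo M' (e N))
  /-- two-step flags in `M` are the same as subobjects of quotients of `M` -/
  flags : ∀ M, ∃ (T : Type u) (p : (Σ N : C.Sub M, C.Sub (C.sub M N)) ≃ T)
    (q : (Σ N : C.Sub M, C.Sub (quo M N)) ≃ T), ∀ x y, p x = q y →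
      C.iso.r (C.sub (C.sub M x.1) x.2) (C.sub M y.1) ∧
      C.iso.r (quo (C.sub M x.1) x.2) (C.sub (quo M y.1) y.2) ∧
      C.iso.r (quo M x.1) (quo (quo M y.1) y.2)
  sum : ∀ A B M, C.IsSum A B M → ∃ e : C.Sub M ≃ C.Sub A × C.Sub B, ∀ N,
    C.IsSum (C.sub A (e N).1) (C.sub B (e N).2) (C.sub M N) ∧
    C.IsSum (quo A (e N).1) (quo B (e N).2) (quo M N)
  bot : ∀ M, ∃ N₀, C.iso.r (C.sub M N₀) C.zero ∧ C.iso.r (quo M N₀) M ∧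
    ∀ N, C.iso.r (C.sub M N) C.zero → N = N₀
  top : ∀ M, ∃ N₁, C.iso.r (quo M N₁) C.zero ∧ C.iso.r (C.sub M N₁) M ∧
    ∀ N, C.iso.r (quo M N) C.zero → N = N₁

variable {C}

theorem cls_eq_iff {A B : C.Obj} : C.cls A = C.cls B ↔ C.iso.r A B :=
  ⟨fun h => Quotient.exact (s := C.iso) h, fun h => Quotient.sound (s := C.iso) h⟩

theorem cls_out (c : C.Iso) : C.cls c.out = c := Quotient.out_eq c

theorem delta_zero_apply (A : C.Obj) [Decidable (C.iso.r A C.zero)] :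
    C.delta (C.cls C.zero) (C.cls A) = if C.iso.r A C.zero then 1 else 0 := by
  classical
  rw [delta, Finsupp.single_apply]
  have : C.cls C.zero = C.cls A ↔ C.iso.r A C.zero := by rw [eq_comm, cls_eq_iff]
  simp only [this]

instance (M : C.Obj) : Finite (C.Sub M) := C.sub_finite M

instance (M : C.Obj) : Fintype (C.Sub M) := Fintype.ofFinite _

theorem hallMul_single (A B c : C.Iso) (a b : ℚ) :
    C.hallMul (Finsupp.single A a) (Finsupp.single B b) c = a * b * C.hallNumber A B c := by
  simp [hallMul, deltaMul, mul_assoc, Finsupp.ofSupportFinite_coe]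

/-- It suffices to test on the basis: at δ_D both sides are minus the number of subobjects of B
isomorphic to D with quotient A. -/
theorem topElim_phi_delta (A B : C.Iso) : C.topElim (C.phi B) (C.delta A) =
    -∑ᶠ N ∈ C.subsWithQuot B A, C.phi (C.cls (C.sub B.out N)) := by
  classical
  refine Finsupp.lhom_ext fun D d => ?_
  rw [finsum_mem_eq_finite_toFinset_sum _ (Set.toFinite _)]
  have h : ∀ (s : Finset (C.Sub B.out)) (x : C.H),
      (-∑ N ∈ s, C.phi (C.cls (C.sub B.out N))) x
        = -∑ N ∈ s, x (C.cls (C.sub B.out N)) := by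
    intro s x
    simp [phi]
  rw [h]
  change -(C.hallMul (Finsupp.single D d) (Finsupp.single A 1) B) = _
  rw [hallMul_single, hallNumber, Nat.card_eq_fintype_card, Fintype.card_subtype,
    mul_one]
  simp only [Finsupp.single_apply, eq_comm (a := D)]
  rw [← Finset.sum_filter, Finset.sum_const, nsmul_eq_mul, mul_comm]
  congr 4
  ext N
  simp [and_comm]

/-- Common source of the stability of the restricted dual (all classes) and of H_{≤ M} (classes of
subobjects of M). By linearity only φ_B · δ_A matters, and this involves only subobjects of B. -/
theorem topElim_mem_span {s : Set C.Iso} {X : C.H}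
    (h : ∀ A ∈ s, ∀ N : C.Sub A.out, C.cls (C.sub A.out N) ∈ s)
    {φ : Module.Dual ℚ C.H} (hφ : φ ∈ Submodule.span ℚ (C.phi '' s)) :
    C.topElim φ X ∈ Submodule.span ℚ (C.phi '' s) := by
  induction hφ using Submodule.span_induction with
  | mem φ hφ =>
    obtain ⟨B, hB, rfl⟩ := hφ
    induction X using Finsupp.induction_linear with
    | zero => simp [topElim]
    | add X Y hX hY =>
      have : C.topElim (C.phi B) (X + Y) = C.topElim (C.phi B) X + C.topElim (C.phi B) Y := by
        simp only [topElim, map_add, LinearMap.comp_add, neg_add]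
      rw [this]
      exact add_mem hX hY
    | single A a =>
      have : C.topElim (C.phi B) (Finsupp.single A a) = a • C.topElim (C.phi B) (C.delta A) := by
        rw [topElim, topElim, delta, ← mul_one a, ← smul_eq_mul, ← Finsupp.smul_single]
        simp only [map_smul, LinearMap.comp_smul, smul_neg, smul_eq_mul, mul_one]
      rw [this, topElim_phi_delta]
      refine Submodule.smul_mem _ _ (neg_mem ?_)
      exact finsum_mem_induction (· ∈ Submodule.span ℚ (C.phi '' s)) (zero_mem _)
        (fun _ _ => add_mem)
        fun N _ => Submodule.subset_span ⟨_, h B hB N, rfl⟩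
  | zero => simp [topElim]
  | add φ ψ _ _ h1 h2 =>
    have : C.topElim (φ + ψ) X = C.topElim φ X + C.topElim ψ X := by
      simp only [topElim, LinearMap.add_comp, neg_add]
    rw [this]
    exact add_mem h1 h2
  | smul a φ _ h1 =>
    have : C.topElim (a • φ) X = a • C.topElim φ X := by
      simp only [topElim, LinearMap.smul_comp, smul_neg]
    rw [this]
    exact Submodule.smul_mem _ _ h1

theorem topElim_mem_restrictedDual {φ : Module.Dual ℚ C.H} (hφ : φ ∈ C.restrictedDual)
    (X : C.H) : C.topElim φ X ∈ C.restrictedDual := by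
  rw [restrictedDual, ← Set.image_univ] at *
  exact topElim_mem_span (fun _ _ _ => Set.mem_univ _) hφ

namespace Laws

theorem mem_subsWithQuot (L : C.Laws) (M B : C.Iso) (N : C.Sub M.out) :
    N ∈ C.subsWithQuot M B ↔ C.cls (L.quo M.out N) = B := by
  have : C.cls (L.quo M.out N) = B ↔ C.cls (L.quo M.out N) = C.cls B.out := by rw [cls_out]
  rw [this, cls_eq_iff, ← L.isQuot_iff]
  rfl

theorem hallMul_apply_out (L : C.Laws) (f g : C.H) (c : C.Iso) :
    C.hallMul f g c =
      ∑ N : C.Sub c.out, f (C.cls (C.sub c.out N)) * g (C.cls (L.quo c.out N)) := by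
  classical
  induction f using Finsupp.induction_linear with
  | zero => simp
  | add f₁ f₂ h₁ h₂ => simp [h₁, h₂, add_mul, Finset.sum_add_distrib]
  | single A a =>
    induction g using Finsupp.induction_linear with
    | zero => simp
    | add g₁ g₂ h₁ h₂ => simp [h₁, h₂, mul_add, Finset.sum_add_distrib]
    | single B b =>
      rw [hallMul_single, hallNumber, Nat.card_eq_fintype_card, Fintype.card_subtype,
        Finset.card_filter]
      push_cast
      rw [Finset.mul_sum]
      refine Finset.sum_congr rfl fun N _ => ?_
      rw [L.mem_subsWithQuot, Finsupp.single_apply, Finsupp.single_apply]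
      simp only [eq_comm (a := A), eq_comm (a := B)]
      split_ifs <;> simp_all

/-- The product is defined through chosen representatives of classes; `transport` frees the formula
from that choice, so that it can be applied to a subobject or a quotient itself. -/
theorem hallMul_apply (L : C.Laws) (f g : C.H) (M : C.Obj) :
    C.hallMul f g (C.cls M) =
      ∑ N : C.Sub M, f (C.cls (C.sub M N)) * g (C.cls (L.quo M N)) := by
  rw [L.hallMul_apply_out]
  obtain ⟨e, he⟩ := L.transport _ _ (cls_eq_iff.mp (cls_out (C.cls M)))
  refine Fintype.sum_equiv e _ _ fun N => ?_
  rw [cls_eq_iff.mpr (he N).1, cls_eq_iff.mpr (he N).2]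

/-- Expanding the products gives one sum over flags and one over subobjects of quotients; `flags`
matches them term by term. -/
theorem hallMul_assoc (L : C.Laws) (f g h : C.H) :
    C.hallMul (C.hallMul f g) h = C.hallMul f (C.hallMul g h) := by
  ext c
  obtain ⟨M, rfl⟩ : ∃ M, C.cls M = c := ⟨c.out, cls_out c⟩
  rw [L.hallMul_apply, L.hallMul_apply]
  simp only [L.hallMul_apply, Finset.sum_mul, Finset.mul_sum]
  rw [← Fintype.sum_sigma' (fun (N : C.Sub M) (K : C.Sub (C.sub M N)) =>
      f (C.cls (C.sub (C.sub M N) K)) * g (C.cls (L.quo (C.sub M N) K)) * h (C.cls (L.quo M N))),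
    ← Fintype.sum_sigma' (fun (N : C.Sub M) (K : C.Sub (L.quo M N)) =>
      f (C.cls (C.sub M N)) * (g (C.cls (C.sub (L.quo M N) K)) *
        h (C.cls (L.quo (L.quo M N) K))))]
  obtain ⟨T, p, q, hpq⟩ := L.flags M
  refine Fintype.sum_equiv (p.trans q.symm) _ _ fun x => ?_
  obtain ⟨h1, h2, h3⟩ := hpq x (q.symm (p x)) (by simp)
  simp only [Equiv.trans_apply]
  rw [cls_eq_iff.mpr h1, cls_eq_iff.mpr h2, cls_eq_iff.mpr h3, mul_assoc]

/-- Together with `sum_delta_quo`, this says that δ_∅ is a two-sided unit, because exactly one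
subobject is zero and exactly one has zero quotient. -/
theorem sum_delta_sub (L : C.Laws) (h : C.Iso → ℚ) (M : C.Obj) :
    ∑ N : C.Sub M, C.delta (C.cls C.zero) (C.cls (C.sub M N)) * h (C.cls (L.quo M N)) =
      h (C.cls M) := by
  classical
  obtain ⟨N₀, h1, h2, h3⟩ := L.bot M
  rw [Finset.sum_eq_single N₀]
  · rw [delta_zero_apply, if_pos h1, one_mul, cls_eq_iff.mpr h2]
  · intro N _ hN
    rw [delta_zero_apply, if_neg fun h => hN (h3 N h), zero_mul]
  · simp

theorem sum_delta_quo (L : C.Laws) (h : C.Iso → ℚ) (M : C.Obj) :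
    ∑ N : C.Sub M, h (C.cls (C.sub M N)) * C.delta (C.cls C.zero) (C.cls (L.quo M N)) =
      h (C.cls M) := by
  classical
  obtain ⟨N₀, h1, h2, h3⟩ := L.top M
  rw [Finset.sum_eq_single N₀]
  · rw [delta_zero_apply, if_pos h1, mul_one, cls_eq_iff.mpr h2]
  · intro N _ hN
    rw [delta_zero_apply, if_neg fun h => hN (h3 N h), mul_zero]
  · simp

/-- Primitivity of X and Y splits each summand into four, and each of the four sums factors over A
and B. Two of them form the primitive part; the other two are a cross term symmetric in X and Y. -/
theorem hallMul_primitive_apply (L : C.Laws) {X Y : C.H} (hX : X ∈ C.n) (hY : Y ∈ C.n)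
    {A B M : C.Obj}
    (h : C.IsSum A B M) :
    C.hallMul X Y (C.cls M) =
      C.hallMul X Y (C.cls A) * C.delta (C.cls C.zero) (C.cls B)
        + C.delta (C.cls C.zero) (C.cls A) * C.hallMul X Y (C.cls B)
        + X (C.cls A) * Y (C.cls B) + X (C.cls B) * Y (C.cls A) := by
  obtain ⟨e, he⟩ := L.sum A B M h
  have key : C.hallMul X Y (C.cls M) = ∑ p : C.Sub A × C.Sub B,
      (X (C.cls (C.sub A p.1)) * C.delta (C.cls C.zero) (C.cls (C.sub B p.2))
        + C.delta (C.cls C.zero) (C.cls (C.sub A p.1)) * X (C.cls (C.sub B p.2))) *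
      (Y (C.cls (L.quo A p.1)) * C.delta (C.cls C.zero) (C.cls (L.quo B p.2))
        + C.delta (C.cls C.zero) (C.cls (L.quo A p.1)) * Y (C.cls (L.quo B p.2))) := by
    rw [L.hallMul_apply]
    refine Fintype.sum_equiv e _ _ fun N => ?_
    rw [hX _ _ _ (he N).1, hY _ _ _ (he N).2]
  have expand : ∀ x x' d d' y y' z z' : ℚ, (x * d' + d * x') * (y * z' + z * y') =
      (x * y) * (d' * z') + (x * z) * (d' * y') + (d * y) * (x' * z') + (d * z) * (x' * y') := by
    intros; ring
  simp only [key, expand, Finset.sum_add_distrib, Fintype.sum_prod_type, ← Finset.sum_mul_sum]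
  have h1 : ∀ D, ∑ N, X (C.cls (C.sub D N)) * Y (C.cls (L.quo D N)) =
      C.hallMul X Y (C.cls D) := fun D => (L.hallMul_apply X Y D).symm
  simp only [h1, L.sum_delta_quo X, L.sum_delta_sub Y, L.sum_delta_sub (C.delta (C.cls C.zero))]
  ring

theorem bracket_mem (L : C.Laws) {X Y : C.H} (hX : X ∈ C.n)
    (hY : Y ∈ C.n) : C.bracket X Y ∈ C.n := by
  intro A B M h
  simp only [bracket, Finsupp.sub_apply, L.hallMul_primitive_apply hX hY h,
    L.hallMul_primitive_apply hY hX h]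
  ring

theorem jacobi (L : C.Laws) (X Y Z : C.H) :
    C.bracket X (C.bracket Y Z) + C.bracket Y (C.bracket Z X)
      + C.bracket Z (C.bracket X Y) = 0 := by
  simp only [bracket, map_sub, LinearMap.sub_apply, L.hallMul_assoc]
  abel

/-- Dualizing right multiplication reverses the order of the factors; the minus sign in the action
compensates for this, so that a right representation results. -/
theorem topElim_bracket (L : C.Laws) (φ : Module.Dual ℚ C.H) (X Y : C.H) :
    C.topElim φ (C.bracket X Y) =
      C.topElim (C.topElim φ X) Y - C.topElim (C.topElim φ Y) X := by
  ext f
  simp [topElim, bracket, L.hallMul_assoc]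

/-- The first isomorphism in `flags` makes a subobject of a subobject a subobject; `transport`
passes from the chosen representative of A to the actual subobject of M. -/
theorem subClasses_trans (L : C.Laws) (M : C.Iso) {A : C.Iso} (hA : A ∈ C.subClasses M)
    (N : C.Sub A.out) : C.cls (C.sub A.out N) ∈ C.subClasses M := by
  obtain ⟨K, rfl⟩ := hA
  obtain ⟨e, he⟩ := L.transport _ _ (cls_eq_iff.mp (cls_out (C.cls (C.sub M.out K))))
  obtain ⟨T, p, q, hpq⟩ := L.flags M.out
  obtain ⟨h1, -, -⟩ := hpq ⟨K, e N⟩ (q.symm (p ⟨K, e N⟩)) (by simp)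
  exact ⟨_, ((cls_eq_iff.mpr (he N).1).trans (cls_eq_iff.mpr h1)).symm⟩

theorem topElim_mem_below (L : C.Laws) {M : C.Iso} {φ : Module.Dual ℚ C.H} (hφ : φ ∈ C.below M)
    (X : C.H) : C.topElim φ X ∈ C.below M :=
  topElim_mem_span (fun _ hA N => L.subClasses_trans M hA N) hφ

end Laws

theorem below_le (M : C.Iso) : C.below M ≤ C.restrictedDual :=
  Submodule.span_mono (Set.image_subset_range _ _)

theorem below_finiteDimensional (M : C.Iso) : FiniteDimensional ℚ (C.below M) :=
  FiniteDimensional.span_of_finite ℚ ((Set.finite_range _).image _)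

end HallCat

/-! ### Rooted forests: cuts as descendant-closed sets -/

namespace Forest

/-- A set of vertices closed under passing to children. -/
def DescClosed (F : Forest.{u}) (U : Set F.V) : Prop :=
  ∀ p v, p ∈ U → F.parent v = some p → v ∈ U

theorem DescClosed.anc {F : Forest.{u}} {U : Set F.V} (hU : F.DescClosed U) {v w : F.V}
    (h : F.Anc v w) (hv : v ∈ U) : w ∈ U := by
  induction h with
  | refl => exact hv
  | tail _ h ih => exact hU _ _ ih h

theorem Anc.antisymm {F : Forest.{u}} {v w : F.V} (h : F.Anc v w) (k : F.Anc w v) : v = w := by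
  rcases Relation.reflTransGen_iff_eq_or_transGen.mp h with h | h
  · exact h.symm
  · exact absurd (h.trans_left k) (F.wf.transGen.irrefl.irrefl v)

theorem Cut.descClosed_lower {F : Forest.{u}} (c : F.Cut) : F.DescClosed c.lower := by
  rintro p v ⟨w, hw, h⟩ hv
  exact ⟨w, hw, h.tail hv⟩

/-- An admissible cut is determined by the part below it, which can be any set of vertices
closed under passing to children. -/
def cutEquiv (F : Forest.{u}) : F.Cut ≃ {U : Set F.V // F.DescClosed U} :=
  _root_.Equiv.ofBijective (fun c => ⟨c.lower, c.descClosed_lower⟩) <| by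
    constructor
    -- A vertex v of c lies below some w in d, which lies below some x in c; the antichain condition
    -- gives x = v, and then w = v.
    · have key : ∀ c d : F.Cut, c.lower = d.lower → c.1 ⊆ d.1 := by
        intro c d h v hv
        obtain ⟨w, hw, h1⟩ : v ∈ d.lower := h ▸ ⟨v, hv, .refl⟩
        obtain ⟨x, hx, h2⟩ : w ∈ c.lower := h ▸ ⟨w, hw, .refl⟩
        have h3 : x = v := by
          by_contra hne
          exact c.2 hx hv hne (h2.trans h1)
        subst h3
        rwa [Anc.antisymm h2 h1]
      intro c d h
      have h' := Subtype.ext_iff.mp h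
      exact Subtype.ext ((key c d h').antisymm (key d c h'.symm))
    · rintro ⟨U, hU⟩
      -- The cut consists of the topmost vertices of U. If one of them were strictly above another,
      -- the parent of the lower one would lie in U.
      refine ⟨⟨{v | v ∈ U ∧ ∀ p, F.parent v = some p → p ∉ U}, ?_⟩, ?_⟩
      · intro v hv w hw hne h
        rcases Relation.ReflTransGen.cases_tail h with h | ⟨p, h1, h2⟩
        · exact hne h.symm
        · exact hw.2 p h2 (hU.anc h1 hv.1)
      · refine Subtype.ext (Set.Subset.antisymm ?_ ?_)
        · rintro v ⟨w, hw, h⟩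
          exact hU.anc h hw.1
        · intro v
          induction v using F.wf.induction with
          | _ v ih =>
            intro hv
            by_cases h : ∃ p, F.parent v = some p ∧ p ∈ U
            · obtain ⟨p, h1, h2⟩ := h
              obtain ⟨w, hw, h3⟩ := ih p h1 h2
              exact ⟨w, hw, h3.tail h1⟩
            · exact ⟨v, ⟨hv, fun p h1 h2 => h ⟨p, h1, h2⟩⟩, .refl⟩

/-- The cut with a given part below it. -/
def cutOf (F : Forest.{u}) (U : Set F.V) (hU : F.DescClosed U) : F.Cut := F.cutEquiv.symm ⟨U, hU⟩

@[simp]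
theorem lower_cutOf (F : Forest.{u}) (U : Set F.V) (hU : F.DescClosed U) :
    (F.cutOf U hU).lower = U :=
  congrArg Subtype.val (F.cutEquiv.apply_symm_apply ⟨U, hU⟩)

theorem Cut.ext_lower {F : Forest.{u}} {c d : F.Cut} (h : c.lower = d.lower) : c = d :=
  F.cutEquiv.injective (Subtype.ext h)

/-- The forest `P` is realized inside a set `X`: its vertices correspond to `D ⊆ X` and its
edges to the relation `r` on `D`. -/
structure Presents (P : Forest.{u}) {X : Type u} (i : P.V → X) (D : Set X) (r : X → X → Prop) :
    Prop where
  inj : Function.Injective i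
  range_eq : Set.range i = D
  parent_iff : ∀ a b, P.parent b = some a ↔ r (i a) (i b)

/-- A presentation determines the forest up to isomorphism, so that comparing iterated restrictions
is reduced to comparing subsets of one vertex set. -/
theorem Presents.equiv {P Q : Forest.{u}} {X : Type u} {i : P.V → X} {j : Q.V → X} {D D' : Set X}
    {r r' : X → X → Prop} (h : P.Presents i D r) (k : Q.Presents j D' r') (hD : D = D')
    (hr : ∀ x ∈ D, ∀ y ∈ D, (r x y ↔ r' x y)) : Nonempty (P.Equiv Q) := by
  subst hD
  let e : P.V ≃ Q.V := ((_root_.Equiv.ofInjective i h.inj).trans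
    (_root_.Equiv.setCongr (h.range_eq.trans k.range_eq.symm))).trans
    (_root_.Equiv.ofInjective j k.inj).symm
  have he : ∀ v, j (e v) = i v := fun v => by
    have := _root_.Equiv.apply_ofInjective_symm k.inj
      ⟨i v, (h.range_eq.trans k.range_eq.symm) ▸ Set.mem_range_self v⟩
    exact this
  have hp : ∀ a b, Q.parent (e b) = some (e a) ↔ P.parent b = some a := by
    intro a b
    rw [k.parent_iff, h.parent_iff, he, he]
    exact (hr _ (h.range_eq ▸ Set.mem_range_self a) _ (h.range_eq ▸ Set.mem_range_self b)).symm
  refine ⟨⟨e, fun v => Option.ext fun w => ?_⟩⟩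
  obtain ⟨w, rfl⟩ := e.surjective w
  rw [hp, Option.map_eq_some_iff]
  simp

/-- The relation "`p` is the parent of `v`". -/
def Edge (F : Forest.{u}) (p v : F.V) : Prop := F.parent v = some p

/-- The inclusion of the vertices of an induced forest. -/
def incl (F : Forest.{u}) (U : Set F.V) : (F.restrict U).V → F.V := Subtype.val

theorem incl_injective (F : Forest.{u}) (U : Set F.V) : Function.Injective (F.incl U) :=
  Subtype.val_injective

@[simp]
theorem range_incl (F : Forest.{u}) (U : Set F.V) : Set.range (F.incl U) = U :=
  Subtype.range_coe

theorem incl_mem {F : Forest.{u}} {U : Set F.V} (v : (F.restrict U).V) : F.incl U v ∈ U := v.2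

theorem presents_restrict (F : Forest.{u}) (U : Set F.V) :
    (F.restrict U).Presents (F.incl U) U F.Edge where
  inj := F.incl_injective U
  range_eq := F.range_incl U
  parent_iff a b := by
    classical
    change ((F.parent (F.incl U b)).bind fun p => if h : p ∈ U then some ⟨p, h⟩ else none) =
      some a ↔ F.parent (F.incl U b) = some (F.incl U a)
    rw [Option.bind_eq_some_iff]
    constructor
    · rintro ⟨p, hp, h⟩
      split_ifs at h
      obtain rfl := Option.some.inj h
      exact hp
    · intro h
      exact ⟨_, h, by rw [dif_pos (incl_mem a)]; rfl⟩

theorem Presents.restrict {P : Forest.{u}} {X : Type u} {i : P.V → X} {D : Set X}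
    {r : X → X → Prop} (h : P.Presents i D r) (U : Set P.V) :
    (P.restrict U).Presents (i ∘ P.incl U) (i '' U) r where
  inj := h.inj.comp (P.incl_injective U)
  range_eq := by rw [Set.range_comp, range_incl]
  parent_iff a b := ((P.presents_restrict U).parent_iff a b).trans (h.parent_iff _ _)

theorem presents_self (F : Forest.{u}) : F.Presents id Set.univ F.Edge where
  inj := Function.injective_id
  range_eq := Set.range_id
  parent_iff _ _ := Iff.rfl

theorem Equiv.presents {F G : Forest.{u}} (f : F.Equiv G) : F.Presents f.e Set.univ G.Edge where
  inj := f.e.injective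
  range_eq := f.e.surjective.range_eq
  parent_iff a b := by
    rw [Edge, f.parent_eq, Option.map_eq_some_iff]
    simp

theorem Presents.disjUnion {P Q : Forest.{u}} {X : Type u} {i : P.V → X} {j : Q.V → X}
    {D D' : Set X} {r : X → X → Prop} (h : P.Presents i D r) (k : Q.Presents j D' r)
    (hd : ∀ x ∈ D, ∀ y ∈ D', x ≠ y ∧ ¬ r x y ∧ ¬ r y x) :
    (P.disjUnion Q).Presents (Sum.elim i j) (D ∪ D') r := by
  have hi : ∀ a, i a ∈ D := fun a => h.range_eq ▸ Set.mem_range_self a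
  have hj : ∀ a, j a ∈ D' := fun a => k.range_eq ▸ Set.mem_range_self a
  refine ⟨h.inj.sumElim k.inj fun a b => (hd _ (hi a) _ (hj b)).1, ?_, ?_⟩
  · rw [← h.range_eq, ← k.range_eq]
    exact Set.Sum.elim_range i j
  · rintro (a | a) (b | b)
    · simp [Forest.disjUnion, h.parent_iff]
    · simp [Forest.disjUnion, hd _ (hi a) _ (hj b)]
    · simp [Forest.disjUnion, hd _ (hi b) _ (hj a)]
    · simp [Forest.disjUnion, k.parent_iff]

theorem Presents.descClosed_preimage {P M : Forest.{u}} {i : P.V → M.V} {D : Set M.V}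
    (h : P.Presents i D M.Edge) {U : Set M.V} (hU : M.DescClosed U) :
    P.DescClosed (i ⁻¹' U) :=
  fun p v hp hv => hU (i p) (i v) hp ((h.parent_iff p v).mp hv)

/-- The set W collects the descendants that may leave D: it is empty when D is the part below a cut,
and it is that lower part when D is the part above. -/
theorem Presents.descClosed_image {P M : Forest.{u}} {i : P.V → M.V} {D : Set M.V}
    (h : P.Presents i D M.Edge) {U : Set P.V} (hU : P.DescClosed U) {W : Set M.V}
    (hD : ∀ p v, p ∈ D → M.parent v = some p → v ∈ D ∨ v ∈ W) :
    ∀ p v, p ∈ i '' U → M.parent v = some p → v ∈ i '' U ∨ v ∈ W := by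
  rintro _ v ⟨p, hp, rfl⟩ hv
  refine (hD _ v (h.range_eq ▸ Set.mem_range_self p) hv).imp_left fun hv' => ?_
  rw [← h.range_eq] at hv'
  obtain ⟨v, rfl⟩ := hv'
  exact ⟨v, hU p v hp ((h.parent_iff p v).mpr hv), rfl⟩

theorem Equiv.descClosed_image {F G : Forest.{u}} (f : F.Equiv G) {U : Set F.V}
    (hU : F.DescClosed U) : G.DescClosed (f.e '' U) := fun p v hp hv => by
  simpa using f.presents.descClosed_image hU (W := ∅) (fun _ _ _ _ => .inl trivial) p v hp hv

theorem Equiv.transport {F G : Forest.{u}} (f : F.Equiv G) :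
    ∃ e : F.Cut ≃ G.Cut, ∀ c,
      Nonempty ((F.restrict c.lower).Equiv (G.restrict (e c).lower)) ∧
      Nonempty ((F.restrict c.lowerᶜ).Equiv (G.restrict (e c).lowerᶜ)) := by
  have hp := f.presents
  let e : F.Cut → G.Cut := fun c => G.cutOf (f.e '' c.lower) (f.descClosed_image c.descClosed_lower)
  have hlow : ∀ c, (e c).lower = f.e '' c.lower := fun c => G.lower_cutOf _ _
  have he : Function.Bijective e := by
    constructor
    · intro c d h
      have := congrArg Cut.lower h
      rw [hlow, hlow] at this
      exact Cut.ext_lower (f.e.injective.image_injective this)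
    · intro c
      refine ⟨F.cutOf (f.e ⁻¹' c.lower) (hp.descClosed_preimage c.descClosed_lower), ?_⟩
      apply Cut.ext_lower
      rw [hlow, lower_cutOf, Set.image_preimage_eq _ f.e.surjective]
  refine ⟨_root_.Equiv.ofBijective e he, fun c => ?_⟩
  rw [_root_.Equiv.ofBijective_apply, hlow]
  refine ⟨(hp.restrict _).equiv (G.presents_restrict _) rfl fun _ _ _ _ => Iff.rfl,
    (hp.restrict _).equiv (G.presents_restrict _) ?_ fun _ _ _ _ => Iff.rfl⟩
  rw [Set.image_compl_eq f.e.bijective]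

theorem flags (F : Forest.{u}) :
    ∃ (T : Type u) (p : (Σ c : F.Cut, (F.restrict c.lower).Cut) ≃ T)
      (q : (Σ c : F.Cut, (F.restrict c.lowerᶜ).Cut) ≃ T), ∀ x y, p x = q y →
      Nonempty (((F.restrict x.1.lower).restrict x.2.lower).Equiv (F.restrict y.1.lower)) ∧
      Nonempty (((F.restrict x.1.lower).restrict x.2.lowerᶜ).Equiv
        ((F.restrict y.1.lowerᶜ).restrict y.2.lower)) ∧
      Nonempty ((F.restrict x.1.lowerᶜ).Equiv ((F.restrict y.1.lowerᶜ).restrict y.2.lowerᶜ)) := by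
  have hsub := fun U => F.presents_restrict U
  -- Both kinds of data are encoded by nested descendant-closed sets U ⊆ W: a cut of the lower part
  -- W gives U, and a cut of the part above U gives W \ U.
  let T : Type u := {p : Set F.V × Set F.V // F.DescClosed p.1 ∧ F.DescClosed p.2 ∧ p.1 ⊆ p.2}
  let P : (Σ c : F.Cut, (F.restrict c.lower).Cut) → Set F.V × Set F.V := fun x =>
    (F.incl _ '' x.2.lower, x.1.lower)
  let Q : (Σ c : F.Cut, (F.restrict c.lowerᶜ).Cut) → Set F.V × Set F.V := fun x =>
    (x.1.lower, x.1.lower ∪ F.incl _ '' x.2.lower)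
  have hP : ∀ x, F.DescClosed (P x).1 ∧ F.DescClosed (P x).2 ∧ (P x).1 ⊆ (P x).2 := by
    intro x
    refine ⟨fun p v hp hv => ?_, x.1.descClosed_lower, ?_⟩
    · simpa [P] using (hsub _).descClosed_image x.2.descClosed_lower (W := ∅)
        (fun p v hp hv => .inl (x.1.descClosed_lower p v hp hv)) p v hp hv
    · rintro _ ⟨v, _, rfl⟩
      exact incl_mem v
  have hQ : ∀ x, F.DescClosed (Q x).1 ∧ F.DescClosed (Q x).2 ∧ (Q x).1 ⊆ (Q x).2 := by
    intro x
    refine ⟨x.1.descClosed_lower, ?_, Set.subset_union_left⟩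
    rintro p v (hp | hp) hv
    · exact .inl (x.1.descClosed_lower _ _ hp hv)
    · exact ((hsub _).descClosed_image x.2.descClosed_lower (W := x.1.lower)
        (fun p v _ _ => (Classical.em (v ∈ x.1.lower)).symm) p v hp hv).symm
  have bP : Function.Bijective fun x => (⟨P x, hP x⟩ : T) := by
    constructor
    · rintro ⟨c, d⟩ ⟨c', d'⟩ h
      obtain ⟨h1, h2⟩ : F.incl _ '' d.lower = F.incl _ '' d'.lower ∧ c.lower = c'.lower :=
        Prod.mk.inj (congrArg Subtype.val h)
      obtain rfl := Cut.ext_lower h2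
      rw [Cut.ext_lower ((F.incl_injective _).image_injective h1)]
    · rintro ⟨⟨U, W⟩, hU, hW, hUW⟩
      dsimp only at hU hW hUW
      refine ⟨⟨F.cutOf W hW, cutOf _ (F.incl _ ⁻¹' U) ((hsub _).descClosed_preimage hU)⟩, ?_⟩
      refine Subtype.ext (Prod.ext ?_ ?_)
      · simpa [P, Set.image_preimage_eq_inter_range] using hUW
      · simp [P]
  have bQ : Function.Bijective fun x => (⟨Q x, hQ x⟩ : T) := by
    constructor
    · rintro ⟨c, d⟩ ⟨c', d'⟩ h
      obtain ⟨h1, h2⟩ : c.lower = c'.lower ∧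
          c.lower ∪ F.incl _ '' d.lower = c'.lower ∪ F.incl _ '' d'.lower :=
        Prod.mk.inj (congrArg Subtype.val h)
      obtain rfl := Cut.ext_lower h1
      have : d = d' := by
        apply Cut.ext_lower
        ext v
        have h2 := Set.ext_iff.mp h2 (F.incl _ v)
        have hv : F.incl _ v ∉ c.lower := incl_mem v
        simpa only [Set.mem_union, hv, false_or, (F.incl_injective _).mem_set_image] using h2
      rw [this]
    · rintro ⟨⟨U, W⟩, hU, hW, hUW⟩
      dsimp only at hU hW hUW
      refine ⟨⟨F.cutOf U hU, cutOf _ (F.incl _ ⁻¹' W) ((hsub _).descClosed_preimage hW)⟩, ?_⟩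
      refine Subtype.ext (Prod.ext ?_ ?_)
      · simp [Q]
      · simp only [Q, lower_cutOf, Set.image_preimage_eq_inter_range, range_incl, ← Set.sdiff_eq]
        exact Set.union_sdiff_cancel hUW
  refine ⟨T, _root_.Equiv.ofBijective _ bP, _root_.Equiv.ofBijective _ bQ, ?_⟩
  rintro ⟨c, d⟩ ⟨c', d'⟩ h
  obtain ⟨h1, h2⟩ : F.incl _ '' d.lower = c'.lower ∧ c.lower = c'.lower ∪ F.incl _ '' d'.lower :=
    Prod.mk.inj (congrArg Subtype.val h)
  have hd : F.incl c'.lowerᶜ '' d'.lower ⊆ c'.lowerᶜ := by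
    rintro _ ⟨v, _, rfl⟩
    exact incl_mem v
  refine ⟨((hsub _).restrict _).equiv (hsub _) h1 fun _ _ _ _ => Iff.rfl,
    ((hsub _).restrict _).equiv ((hsub _).restrict _) ?_ fun _ _ _ _ => Iff.rfl,
    (hsub _).equiv ((hsub _).restrict _) ?_ fun _ _ _ _ => Iff.rfl⟩
  · rw [Set.image_compl_eq_range_sdiff_image (F.incl_injective _), range_incl]
    dsimp only
    rw [h1, h2, Set.union_sdiff_left]
    exact (Set.subset_compl_iff_disjoint_right.mp hd).sdiff_eq_left
  · rw [Set.image_compl_eq_range_sdiff_image (F.incl_injective _), range_incl]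
    dsimp only
    rw [h2, Set.compl_union, Set.sdiff_eq]

theorem sum {A B M : Forest.{u}} (f : M.Equiv (A.disjUnion B)) :
    ∃ e : M.Cut ≃ A.Cut × B.Cut, ∀ c,
      Nonempty ((M.restrict c.lower).Equiv
        ((A.restrict (e c).1.lower).disjUnion (B.restrict (e c).2.lower))) ∧
      Nonempty ((M.restrict c.lowerᶜ).Equiv
        ((A.restrict (e c).1.lowerᶜ).disjUnion (B.restrict (e c).2.lowerᶜ))) := by
  -- All three forests are presented inside this one. As no edge joins the summands, a set is
  -- descendant-closed exactly when its two traces are.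
  let X := A.disjUnion B
  let i : A.V → X.V := Sum.inl
  let j : B.V → X.V := Sum.inr
  have hM : M.Presents f.e Set.univ X.Edge := f.presents
  have hA : A.Presents i (Set.range i) X.Edge :=
    ⟨Sum.inl_injective, rfl, fun a b => by simp [i, X, Edge, disjUnion]⟩
  have hB : B.Presents j (Set.range j) X.Edge :=
    ⟨Sum.inr_injective, rfl, fun a b => by simp [j, X, Edge, disjUnion]⟩
  have hcov : ∀ x, x ∈ Set.range i ∨ x ∈ Set.range j := by
    rintro (x | x)
    exacts [.inl ⟨x, rfl⟩, .inr ⟨x, rfl⟩]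
  have hd : ∀ x y, i x ≠ j y ∧ ¬ X.Edge (i x) (j y) ∧ ¬ X.Edge (j y) (i x) := by
    intro x y
    refine ⟨Sum.inl_ne_inr, ?_, ?_⟩ <;> simp [i, j, X, Edge, disjUnion]
  have hpre : ∀ (U : Set A.V) (W : Set B.V), i ⁻¹' (i '' U ∪ j '' W) = U := fun U W => by
    ext v
    simp only [Set.mem_preimage, Set.mem_union, hA.inj.mem_set_image, or_iff_left_iff_imp]
    rintro ⟨w, _, hw⟩
    exact absurd hw.symm (hd v w).1
  have hpre' : ∀ (U : Set A.V) (W : Set B.V), j ⁻¹' (i '' U ∪ j '' W) = W := fun U W => by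
    ext v
    simp only [Set.mem_preimage, Set.mem_union, hB.inj.mem_set_image, or_iff_right_iff_imp]
    rintro ⟨w, _, hw⟩
    exact absurd hw (hd w v).1
  have hcov' : ∀ U : Set X.V, i '' (i ⁻¹' U) ∪ j '' (j ⁻¹' U) = U := fun U => by
    ext x
    rcases hcov x with ⟨x, rfl⟩ | ⟨x, rfl⟩
    · exact Set.ext_iff.mp (hpre (i ⁻¹' U) (j ⁻¹' U)) x
    · exact Set.ext_iff.mp (hpre' (i ⁻¹' U) (j ⁻¹' U)) x
  have cl := fun c : M.Cut => f.descClosed_image c.descClosed_lower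
  let e : M.Cut → A.Cut × B.Cut := fun c =>
    (A.cutOf (i ⁻¹' (f.e '' c.lower)) (hA.descClosed_preimage (cl c)),
      B.cutOf (j ⁻¹' (f.e '' c.lower)) (hB.descClosed_preimage (cl c)))
  have e1 : ∀ c, (e c).1.lower = i ⁻¹' (f.e '' c.lower) := fun c => lower_cutOf _ _ _
  have e2 : ∀ c, (e c).2.lower = j ⁻¹' (f.e '' c.lower) := fun c => lower_cutOf _ _ _
  have he : Function.Bijective e := by
    constructor
    · intro c d h
      have h1 := congrArg (fun x => Cut.lower x.1) h
      have h2 := congrArg (fun x => Cut.lower x.2) h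
      simp only [e1, e2] at h1 h2
      apply Cut.ext_lower
      apply f.e.injective.image_injective
      rw [← hcov' (f.e '' c.lower), h1, h2]
      exact hcov' _
    · rintro ⟨c, d⟩
      have hcl : X.DescClosed (i '' c.lower ∪ j '' d.lower) := by
        rintro p v (⟨p, hp, rfl⟩ | ⟨p, hp, rfl⟩) hv
        · rcases hcov v with ⟨v, rfl⟩ | ⟨v, rfl⟩
          · exact .inl ⟨v, c.descClosed_lower p v hp ((hA.parent_iff p v).mpr hv), rfl⟩
          · exact absurd hv (hd p v).2.1
        · rcases hcov v with ⟨v, rfl⟩ | ⟨v, rfl⟩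
          · exact absurd hv (hd v p).2.2
          · exact .inr ⟨v, d.descClosed_lower p v hp ((hB.parent_iff p v).mpr hv), rfl⟩
      refine ⟨M.cutOf _ (hM.descClosed_preimage hcl), ?_⟩
      apply Prod.ext <;> apply Cut.ext_lower
      · rw [e1, lower_cutOf, Set.image_preimage_eq _ f.e.surjective, hpre]
      · rw [e2, lower_cutOf, Set.image_preimage_eq _ f.e.surjective, hpre']
  have hdu : ∀ (U : Set A.V) (W : Set B.V), ∀ x ∈ i '' U, ∀ y ∈ j '' W,
      x ≠ y ∧ ¬ X.Edge x y ∧ ¬ X.Edge y x := by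
    rintro U W _ ⟨x, _, rfl⟩ _ ⟨y, _, rfl⟩
    exact hd x y
  refine ⟨_root_.Equiv.ofBijective e he, fun c => ?_⟩
  rw [_root_.Equiv.ofBijective_apply, e1, e2]
  constructor
  · exact (hM.restrict _).equiv ((hA.restrict _).disjUnion (hB.restrict _) (hdu _ _)) (hcov' _).symm
      fun _ _ _ _ => Iff.rfl
  · refine (hM.restrict _).equiv ((hA.restrict _).disjUnion (hB.restrict _) (hdu _ _)) ?_
      fun _ _ _ _ => Iff.rfl
    rw [← Set.preimage_compl, ← Set.preimage_compl, hcov', Set.image_compl_eq f.e.bijective]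

theorem restrict_equiv_empty_iff (F : Forest.{u}) (U : Set F.V) :
    Nonempty ((F.restrict U).Equiv Forest.empty) ↔ U = ∅ := by
  constructor
  · rintro ⟨f⟩
    refine Set.eq_empty_of_forall_notMem fun v hv => ?_
    exact (f.e ⟨v, hv⟩).elim
  · rintro rfl
    exact ⟨⟨⟨fun v => v.2.elim, fun v => v.elim, fun v => v.2.elim, fun v => v.elim⟩,
      fun v => v.2.elim⟩⟩

theorem restrict_univ_equiv (F : Forest.{u}) : Nonempty ((F.restrict Set.univ).Equiv F) :=
  (F.presents_restrict _).equiv F.presents_self rfl fun _ _ _ _ => Iff.rfl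

theorem bot (F : Forest.{u}) :
    ∃ c₀ : F.Cut, Nonempty ((F.restrict c₀.lower).Equiv Forest.empty) ∧
      Nonempty ((F.restrict c₀.lowerᶜ).Equiv F) ∧
      ∀ c : F.Cut, Nonempty ((F.restrict c.lower).Equiv Forest.empty) → c = c₀ := by
  have hU : F.DescClosed ∅ := fun p v h => h.elim
  refine ⟨F.cutOf ∅ hU, ?_, ?_, fun c hc => Cut.ext_lower ?_⟩
  · rw [restrict_equiv_empty_iff, lower_cutOf]
  · rw [lower_cutOf, Set.compl_empty]
    exact F.restrict_univ_equiv
  · rw [lower_cutOf]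
    exact (F.restrict_equiv_empty_iff _).mp hc

theorem top (F : Forest.{u}) :
    ∃ c₁ : F.Cut, Nonempty ((F.restrict c₁.lowerᶜ).Equiv Forest.empty) ∧
      Nonempty ((F.restrict c₁.lower).Equiv F) ∧
      ∀ c : F.Cut, Nonempty ((F.restrict c.lowerᶜ).Equiv Forest.empty) → c = c₁ := by
  have hU : F.DescClosed Set.univ := fun p v _ _ => trivial
  refine ⟨F.cutOf Set.univ hU, ?_, ?_, fun c hc => Cut.ext_lower ?_⟩
  · rw [restrict_equiv_empty_iff, lower_cutOf, Set.compl_univ]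
  · rw [lower_cutOf]
    exact F.restrict_univ_equiv
  · rw [lower_cutOf, ← Set.compl_empty_iff]
    exact (F.restrict_equiv_empty_iff _).mp hc

end Forest

/-- The structural laws of the category of labeled rooted forests. -/
def LRF.laws (S : Type u) : (LRF S).Laws where
  quo F c := LabeledForest.restrict F (Forest.Cut.lower c)ᶜ
  isQuot_iff _ _ _ := Iff.rfl
  transport := fun _ _ ⟨f⟩ => f.transport
  flags F := F.forest.flags
  sum := fun _ _ _ ⟨f⟩ => Forest.sum f
  bot F := F.forest.bot
  top F := F.forest.top


/-- For a symmetric relation, a property preserved by single steps is constant on classes. The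
induction runs on the equivalence `P x ↔ P y`, as otherwise the symmetry case would fail. -/
theorem eqvGen_induction {α : Type*} {r : α → α → Prop} (hr : ∀ a b, r a b → r b a)
    {P : α → Prop} (step : ∀ a b, r a b → P a → P b) {x y : α} (h : Relation.EqvGen r x y)
    (hx : P x) : P y := by
  have key : P x ↔ P y := by
    clear hx
    induction h with
    | rel x y h => exact ⟨step _ _ h, step _ _ (hr _ _ h)⟩
    | refl => exact Iff.rfl
    | symm _ _ _ ih => exact ih.symm
    | trans _ _ _ _ _ ih₁ ih₂ => exact ih₁.trans ih₂
  exact key.mp hx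

/-! ### Alternating paths of two partial involutions -/

/-- Paths whose steps alternate between `A` and `P`, starting and ending with a step in `A`. -/
inductive Zig {X : Type*} (A P : X → X → Prop) : X → X → Prop
  | edge (a b : X) : A a b → Zig A P a b
  | step (a k l b : X) : A a k → P k l → Zig A P l b → Zig A P a b

/-- The equivalence relation generated by `A` and `P`. -/
def ZigEqv {X : Type*} (A P : X → X → Prop) : X → X → Prop :=
  Relation.EqvGen fun x y => A x y ∨ P x y

section Zig

variable {X : Type*} {A P : X → X → Prop}

theorem Zig.eqv {x y : X} (h : Zig A P x y) : ZigEqv A P x y := by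
  induction h with
  | edge a b h => exact .rel _ _ (.inl h)
  | step a k l b h p _ ih =>
    exact .trans _ _ _ (.rel _ _ (.inl h)) (.trans _ _ _ (.rel _ _ (.inr p)) ih)

theorem Zig.head {x y : X} (h : Zig A P x y) : ∃ z, A x z := by
  cases h with
  | edge _ _ h => exact ⟨_, h⟩
  | step _ _ _ _ h _ _ => exact ⟨_, h⟩

theorem Zig.snoc {a b k l : X} (h : Zig A P a k) (p : P k l) (e : A l b) : Zig A P a b := by
  induction h with
  | edge a k h => exact .step a k l b h p (.edge l b e)
  | step a k' l' k h q _ ih => exact .step a k' l' b h q (ih p)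

variable (A_symm : ∀ a b, A a b → A b a) (P_symm : ∀ a b, P a b → P b a)
  (A_unique : ∀ a b c, A a b → A a c → b = c) (P_unique : ∀ a b c, P a b → P a c → b = c)

section
include A_symm P_symm

theorem Zig.symm {a b : X} (h : Zig A P a b) : Zig A P b a := by
  induction h with
  | edge a b h => exact .edge b a (A_symm _ _ h)
  | step a k l b h p _ ih => exact ih.snoc (P_symm _ _ p) (A_symm _ _ h)

theorem ZigEqv.induction {Q : X → Prop} (hA : ∀ a b, A a b → Q a → Q b)
    (hP : ∀ a b, P a b → Q a → Q b) {x y : X} (h : ZigEqv A P x y) (hx : Q x) : Q y :=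
  eqvGen_induction (fun _ _ h => h.imp (A_symm _ _) (P_symm _ _))
    (fun a b h => h.elim (hA a b) (hP a b)) h hx

end

include A_symm A_unique in
-- The path reaches z by an A-step and A is a partial involution, so another A-step from z only
-- undoes the last one.
theorem Zig.next {x z y : X} (h : Zig A P x z) (e : A z y) :
    y = x ∨ ∃ m, Zig A P x m ∧ P m y := by
  induction h with
  | edge x z h => exact .inl (A_unique _ _ _ e (A_symm _ _ h))
  | step x k l z h p _ ih =>
    rcases ih e with rfl | ⟨m, h1, h2⟩
    · exact .inr ⟨k, .edge _ _ h, p⟩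
    · exact .inr ⟨m, .step _ _ _ _ h p h1, h2⟩

include A_symm P_symm A_unique P_unique in
-- Since x has no P-step, its class is a path starting at x, traversed without choices; the cases
-- record the type of the last step.
theorem ZigEqv.cases {x z : X} (hx : ∀ y, ¬ P x y) (h : ZigEqv A P x z) :
    z = x ∨ Zig A P x z ∨ ∃ m, Zig A P x m ∧ P m z := by
  refine h.induction A_symm P_symm
    (Q := fun z => z = x ∨ Zig A P x z ∨ ∃ m, Zig A P x m ∧ P m z) ?_ ?_ (.inl rfl)
  · rintro a b hab (rfl | h | ⟨m, h, p⟩)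
    · exact .inr (.inl (.edge _ _ hab))
    · exact (h.next A_symm A_unique hab).imp_right .inr
    · exact .inr (.inl (h.snoc p hab))
  · rintro a b hab (rfl | h | ⟨m, h, p⟩)
    · exact absurd hab (hx b)
    · exact .inr (.inr ⟨_, h, hab⟩)
    · obtain rfl := P_unique _ _ _ (P_symm _ _ p) hab
      exact .inr (.inl h)

include A_symm P_symm A_unique P_unique in
theorem ZigEqv.zig {x y : X} (hx : ∀ z, ¬ P x z) (hy : ∀ z, ¬ P y z) (hne : x ≠ y)
    (h : ZigEqv A P x y) : Zig A P x y := by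
  rcases h.cases A_symm P_symm A_unique P_unique hx with h | h | ⟨m, _, h⟩
  · exact absurd h.symm hne
  · exact h
  · exact absurd (P_symm _ _ h) (hy m)

include A_unique P_unique in
-- Two walks from x agree step by step; neither can continue past the end of the other, where no
-- P-step is available.
theorem Zig.unique {x y z : X} (h : Zig A P x y) (k : Zig A P x z) (hy : ∀ w, ¬ P y w)
    (hz : ∀ w, ¬ P z w) : y = z := by
  induction h with
  | edge x y h =>
    cases k with
    | edge _ _ k => exact A_unique _ _ _ h k
    | step _ m l _ k p _ =>
      obtain rfl := A_unique _ _ _ h k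
      exact absurd p (hy _)
  | step x m l y h p _ ih =>
    cases k with
    | edge _ _ k =>
      obtain rfl := A_unique _ _ _ h k
      exact absurd p (hz _)
    | step _ m' l' _ k p' r =>
      obtain rfl := A_unique _ _ _ h k
      obtain rfl := P_unique _ _ _ p p'
      exact ih r hy

include A_unique P_unique in
-- The walk to z is an initial segment of the walk to the end y, and the latter must go on from z by
-- an A-step.
theorem Zig.exists_next {x y z m : X} (h : Zig A P x m) (p : P m z) (k : Zig A P x y)
    (hy : ∀ w, ¬ P y w) : ∃ w, A z w := by
  induction h with
  | edge x m h =>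
    cases k with
    | edge _ _ k =>
      obtain rfl := A_unique _ _ _ h k
      exact absurd p (hy _)
    | step _ m' l _ k p' r =>
      obtain rfl := A_unique _ _ _ h k
      obtain rfl := P_unique _ _ _ p p'
      exact r.head
  | step x a b m h q _ ih =>
    cases k with
    | edge _ _ k =>
      obtain rfl := A_unique _ _ _ h k
      exact absurd q (hy _)
    | step _ a' b' _ k q' r =>
      obtain rfl := A_unique _ _ _ h k
      obtain rfl := P_unique _ _ _ q q'
      exact ih p r

include A_symm P_symm A_unique P_unique

/-- An alternating path has at most two ends. -/
theorem ZigEqv.ends_unique {x y z : X} (hx : ∀ w, ¬ P x w) (hy : ∀ w, ¬ P y w)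
    (hz : ∀ w, ¬ P z w) (h : ZigEqv A P x y) (k : ZigEqv A P x z) (hxy : x ≠ y) (hxz : x ≠ z) :
    y = z :=
  (h.zig A_symm P_symm A_unique P_unique hx hy hxy).unique A_unique P_unique
    (k.zig A_symm P_symm A_unique P_unique hx hz hxz) hy hz

/-- On an alternating path between two ends without `P`-step every member has an `A`-step. -/
theorem ZigEqv.exists_step {x y z : X} (hx : ∀ w, ¬ P x w) (hy : ∀ w, ¬ P y w) (hxy : x ≠ y)
    (h : ZigEqv A P x y) (k : ZigEqv A P x z) : ∃ w, A z w := by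
  have h' := h.zig A_symm P_symm A_unique P_unique hx hy hxy
  rcases k.cases A_symm P_symm A_unique P_unique hx with rfl | k | ⟨m, k, p⟩
  · exact h'.head
  · exact (k.symm A_symm P_symm).head
  · exact k.exists_next A_unique P_unique p h' hy

end Zig

/-! ### Feynman subgraphs as sets of half-edges -/

namespace FGraph

variable {G A : FGraph.{u}}

/-- Two vertices are connected through edges with halves in `J`. -/
def Cn (G : FGraph.{u}) (J : Set G.H) (v w : G.V) : Prop :=
  Relation.EqvGen (fun v w => ∃ a b, (G.adj a b ∧ a ∈ J) ∧ G.vert a = v ∧ G.vert b = w) v w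

/-- `J` is the set of halves of a set of internal edges. -/
def Paired (G : FGraph.{u}) (J : Set G.H) : Prop := ∀ a ∈ J, ∃ b ∈ J, G.adj a b

/-- The half-edges outside `J` at the vertices connected to `v` through `J`. -/
def lv (G : FGraph.{u}) (J : Set G.H) (v : G.V) : Set G.H := {h | h ∉ J ∧ G.Cn J (G.vert h) v}

/-- The halves of internal edges. -/
def inn (G : FGraph.{u}) : Set G.H := {h | ∃ k, G.adj h k}

/-- Each vertex is incident to exactly three half-edges. -/
def Trivalent (G : FGraph.{u}) : Prop := ∀ v, Nat.card {h // G.vert h = v} = 3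

/-- The edges with halves in `J` span a Feynman subgraph. -/
structure Good (G : FGraph.{u}) (J : Set G.H) : Prop where
  paired : G.Paired J
  legs : ∀ a ∈ J, (G.lv J (G.vert a)).ncard = 2 ∨ (G.lv J (G.vert a)).ncard = 3
  irred : ∀ a b, G.adj a b → a ∈ J → G.Cn (J \ {a, b}) (G.vert a) (G.vert b)

namespace Cn

variable {J K : Set G.H} {v w x : G.V}

theorem refl (v : G.V) : G.Cn J v v := Relation.EqvGen.refl v

theorem symm (h : G.Cn J v w) : G.Cn J w v := Relation.EqvGen.symm _ _ h

theorem trans (h : G.Cn J v w) (k : G.Cn J w x) : G.Cn J v x := Relation.EqvGen.trans _ _ _ h k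

theorem of_adj {a b : G.H} (h : G.adj a b) (ha : a ∈ J) : G.Cn J (G.vert a) (G.vert b) :=
  .rel _ _ ⟨a, b, ⟨h, ha⟩, rfl, rfl⟩

theorem of_eq (h : v = w) : G.Cn J v w := h ▸ Cn.refl v

theorem mono (h : G.Cn J v w) (hJ : J ⊆ K) : G.Cn K v w :=
  Relation.EqvGen.mono (fun _ _ ⟨a, b, ⟨h, ha⟩, h1, h2⟩ => ⟨a, b, ⟨h, hJ ha⟩, h1, h2⟩) v w h

theorem induction (hJ : ∀ a b, G.adj a b → a ∈ J → b ∈ J) {P : G.V → Prop}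
    (step : ∀ a b, G.adj a b → a ∈ J → P (G.vert a) → P (G.vert b)) (h : G.Cn J v w) (hv : P v) :
    P w := by
  refine eqvGen_induction ?_ ?_ h hv
  · rintro _ _ ⟨a, b, ⟨h, ha⟩, rfl, rfl⟩
    exact ⟨b, a, ⟨G.adj_symm _ _ h, hJ _ _ h ha⟩, rfl, rfl⟩
  · rintro _ _ ⟨a, b, ⟨h, ha⟩, rfl, rfl⟩
    exact step a b h ha

end Cn

theorem Paired.closed {J : Set G.H} (hJ : G.Paired J) (a b : G.H) (h : G.adj a b) (ha : a ∈ J) :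
    b ∈ J := by
  obtain ⟨c, hc, h'⟩ := hJ a ha
  rwa [G.adj_unique _ _ _ h h']

theorem Paired.diff {J : Set G.H} (hJ : G.Paired J) {a b : G.H} (h : G.adj a b) :
    G.Paired (J \ {a, b}) := by
  rintro x ⟨hx, hx'⟩
  obtain ⟨y, hy, hxy⟩ := hJ x hx
  refine ⟨y, ⟨hy, ?_⟩, hxy⟩
  rintro (rfl | rfl)
  · exact hx' (.inr (G.adj_unique _ _ _ (G.adj_symm _ _ hxy) h))
  · exact hx' (.inl (G.adj_unique _ _ _ (G.adj_symm _ _ hxy) (G.adj_symm _ _ h)))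

theorem paired_inn (G : FGraph.{u}) : G.Paired G.inn :=
  fun _ ⟨b, h⟩ => ⟨b, ⟨_, G.adj_symm _ _ h⟩, h⟩

theorem Paired.subset_inn {J : Set G.H} (hJ : G.Paired J) : J ⊆ G.inn :=
  fun _ ha => let ⟨b, _, h⟩ := hJ _ ha; ⟨b, h⟩

theorem lv_congr {J : Set G.H} {v w : G.V} (h : G.Cn J v w) : G.lv J v = G.lv J w := by
  ext x
  exact ⟨fun k => ⟨k.1, k.2.trans h⟩, fun k => ⟨k.1, k.2.trans h.symm⟩⟩

/-- As every vertex meets an internal edge, conditions on all vertices reduce to conditions at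
internal edges. Irreducibility need only be checked between the two ends of the removed edge, and it
contains the loop condition. -/
theorem isFeynman_iff :
    G.IsFeynman ↔ G.Trivalent ∧ (∀ v, ∃ h ∈ G.inn, G.vert h = v) ∧ G.Good G.inn := by
  have hc : ∀ v w, G.Conn v w ↔ G.Cn G.inn v w := fun v w => by
    have : G.adj = fun a b => G.adj a b ∧ a ∈ G.inn := by
      ext a b
      exact ⟨fun h => ⟨h, b, h⟩, fun h => h.1⟩
    unfold Conn Cn
    exact Iff.of_eq (congrArg (fun R => (G.connBy R).r v w) this)
  have hw : ∀ a b, G.adj a b → ∀ v w, G.ConnWithout a b v w ↔ G.Cn (G.inn \ {a, b}) v w := by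
    intro a b _ v w
    have : (fun x y => G.adj x y ∧ x ≠ a ∧ x ≠ b) =
        fun x y => G.adj x y ∧ x ∈ G.inn \ {a, b} := by
      ext x y
      constructor
      · rintro ⟨h1, h2, h3⟩
        exact ⟨h1, ⟨y, h1⟩, by simp [h2, h3]⟩
      · rintro ⟨h1, -, h2⟩
        simpa [h1] using h2
    unfold ConnWithout Cn
    exact Iff.of_eq (congrArg (fun R => (G.connBy R).r v w) this)
  have hl : ∀ v, Nat.card {h // G.External h ∧ G.Conn v (G.vert h)} = (G.lv G.inn v).ncard := by
    intro v
    have : {h | G.External h ∧ G.Conn v (G.vert h)} = G.lv G.inn v := by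
      ext h
      simp only [External, Set.mem_ofPred_eq, lv, inn, not_exists, hc]
      exact and_congr_right fun _ => ⟨Cn.symm, Cn.symm⟩
    rw [← this]
    rfl
  constructor
  · intro h
    refine ⟨h.trivalent, fun v => ?_, G.paired_inn, fun a _ => ?_, fun a b hab _ => ?_⟩
    · obtain ⟨x, hx, hx'⟩ := h.exists_internal v
      refine ⟨x, ?_, hx⟩
      simpa [External, inn] using hx'
    · rw [← hl]
      exact h.legs _
    · exact (hw a b hab _ _).mp (h.irred a b hab _ _ ((hc _ _).mpr (.of_adj hab ⟨b, hab⟩)))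
  · rintro ⟨h1, h2, h3⟩
    refine ⟨h1, fun v => ?_, fun v => ?_, fun a b hab v w hvw => ?_⟩
    · obtain ⟨a, ha, rfl⟩ := h2 v
      rw [hl]
      exact h3.legs a ha
    · obtain ⟨a, ⟨b, hb⟩, rfl⟩ := h2 v
      exact ⟨a, b, hb, (hc _ _).mpr (.refl _), (hw a b hb _ _).mpr (h3.irred a b hb ⟨b, hb⟩)⟩
    · rw [hw a b hab]
      rw [hc] at hvw
      have h4 := h3.irred a b hab ⟨b, hab⟩
      -- Wherever the path uses the removed edge, it takes the detour `h4` between its ends.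
      refine hvw.induction (P := fun w => G.Cn (G.inn \ {a, b}) v w) h3.paired.closed ?_ (.refl _)
      intro x y hxy hx hvx
      by_cases h5 : x ∈ ({a, b} : Set G.H)
      · rcases h5 with rfl | rfl
        · obtain rfl := G.adj_unique _ _ _ hxy hab
          exact hvx.trans h4
        · obtain rfl := G.adj_unique _ _ _ hxy (G.adj_symm _ _ hab)
          exact hvx.trans h4.symm
      · exact hvx.trans (.of_adj hxy ⟨hx, h5⟩)

/-! ### Immersions -/

/-- An embedding of the vertices and half-edges of one graph into another that keeps all half-edges
at the vertices, and under which the internal edges are those with halves in `S`. -/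
structure Imm (A G : FGraph.{u}) (S : Set G.H) where
  v : A.V → G.V
  h : A.H → G.H
  v_inj : Function.Injective v
  h_inj : Function.Injective h
  vert_h : ∀ a, G.vert (h a) = v (A.vert a)
  full : ∀ x w, G.vert x = v w → ∃ a, h a = x
  adj_h : ∀ a b, A.adj a b → G.adj (h a) (h b) ∧ h a ∈ S
  lift_adj : ∀ a y, h a ∈ S → G.adj (h a) y → ∃ b, h b = y ∧ A.adj a b

namespace Imm

variable {S K : Set G.H} (φ : Imm A G S)
include φ

theorem adj_iff (a b : A.H) : A.adj a b ↔ G.adj (φ.h a) (φ.h b) ∧ φ.h a ∈ S := by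
  refine ⟨φ.adj_h a b, fun ⟨h, ha⟩ => ?_⟩
  obtain ⟨c, hc, hac⟩ := φ.lift_adj a _ ha h
  rwa [← φ.h_inj hc]

theorem preimage_eq_inn (hS : G.Paired S) : φ.h ⁻¹' S = A.inn := by
  ext a
  constructor
  · intro ha
    obtain ⟨y, _, hy⟩ := hS _ ha
    obtain ⟨b, _, hab⟩ := φ.lift_adj a y ha hy
    exact ⟨b, hab⟩
  · rintro ⟨b, hab⟩
    exact (φ.adj_h a b hab).2

theorem paired_preimage (hK : G.Paired K) (hKS : K ⊆ S) : A.Paired (φ.h ⁻¹' K) := by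
  intro a ha
  obtain ⟨y, hy, hay⟩ := hK _ ha
  obtain ⟨b, rfl, hab⟩ := φ.lift_adj a y (hKS ha) hay
  exact ⟨b, hy, hab⟩

/-- A K-path starting in the image cannot leave it: every half-edge at an image vertex comes from A,
and edges with halves in S lift. Hence components, legs and goodness may be computed in A. -/
theorem cn_iff_exists (hK : G.Paired K) (hKS : K ⊆ S) {v : A.V} {y : G.V} :
    G.Cn K (φ.v v) y ↔ ∃ w, φ.v w = y ∧ A.Cn (φ.h ⁻¹' K) v w := by
  have hJ := φ.paired_preimage hK hKS
  constructor
  · intro h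
    refine h.induction (P := fun y => ∃ w, φ.v w = y ∧ A.Cn (φ.h ⁻¹' K) v w) hK.closed ?_
      ⟨v, rfl, .refl v⟩
    rintro x y hxy hx ⟨w, hw, hvw⟩
    obtain ⟨a, rfl⟩ := φ.full x w hw.symm
    obtain ⟨b, rfl, hab⟩ := φ.lift_adj a y (hKS hx) hxy
    refine ⟨A.vert b, (φ.vert_h b).symm, ?_⟩
    rw [φ.vert_h] at hw
    rw [φ.v_inj hw] at hvw
    exact hvw.trans (.of_adj hab hx)
  · rintro ⟨w, rfl, h⟩
    refine h.induction (P := fun w => G.Cn K (φ.v v) (φ.v w)) hJ.closed ?_ (.refl _)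
    intro a b hab ha hv
    rw [← φ.vert_h] at hv ⊢
    exact hv.trans (.of_adj (φ.adj_h _ _ hab).1 ha)

theorem cn_iff (hK : G.Paired K) (hKS : K ⊆ S) {v w : A.V} :
    G.Cn K (φ.v v) (φ.v w) ↔ A.Cn (φ.h ⁻¹' K) v w := by
  rw [φ.cn_iff_exists hK hKS]
  constructor
  · rintro ⟨x, hx, h⟩
    rwa [← φ.v_inj hx]
  · exact fun h => ⟨w, rfl, h⟩

theorem lv_eq_image (hK : G.Paired K) (hKS : K ⊆ S) (v : A.V) :
    G.lv K (φ.v v) = φ.h '' A.lv (φ.h ⁻¹' K) v := by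
  ext x
  constructor
  · rintro ⟨h1, h2⟩
    obtain ⟨w, hw, h3⟩ := (φ.cn_iff_exists hK hKS).mp h2.symm
    obtain ⟨a, rfl⟩ := φ.full x w hw.symm
    rw [φ.vert_h] at hw
    rw [φ.v_inj hw] at h3
    exact ⟨a, ⟨h1, h3.symm⟩, rfl⟩
  · rintro ⟨a, ⟨h1, h2⟩, rfl⟩
    refine ⟨h1, ?_⟩
    rw [φ.vert_h, φ.cn_iff hK hKS]
    exact h2

theorem ncard_lv (hK : G.Paired K) (hKS : K ⊆ S) (a : A.H) :
    (G.lv K (G.vert (φ.h a))).ncard = (A.lv (φ.h ⁻¹' K) (A.vert a)).ncard := by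
  rw [φ.vert_h, φ.lv_eq_image hK hKS, Set.ncard_image_of_injective _ φ.h_inj]

theorem cn_diff_iff (hK : G.Paired K) (hKS : K ⊆ S) {a b : A.H} (hab : A.adj a b) :
    G.Cn (K \ {φ.h a, φ.h b}) (G.vert (φ.h a)) (G.vert (φ.h b)) ↔
      A.Cn (φ.h ⁻¹' K \ {a, b}) (A.vert a) (A.vert b) := by
  have hd : φ.h ⁻¹' (K \ {φ.h a, φ.h b}) = φ.h ⁻¹' K \ {a, b} := by
    rw [← Set.image_pair, Set.preimage_sdiff, Set.preimage_image_eq _ φ.h_inj]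
  rw [φ.vert_h, φ.vert_h, φ.cn_iff (hK.diff (φ.adj_h a b hab).1) (Set.sdiff_subset.trans hKS), hd]

theorem good_preimage (hK : G.Good K) (hKS : K ⊆ S) : A.Good (φ.h ⁻¹' K) := by
  refine ⟨φ.paired_preimage hK.paired hKS, fun a ha => ?_, fun a b hab ha => ?_⟩
  · rw [← φ.ncard_lv hK.paired hKS]
    exact hK.legs _ ha
  · rw [← φ.cn_diff_iff hK.paired hKS hab]
    exact hK.irred _ _ (φ.adj_h a b hab).1 ha

/-- Goodness is a condition at each edge of K and its component, so it may be checked on immersed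
graphs covering K. With φ = ψ this yields images under an immersion; with two summands it handles
disjoint unions. -/
theorem good_of_cover {B : FGraph.{u}} (ψ : Imm B G S) (hKS : K ⊆ S) (hA : A.Good (φ.h ⁻¹' K))
    (hB : B.Good (ψ.h ⁻¹' K)) (hc : ∀ x ∈ K, x ∈ Set.range φ.h ∨ x ∈ Set.range ψ.h) :
    G.Good K := by
  have hK : G.Paired K := by
    intro x hx
    rcases hc x hx with ⟨a, rfl⟩ | ⟨a, rfl⟩
    · obtain ⟨b, hb, hab⟩ := hA.paired a hx
      exact ⟨_, hb, (φ.adj_h a b hab).1⟩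
    · obtain ⟨b, hb, hab⟩ := hB.paired a hx
      exact ⟨_, hb, (ψ.adj_h a b hab).1⟩
  refine ⟨hK, fun x hx => ?_, fun x y hxy hx => ?_⟩
  · rcases hc x hx with ⟨a, rfl⟩ | ⟨a, rfl⟩
    · rw [φ.ncard_lv hK hKS]
      exact hA.legs a hx
    · rw [ψ.ncard_lv hK hKS]
      exact hB.legs a hx
  · rcases hc x hx with ⟨a, rfl⟩ | ⟨a, rfl⟩
    · obtain ⟨b, rfl, hab⟩ := φ.lift_adj a y (hKS hx) hxy
      rw [φ.cn_diff_iff hK hKS hab]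
      exact hA.irred a b hab hx
    · obtain ⟨b, rfl, hab⟩ := ψ.lift_adj a y (hKS hx) hxy
      rw [ψ.cn_diff_iff hK hKS hab]
      exact hB.irred a b hab hx

theorem image_subset (J : Set A.H) (hJ : A.Paired J) : φ.h '' J ⊆ S := by
  rintro _ ⟨a, ha, rfl⟩
  obtain ⟨b, _, hab⟩ := hJ a ha
  exact (φ.adj_h a b hab).2

theorem good_image {J : Set A.H} (hJ : A.Good J) : G.Good (φ.h '' J) := by
  have hp : φ.h ⁻¹' (φ.h '' J) = J := Set.preimage_image_eq _ φ.h_inj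
  refine φ.good_of_cover φ (φ.image_subset J hJ.paired) (hp.symm ▸ hJ) (hp.symm ▸ hJ) ?_
  rintro _ ⟨a, _, rfl⟩
  exact .inl ⟨a, rfl⟩

theorem trivalent (hG : G.Trivalent) : A.Trivalent := by
  intro v
  rw [← hG (φ.v v)]
  refine Nat.card_congr (_root_.Equiv.ofBijective
    (fun a => ⟨φ.h a.1, by rw [φ.vert_h, a.2]⟩) ⟨?_, ?_⟩)
  · intro a b h
    exact Subtype.ext (φ.h_inj (Subtype.ext_iff.mp h))
  · rintro ⟨x, hx⟩
    obtain ⟨a, rfl⟩ := φ.full x v hx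
    exact ⟨⟨a, φ.v_inj ((φ.vert_h a).symm.trans hx)⟩, rfl⟩

end Imm

/-- The inclusion of a part of a graph. -/
def partImm (G : FGraph.{u}) (W : Set G.V) (J : Set G.H) (hJ : G.Paired J)
    (hW : ∀ h ∈ J, G.vert h ∈ W) : Imm (G.part W J) G J where
  v := Subtype.val
  h := Subtype.val
  v_inj := Subtype.val_injective
  h_inj := Subtype.val_injective
  vert_h _ := rfl
  full x w h := ⟨⟨x, h ▸ w.2⟩, rfl⟩
  adj_h _ _ h := ⟨h.1, h.2.1⟩
  lift_adj _ y ha hay :=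
    have hy := hJ.closed _ _ hay ha
    ⟨⟨y, hW y hy⟩, rfl, hay, ha, hy⟩

theorem part_isFeynman (hG : G.Trivalent) {J : Set G.H} (hJ : G.Good J) :
    (G.part (G.vert '' J) J).IsFeynman := by
  let φ := G.partImm (G.vert '' J) J hJ.paired fun h hh => ⟨h, hh, rfl⟩
  have hi := φ.preimage_eq_inn hJ.paired
  refine isFeynman_iff.mpr ⟨φ.trivalent hG, ?_, ?_⟩
  · rintro ⟨_, x, hx, rfl⟩
    obtain ⟨a, rfl⟩ := φ.full x ⟨_, x, hx, rfl⟩ rfl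
    exact ⟨a, hi ▸ hx, rfl⟩
  · rw [← hi]
    exact φ.good_preimage hJ subset_rfl

namespace Subgraph

theorem paired (γ : G.Subgraph) : G.Paired γ.J := γ.adj_mem

/-- The inclusion of a Feynman subgraph. -/
def imm (γ : G.Subgraph) : Imm (G.part γ.W γ.J) G γ.J := G.partImm γ.W γ.J γ.paired γ.vert_mem

theorem vert_imm_mem (γ : G.Subgraph) (a : (G.part γ.W γ.J).H) : G.vert (γ.imm.h a) ∈ γ.W := a.2

theorem exists_imm_eq (γ : G.Subgraph) {x : G.H} (hx : G.vert x ∈ γ.W) : ∃ a, γ.imm.h a = x :=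
  ⟨⟨x, hx⟩, rfl⟩

theorem image_inn (γ : G.Subgraph) : γ.imm.h '' (G.part γ.W γ.J).inn = γ.J := by
  rw [← γ.imm.preimage_eq_inn γ.paired, Set.image_preimage_eq_iff]
  exact fun x hx => γ.exists_imm_eq (γ.vert_mem x hx)

theorem good (γ : G.Subgraph) : G.Good γ.J := by
  rw [← γ.image_inn]
  exact γ.imm.good_image (isFeynman_iff.mp γ.isFeynman).2.2

/-- A Feynman graph has no vertex without an internal edge. Thus J determines the subgraph, and
subgraphs amount to good sets. -/
theorem W_eq (γ : G.Subgraph) : γ.W = G.vert '' γ.J := by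
  ext v
  constructor
  · intro hv
    obtain ⟨a, ha, h⟩ := (isFeynman_iff.mp γ.isFeynman).2.1 ⟨v, hv⟩
    exact ⟨γ.imm.h a, γ.image_inn.le ⟨a, ha, rfl⟩, Subtype.ext_iff.mp h⟩
  · rintro ⟨x, hx, rfl⟩
    exact γ.vert_mem x hx

theorem ext_J {γ δ : G.Subgraph} (h : γ.J = δ.J) : γ = δ := by
  have hW : γ.W = δ.W := by rw [γ.W_eq, δ.W_eq, h]
  obtain ⟨W, J, _, _, _⟩ := γ
  obtain ⟨W', J', _, _, _⟩ := δ
  dsimp only at h hW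
  subst h hW
  rfl

/-- The Feynman subgraph with a given set of internal edges. -/
def ofGood (hG : G.Trivalent) (J : Set G.H) (hJ : G.Good J) : G.Subgraph where
  W := G.vert '' J
  J := J
  vert_mem h hh := ⟨h, hh, rfl⟩
  adj_mem := hJ.paired
  isFeynman := part_isFeynman hG hJ

end Subgraph

/-! ### Presentations of trivalent graphs by half-edges -/

/-- The graph `P` is realized inside a set `X`: its half-edges correspond to `D ⊆ X`, the relation
of being incident to the same vertex to `s`, and adjacency to `e`. -/
structure Presents (P : FGraph.{u}) {X : Type u} (i : P.H → X) (D : Set X) (s e : X → X → Prop) :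
    Prop where
  inj : Function.Injective i
  range_eq : Set.range i = D
  surj : Function.Surjective P.vert
  vert_iff : ∀ a b, P.vert a = P.vert b ↔ s (i a) (i b)
  adj_iff : ∀ a b, P.adj a b ↔ e (i a) (i b)

theorem Presents.mem {P : FGraph.{u}} {X : Type u} {i : P.H → X} {D : Set X}
    {s e : X → X → Prop} (h : P.Presents i D s e) (a : P.H) : i a ∈ D :=
  h.range_eq ▸ Set.mem_range_self a

theorem Presents.exists_eq {P : FGraph.{u}} {X : Type u} {i : P.H → X} {D : Set X}
    {s e : X → X → Prop} (h : P.Presents i D s e) {x : X} (hx : x ∈ D) : ∃ a, i a = x := by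
  rwa [← h.range_eq] at hx

/-- Vertices need no separate bookkeeping: since each of them carries a half-edge, they are the
classes of half-edges under incidence to a common vertex. -/
theorem Presents.equiv {P Q : FGraph.{u}} {X : Type u} {i : P.H → X} {j : Q.H → X} {D D' : Set X}
    {s e s' e' : X → X → Prop} (h : P.Presents i D s e) (k : Q.Presents j D' s' e') (hD : D = D')
    (hs : ∀ x ∈ D, ∀ y ∈ D, (s x y ↔ s' x y)) (he : ∀ x ∈ D, ∀ y ∈ D, (e x y ↔ e' x y)) :
    Nonempty (P.Equiv Q) := by
  subst hD
  let f : P.H ≃ Q.H := ((_root_.Equiv.ofInjective i h.inj).trans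
    (_root_.Equiv.setCongr (h.range_eq.trans k.range_eq.symm))).trans
    (_root_.Equiv.ofInjective j k.inj).symm
  have hf : ∀ a, j (f a) = i a := fun a =>
    _root_.Equiv.apply_ofInjective_symm k.inj
      ⟨i a, (h.range_eq.trans k.range_eq.symm) ▸ Set.mem_range_self a⟩
  have hv : ∀ a b, Q.vert (f a) = Q.vert (f b) ↔ P.vert a = P.vert b := fun a b => by
    rw [k.vert_iff, h.vert_iff, hf, hf, hs _ (h.mem a) _ (h.mem b)]
  choose σ hσ using h.surj
  have hvf : ∀ a, Q.vert (f (σ (P.vert a))) = Q.vert (f a) := fun a => by rw [hv, hσ]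
  have hbij : Function.Bijective fun v => Q.vert (f (σ v)) := by
    constructor
    · intro v w hvw
      rw [← hσ v, ← hσ w]
      exact (hv _ _).mp hvw
    · intro w
      obtain ⟨b, rfl⟩ := k.surj w
      obtain ⟨a, rfl⟩ := f.surjective b
      exact ⟨P.vert a, hvf a⟩
  refine ⟨⟨_root_.Equiv.ofBijective _ hbij, f, fun a => (hvf a).symm, fun a b => ?_⟩⟩
  rw [k.adj_iff, h.adj_iff, hf, hf, he _ (h.mem a) _ (h.mem b)]

theorem presents_self (hG : Function.Surjective G.vert) :
    G.Presents id Set.univ (fun x y => G.vert x = G.vert y) G.adj :=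
  ⟨Function.injective_id, Set.range_id, hG, fun _ _ => Iff.rfl, fun _ _ => Iff.rfl⟩

theorem Trivalent.surj (hG : G.Trivalent) : Function.Surjective G.vert := by
  intro v
  have h := hG v
  obtain ⟨⟨a, ha⟩⟩ := (Nat.card_ne_zero.mp (by omega : Nat.card {h // G.vert h = v} ≠ 0)).1
  exact ⟨a, ha⟩

theorem Presents.congr {P : FGraph.{u}} {X : Type u} {i : P.H → X} {D D' : Set X}
    {s e s' e' : X → X → Prop} (h : P.Presents i D s e) (hD : D = D')
    (hs : ∀ x ∈ D, ∀ y ∈ D, (s x y ↔ s' x y)) (he : ∀ x ∈ D, ∀ y ∈ D, (e x y ↔ e' x y)) :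
    P.Presents i D' s' e' where
  inj := h.inj
  range_eq := hD ▸ h.range_eq
  surj := h.surj
  vert_iff a b := (h.vert_iff a b).trans (hs _ (h.mem a) _ (h.mem b))
  adj_iff a b := (h.adj_iff a b).trans (he _ (h.mem a) _ (h.mem b))

theorem Presents.disjUnion {P Q : FGraph.{u}} {X : Type u} {i : P.H → X} {j : Q.H → X}
    {D D' : Set X} {s e : X → X → Prop} (h : P.Presents i D s e) (k : Q.Presents j D' s e)
    (hd : ∀ x ∈ D, ∀ y ∈ D', ¬ s x y ∧ ¬ s y x ∧ ¬ e x y ∧ ¬ e y x) :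
    (P.disjUnion Q).Presents (Sum.elim i j) (D ∪ D') s e := by
  refine ⟨h.inj.sumElim k.inj fun a b hab => ?_, ?_, h.surj.sumMap k.surj, ?_, ?_⟩
  · refine (hd _ (h.mem a) _ (k.mem b)).1 ?_
    rw [← hab, ← h.vert_iff]
  · rw [← h.range_eq, ← k.range_eq]
    exact Set.Sum.elim_range i j
  · rintro (a | a) (b | b)
    · simp [FGraph.disjUnion, h.vert_iff]
    · simp [FGraph.disjUnion, hd _ (h.mem a) _ (k.mem b)]
    · simp [FGraph.disjUnion, hd _ (h.mem b) _ (k.mem a)]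
    · simp [FGraph.disjUnion, k.vert_iff]
  · rintro (a | a) (b | b)
    · simp [FGraph.disjUnion, h.adj_iff]
    · simp [FGraph.disjUnion, hd _ (h.mem a) _ (k.mem b)]
    · simp [FGraph.disjUnion, hd _ (h.mem b) _ (k.mem a)]
    · simp [FGraph.disjUnion, k.adj_iff]

/-- A Feynman subgraph is presented inside any set that presents the ambient graph. -/
theorem Presents.part {P : FGraph.{u}} {X : Type u} {i : P.H → X} {D : Set X}
    {s e : X → X → Prop} (h : P.Presents i D s e) (γ : P.Subgraph) :
    (P.part γ.W γ.J).Presents (i ∘ γ.imm.h) {x | x ∈ D ∧ ∃ a ∈ γ.J, s (i a) x} s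
      (fun x y => e x y ∧ x ∈ i '' γ.J) where
  inj := h.inj.comp γ.imm.h_inj
  range_eq := by
    ext x
    constructor
    · rintro ⟨a, rfl⟩
      obtain ⟨b, hb, hba⟩ := γ.W_eq.le (γ.vert_imm_mem a)
      exact ⟨h.mem _, b, hb, (h.vert_iff _ _).mp hba⟩
    · rintro ⟨hx, a, ha, hax⟩
      obtain ⟨x, rfl⟩ := h.exists_eq hx
      rw [← h.vert_iff] at hax
      obtain ⟨b, rfl⟩ := γ.exists_imm_eq (hax ▸ γ.vert_mem a ha)
      exact ⟨b, rfl⟩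
  surj := by
    rintro ⟨w, hw⟩
    obtain ⟨a, rfl⟩ := h.surj w
    exact ⟨⟨a, hw⟩, rfl⟩
  vert_iff a b := by
    rw [Function.comp_apply, Function.comp_apply, ← h.vert_iff, γ.imm.vert_h,
      γ.imm.vert_h, γ.imm.v_inj.eq_iff]
  adj_iff a b := by
    rw [γ.imm.adj_iff, h.adj_iff, Function.comp_apply, Function.comp_apply,
      h.inj.mem_set_image]

end FGraph

/-! ### Chains through two-legged components -/

namespace FGraph

variable {G : FGraph.{u}} {J S : Set G.H}

/-- The two half-edges are the external edges of a component of `J` with two external edges. -/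
def Pt (G : FGraph.{u}) (J : Set G.H) (x y : G.H) : Prop :=
  x ≠ y ∧ (G.lv J (G.vert x)).ncard = 2 ∧ x ∉ J ∧ y ∉ J ∧ G.Cn J (G.vert x) (G.vert y)

/-- Half-edges joined by chains of edges passing through components with two external edges. -/
def E (G : FGraph.{u}) (J : Set G.H) : G.H → G.H → Prop := ZigEqv G.adj (G.Pt J)

/-- The half-edges of the quotient by `J`. -/
def T (G : FGraph.{u}) (J : Set G.H) : Set G.H :=
  {x | x ∉ J ∧ (G.lv J (G.vert x)).ncard = 3 ∧ ∃ k ∈ G.lv J (G.vert x), k ∈ G.inn}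

theorem Pt.symm {x y : G.H} (h : G.Pt J x y) : G.Pt J y x := by
  obtain ⟨h1, h2, h3, h4, h5⟩ := h
  exact ⟨h1.symm, lv_congr h5 ▸ h2, h4, h3, h5.symm⟩

theorem Pt.eq_or_eq {x y z : G.H} (h : G.Pt J x y) (hz : z ∉ J)
    (hzx : G.Cn J (G.vert z) (G.vert x)) : z = x ∨ z = y := by
  obtain ⟨h1, h2, h3, h4, h5⟩ := h
  obtain ⟨p, q, _, hpq⟩ := Set.ncard_eq_two.mp h2
  have hx : x ∈ G.lv J (G.vert x) := ⟨h3, .refl _⟩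
  have hy : y ∈ G.lv J (G.vert x) := ⟨h4, h5.symm⟩
  have hz : z ∈ G.lv J (G.vert x) := ⟨hz, hzx⟩
  rw [hpq] at hx hy hz
  simp only [Set.mem_insert_iff, Set.mem_singleton_iff] at hx hy hz
  grind

theorem Pt.unique {x y z : G.H} (h : G.Pt J x y) (k : G.Pt J x z) : y = z := by
  rcases h.eq_or_eq k.2.2.2.1 k.2.2.2.2.symm with h' | h'
  · exact absurd h'.symm k.1
  · exact h'.symm

/-- Three legs are not two: the half-edges of the quotient are ends of alternating paths, as the
results on `ZigEqv` require. -/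
theorem not_pt_of_mem_T {x y : G.H} (hx : x ∈ G.T J) : ¬ G.Pt J x y := by
  rintro ⟨_, h, _⟩
  have := hx.2.1
  omega

theorem mem_T_of_cn {x y : G.H} (hx : x ∈ G.T J) (hy : y ∉ J)
    (h : G.Cn J (G.vert x) (G.vert y)) : y ∈ G.T J :=
  ⟨hy, lv_congr h ▸ hx.2⟩

namespace E

variable {x y z : G.H}

theorem refl (x : G.H) : G.E J x x := Relation.EqvGen.refl x

theorem symm (h : G.E J x y) : G.E J y x := Relation.EqvGen.symm _ _ h

theorem trans (h : G.E J x y) (k : G.E J y z) : G.E J x z := Relation.EqvGen.trans _ _ _ h k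

theorem of_adj (h : G.adj x y) : G.E J x y := .rel _ _ (.inl h)

theorem of_pt (h : G.Pt J x y) : G.E J x y := .rel _ _ (.inr h)

theorem induction {P : G.H → Prop} (hA : ∀ a b, G.adj a b → P a → P b)
    (hP : ∀ a b, G.Pt J a b → P a → P b) (h : G.E J x y) (hx : P x) : P y :=
  ZigEqv.induction G.adj_symm (fun _ _ => Pt.symm) hA hP h hx

theorem zig (h : G.E J x y) (hx : x ∈ G.T J) (hy : y ∈ G.T J) (hne : x ≠ y) :
    Zig G.adj (G.Pt J) x y :=
  ZigEqv.zig G.adj_symm (fun _ _ => Pt.symm) G.adj_unique (fun _ _ _ => Pt.unique)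
    (fun _ => not_pt_of_mem_T hx) (fun _ => not_pt_of_mem_T hy) hne h

theorem ends_unique (h : G.E J x y) (k : G.E J x z) (hx : x ∈ G.T J) (hy : y ∈ G.T J)
    (hz : z ∈ G.T J) (hxy : x ≠ y) (hxz : x ≠ z) : y = z :=
  ZigEqv.ends_unique (P := G.Pt J) G.adj_symm (fun _ _ => Pt.symm) G.adj_unique
    (fun _ _ _ => Pt.unique) (fun _ => not_pt_of_mem_T hx) (fun _ => not_pt_of_mem_T hy)
    (fun _ => not_pt_of_mem_T hz)
    h k hxy hxz

theorem mem_inn (h : G.E J x y) (k : G.E J x z) (hx : x ∈ G.T J) (hy : y ∈ G.T J)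
    (hxy : x ≠ y) : z ∈ G.inn :=
  ZigEqv.exists_step (P := G.Pt J) G.adj_symm (fun _ _ => Pt.symm) G.adj_unique
    (fun _ _ _ => Pt.unique) (fun _ => not_pt_of_mem_T hx) (fun _ => not_pt_of_mem_T hy) hxy h k

end E

/-- A vertex not met by J is a class by itself, with three legs by trivalence. -/
theorem ncard_lv (hT : G.Trivalent) (hJ : G.Good J) (v : G.V) :
    (G.lv J v).ncard = 2 ∨ (G.lv J v).ncard = 3 := by
  by_cases h : ∃ a ∈ J, G.vert a = v
  · obtain ⟨a, ha, rfl⟩ := h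
    exact hJ.legs a ha
  · right
    have h1 : ∀ w, G.Cn J v w → w = v := fun w hw =>
      hw.induction (P := fun w => w = v) hJ.paired.closed
        (fun a _ _ ha hav => absurd ⟨a, ha, hav⟩ h) rfl
    have h2 : G.lv J v = {x | G.vert x = v} := by
      ext x
      exact ⟨fun hx => h1 _ hx.2.symm, fun hx => ⟨fun ha => h ⟨x, ha, hx⟩, .of_eq hx⟩⟩
    rw [h2]
    exact hT v

theorem mem_T_or_pt (hT : G.Trivalent) (hJ : G.Good J) {x : G.H} (hx : x ∉ J) (hi : x ∈ G.inn) :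
    x ∈ G.T J ∨ ∃ y, G.Pt J x y := by
  have hxl : x ∈ G.lv J (G.vert x) := ⟨hx, .refl _⟩
  rcases ncard_lv hT hJ (G.vert x) with h | h
  · right
    obtain ⟨y, hy, hyx⟩ := Set.exists_ne_of_one_lt_ncard (h ▸ one_lt_two) x
    exact ⟨y, hyx.symm, h, hx, hy.1, hy.2.symm⟩
  · exact .inl ⟨hx, h, x, hxl, hi⟩

/-! ### Enlarging a Feynman subgraph -/

/-- The class of `v` under `J` is not enlarged by `S`. -/
theorem cn_of_isolated (hS : G.Paired S) {v w : G.V}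
    (h : ∀ s ∈ S, s ∉ J → ¬ G.Cn J (G.vert s) v) (hw : G.Cn S v w) : G.Cn J v w := by
  refine hw.induction (P := fun w => G.Cn J v w) hS.closed ?_ (.refl _)
  intro a b hab ha hva
  by_cases haJ : a ∈ J
  · exact hva.trans (.of_adj hab haJ)
  · exact absurd hva.symm (h a ha haJ)

theorem lv_of_isolated (hS : G.Paired S) (hJS : J ⊆ S) {v : G.V}
    (h : ∀ s ∈ S, s ∉ J → ¬ G.Cn J (G.vert s) v) : G.lv S v = G.lv J v := by
  ext x
  constructor
  · rintro ⟨h1, h2⟩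
    exact ⟨fun hx => h1 (hJS hx), (cn_of_isolated hS h h2.symm).symm⟩
  · rintro ⟨h1, h2⟩
    exact ⟨fun hx => h x hx h1 h2, h2.mono hJS⟩

/-- `S` is obtained from `J` by adding full chains of edges and components of `J` with two external
edges, each chain having an end in the quotient. -/
structure Compat (G : FGraph.{u}) (J S : Set G.H) : Prop where
  sub : J ⊆ S
  paired : G.Paired S
  pt : ∀ x y, x ∈ S → G.Pt J x y → y ∈ S
  exists_end : ∀ x ∈ S, x ∉ J → ∃ t ∈ G.T J, G.E J t x

theorem E.mem (hJ : G.Good J) (hS : G.Compat J S) {x y : G.H} (h : G.E J x y)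
    (hx : x ∈ S ∧ x ∉ J) : y ∈ S ∧ y ∉ J :=
  h.induction (P := fun y => y ∈ S ∧ y ∉ J)
    (fun _ _ hab ha => ⟨hS.paired.closed _ _ hab ha.1,
      fun hb => ha.2 (hJ.paired.closed _ _ (G.adj_symm _ _ hab) hb)⟩)
    (fun _ _ hab ha => ⟨hS.pt _ _ ha.1 hab, hab.2.2.2.1⟩) hx

/-- The step relation A and the set R are kept general because the lemma is used for full chains in
S and also for chains avoiding one edge. -/
theorem cn_of_zigEqv (hJ : G.Good J) (hS : G.Compat J S) {R : Set G.H} (hR : J ⊆ R)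
    {A : G.H → G.H → Prop} (hA : ∀ x y, A x y → A y x) (hadj : ∀ x y, A x y → G.adj x y)
    (hAR : ∀ x y, A x y → x ∈ S → x ∈ R) {x y : G.H} (h : ZigEqv A (G.Pt J) x y)
    (hx : x ∈ S) (hx' : x ∉ J) : G.Cn R (G.vert x) (G.vert y) := by
  refine (h.induction hA (fun _ _ => Pt.symm)
    (Q := fun y => y ∈ S ∧ y ∉ J ∧ G.Cn R (G.vert x) (G.vert y)) ?_ ?_ ⟨hx, hx', .refl _⟩).2.2
  · rintro a b hab ⟨h1, h2, h3⟩
    have h4 := (E.of_adj (J := J) (hadj _ _ hab)).mem hJ hS ⟨h1, h2⟩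
    exact ⟨h4.1, h4.2, h3.trans (.of_adj (hadj _ _ hab) (hAR _ _ hab h1))⟩
  · rintro a b hab ⟨h1, h2, h3⟩
    have h4 := (E.of_pt hab).mem hJ hS ⟨h1, h2⟩
    exact ⟨h4.1, h4.2, h3.trans (hab.2.2.2.2.mono hR)⟩

theorem E.cn (hJ : G.Good J) (hS : G.Compat J S) {x y : G.H} (h : G.E J x y)
    (hx : x ∈ S) (hx' : x ∉ J) : G.Cn S (G.vert x) (G.vert y) :=
  cn_of_zigEqv hJ hS hS.sub G.adj_symm (fun _ _ => id) (fun _ _ _ => id) h hx hx'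

/-- If S meets the legs of the J-component of x, that component cannot be two-legged, for S would
then contain both legs, including x. If S does not meet them, x is already J-connected to t. -/
theorem Compat.mem_T (hT : G.Trivalent) (hJ : G.Good J) (hS : G.Compat J S) {x t : G.H}
    (hx : x ∉ S) (ht : t ∈ G.T J) (h : G.Cn S (G.vert t) (G.vert x)) : x ∈ G.T J := by
  have hx' : x ∉ J := fun hx' => hx (hS.sub hx')
  by_cases hs : ∃ s ∈ S, s ∉ J ∧ G.Cn J (G.vert s) (G.vert x)
  · obtain ⟨s, hs, hsJ, hsx⟩ := hs
    rcases mem_T_or_pt hT hJ hsJ (hS.paired.subset_inn hs) with h1 | ⟨y, h1⟩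
    · exact mem_T_of_cn h1 hx' hsx
    · rcases h1.eq_or_eq hx' hsx.symm with rfl | rfl
      · exact absurd hs hx
      · exact absurd (hS.pt _ _ hs h1) hx
  · push Not at hs
    exact mem_T_of_cn ht hx' (cn_of_isolated hS.paired hs h.symm).symm

/-- Either `x` lies in the quotient, or its component is not affected by `S`. -/
theorem Compat.mem_T_or_isolated (hT : G.Trivalent) (hJ : G.Good J) (hS : G.Compat J S) {x : G.H} :
    (∀ y, y ∉ S → G.Cn S (G.vert x) (G.vert y) → y ∈ G.T J) ∨
      ∀ s ∈ S, s ∉ J → ¬ G.Cn J (G.vert s) (G.vert x) := by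
  by_cases hs : ∃ s ∈ S, s ∉ J ∧ G.Cn J (G.vert s) (G.vert x)
  · left
    intro y hy hxy
    obtain ⟨s, hs, hsJ, hsx⟩ := hs
    obtain ⟨t, ht, hts⟩ := hS.exists_end s hs hsJ
    exact hS.mem_T hT hJ hy ht (((hts.symm.cn hJ hS hs hsJ).symm.trans (hsx.mono hS.sub)).trans hxy)
  · right
    push Not at hs
    exact hs

/-- If S contained just one leg of a two-legged component of J, the edge at that leg would be a
bridge of S. If a chain in S had no end in the quotient, its S-component would have no external
edges, whereas two or three are required. -/
theorem Good.compat (hT : G.Trivalent) (hJ : G.Good J) (hS : G.Good S) (hJS : J ⊆ S) :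
    G.Compat J S := by
  have hpt : ∀ x y, x ∈ S → G.Pt J x y → y ∈ S := by
    intro x y hx hxy
    by_contra hy
    obtain ⟨x', hx', hxx'⟩ := hS.paired x hx
    -- Without the edge {x, x'}, the component of x meets no other edge of S outside J, so the
    -- detour around that edge must run inside J.
    have h1 : G.Cn J (G.vert x) (G.vert x') := by
      refine cn_of_isolated (hS.paired.diff hxx') ?_ (hS.irred x x' hxx' hx)
      rintro s ⟨hs, hs'⟩ hsJ hsx
      rcases hxy.eq_or_eq hsJ hsx with rfl | rfl
      · exact hs' (.inl rfl)
      · exact hy hs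
    have h2 : x' ∉ J := fun h => hxy.2.2.1 (hJ.paired.closed _ _ (G.adj_symm _ _ hxx') h)
    rcases hxy.eq_or_eq h2 h1.symm with rfl | rfl
    · exact G.adj_irrefl _ hxx'
    · exact hy hx'
  refine ⟨hJS, hS.paired, hpt, fun x hx hxJ => ?_⟩
  by_contra hno
  push Not at hno
  -- On a chain without ends every component passed is two-legged, and both its legs lie on the
  -- chain and in S.
  have key : ∀ h, h ∈ S → h ∉ J → G.E J x h → ∀ a, a ∉ J → G.Cn J (G.vert h) (G.vert a) →
      a ∈ S ∧ G.E J x a := by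
    intro h hhS hhJ hxh a ha hha
    rcases mem_T_or_pt hT hJ hhJ (hS.paired.subset_inn hhS) with h1 | ⟨y, h1⟩
    · exact absurd hxh.symm (hno h h1)
    · rcases h1.eq_or_eq ha hha.symm with rfl | rfl
      · exact ⟨hhS, hxh⟩
      · exact ⟨hpt _ _ hhS h1, hxh.trans (.of_pt h1)⟩
  have h1 : ∀ w, G.Cn S (G.vert x) w →
      ∃ h ∈ S, h ∉ J ∧ G.E J x h ∧ G.Cn J (G.vert h) w := by
    intro w hw
    refine hw.induction (P := fun w => ∃ h ∈ S, h ∉ J ∧ G.E J x h ∧ G.Cn J (G.vert h) w)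
      hS.paired.closed ?_ ⟨x, hx, hxJ, .refl _, .refl _⟩
    rintro a b hab ha ⟨h, hhS, hhJ, hxh, hha⟩
    by_cases haJ : a ∈ J
    · exact ⟨h, hhS, hhJ, hxh, hha.trans (.of_adj hab haJ)⟩
    · refine ⟨b, hS.paired.closed _ _ hab ha, ?_, ?_, .refl _⟩
      · exact fun hb => haJ (hJ.paired.closed _ _ (G.adj_symm _ _ hab) hb)
      · exact (key h hhS hhJ hxh a haJ hha).2.trans (.of_adj hab)
  have h2 : G.lv S (G.vert x) = ∅ := by
    refine Set.eq_empty_of_forall_notMem ?_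
    rintro y ⟨hy, hyx⟩
    obtain ⟨h, hhS, hhJ, hxh, hhy⟩ := h1 _ hyx.symm
    exact hy (key h hhS hhJ hxh y (fun hyJ => hy (hJS hyJ)) hhy).1
  have h3 := hS.legs x hx
  rw [h2, Set.ncard_empty] at h3
  omega

/-! ### Quotients -/

/-- `Q` is the quotient of `G` by `J`, with half-edges included by `i`. -/
abbrev IsQuot (G : FGraph.{u}) (J : Set G.H) (Q : FGraph.{u}) (i : Q.H → G.H) : Prop :=
  Q.Presents i (G.T J) (fun x y => G.Cn J (G.vert x) (G.vert y)) (fun x y => x ≠ y ∧ G.E J x y)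

namespace Subgraph

theorem partner_iff (γ : G.Subgraph) (x y : G.H) : γ.Partner x y ↔ G.Pt γ.J x y := by
  have hl : ∀ v, γ.leaving (Quotient.mk γ.comp v) = G.lv γ.J v := fun v => by
    ext h
    exact and_congr_right fun _ => Quotient.eq (r := γ.comp)
  constructor
  · rintro ⟨h1, c, h2, ⟨h3, rfl⟩, ⟨h4, h5⟩⟩
    rw [hl] at h2
    exact ⟨h1, h2, h3, h4, (Quotient.exact (s := γ.comp) h5).symm⟩
  · rintro ⟨h1, h2, h3, h4, h5⟩
    rw [← hl] at h2
    exact ⟨h1, _, h2, ⟨h3, rfl⟩, h4, (Quotient.sound (s := γ.comp) h5).symm⟩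

theorem chain_iff (γ : G.Subgraph) (x y : G.H) : γ.Chain x y ↔ Zig G.adj (G.Pt γ.J) x y := by
  constructor
  · intro h
    induction h with
    | edge a b h => exact .edge a b h
    | step a k l b h p _ ih => exact .step a k l b h ((γ.partner_iff _ _).mp p) ih
  · intro h
    induction h with
    | edge a b h => exact .edge a b h
    | step a k l b h p _ ih => exact .step a k l b h ((γ.partner_iff _ _).mpr p) ih

/-- The inclusion of the half-edges of a quotient graph. -/
def quotH (γ : G.Subgraph) : γ.quot.H → G.H := Subtype.val

/-- Between distinct half-edges of the quotient, an alternating chain exists as soon as they are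
equivalent, because both are ends. From here on the symmetric, transitive relation `E` replaces
chains. -/
theorem isQuot (γ : G.Subgraph) : G.IsQuot γ.J γ.quot γ.quotH := by
  have hl : ∀ v, γ.leaving (Quotient.mk γ.comp v) = G.lv γ.J v := fun v => by
    ext h
    exact and_congr_right fun _ => Quotient.eq (r := γ.comp)
  have hq : ∀ v, Quotient.mk γ.comp v ∈ γ.quotV ↔
      (G.lv γ.J v).ncard = 3 ∧ ∃ k ∈ G.lv γ.J v, k ∈ G.inn := fun v => by
    simp only [quotV, Set.mem_ofPred_eq, hl, External, inn, not_forall, not_not]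
  have hr : Set.range γ.quotH = G.T γ.J := by
    refine Subtype.range_coe.trans ?_
    ext x
    exact and_congr_right fun _ => hq _
  have hmem : ∀ a, γ.quotH a ∈ G.T γ.J := fun a => hr ▸ Set.mem_range_self a
  have hinj : Function.Injective γ.quotH := Subtype.val_injective
  refine ⟨hinj, hr, ?_, ?_, ?_⟩
  · rintro ⟨c, hc⟩
    obtain ⟨h, hh⟩ : (γ.leaving c).Nonempty := by
      rw [Set.nonempty_iff_ne_empty]
      intro h0
      have := hc.1
      rw [h0, Set.ncard_empty] at this
      omega
    obtain ⟨h1, rfl⟩ := hh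
    exact ⟨⟨h, h1, hc⟩, rfl⟩
  · intro a b
    exact Subtype.ext_iff.trans (Quotient.eq (r := γ.comp))
  · intro a b
    change a ≠ b ∧ γ.Chain (γ.quotH a) (γ.quotH b) ↔ _
    rw [γ.chain_iff, hinj.ne_iff]
    exact and_congr_right fun hne =>
      ⟨Zig.eqv, fun k => E.zig k (hmem a) (hmem b) (hinj.ne hne)⟩

end Subgraph

/-! ### Feynman subgraphs of a quotient -/

namespace IsQuot

variable {Q : FGraph.{u}} {i : Q.H → G.H}

theorem mem_T (hQ : G.IsQuot J Q i) (a : Q.H) : i a ∈ G.T J := hQ.mem a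

theorem notMem (hQ : G.IsQuot J Q i) (a : Q.H) : i a ∉ J := (hQ.mem a).1

/-- An edge of Q expands to a chain in S. Conversely, a path in S contracts to one in Q, because
each chain it follows is an edge of Q once both ends are reached. -/
theorem cn_preimage (hQ : G.IsQuot J Q i) (hT : G.Trivalent) (hJ : G.Good J)
    (hS : G.Compat J S) {a b : Q.H} :
    Q.Cn (i ⁻¹' S) (Q.vert a) (Q.vert b) ↔ G.Cn S (G.vert (i a)) (G.vert (i b)) := by
  have hcl : ∀ x y, Q.adj x y → x ∈ i ⁻¹' S → y ∈ i ⁻¹' S := fun x y hxy hx =>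
    (((hQ.adj_iff x y).mp hxy).2.mem hJ hS ⟨hx, hQ.notMem x⟩).1
  constructor
  · intro h
    refine h.induction (P := fun w => ∀ b, Q.vert b = w → G.Cn S (G.vert (i a)) (G.vert (i b)))
      hcl ?_ ?_ b rfl
    · intro x y hxy hx ih c hc
      have h1 := ((hQ.adj_iff x y).mp hxy).2.cn hJ hS hx (hQ.notMem x)
      have h2 := (hQ.vert_iff y c).mp hc.symm
      exact ((ih x rfl).trans h1).trans (h2.mono hS.sub)
    · intro c hc
      exact ((hQ.vert_iff a c).mp hc.symm).mono hS.sub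
  · intro h
    -- Invariant along the path: t is a quotient half-edge reached in Q, and the current vertex is
    -- either in the component of t or in a two-legged component on the chain through t.
    suffices ∃ t, Q.Cn (i ⁻¹' S) (Q.vert a) (Q.vert t) ∧
        (G.Cn J (G.vert (i t)) (G.vert (i b)) ∨ ∃ x y, G.Pt J x y ∧ x ∈ S ∧ G.E J (i t) x ∧
          G.Cn J (G.vert x) (G.vert (i b))) by
      obtain ⟨t, hat, ht⟩ := this
      rcases ht with ht | ⟨x, y, hxy, _, _, hxb⟩
      · exact hat.trans (.of_eq ((hQ.vert_iff t b).mpr ht))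
      · exact absurd (mem_T_of_cn (hQ.mem_T b) hxy.2.2.1 hxb.symm)
          fun h => not_pt_of_mem_T h hxy
    refine h.induction (P := fun v => ∃ t, Q.Cn (i ⁻¹' S) (Q.vert a) (Q.vert t) ∧
        (G.Cn J (G.vert (i t)) v ∨ ∃ x y, G.Pt J x y ∧ x ∈ S ∧ G.E J (i t) x ∧
          G.Cn J (G.vert x) v)) hS.paired.closed ?_ ⟨a, .refl _, .inl (.refl _)⟩
    rintro p q hpq hp ⟨t, hat, ht⟩
    by_cases hpJ : p ∈ J
    · refine ⟨t, hat, ht.imp (fun h => h.trans (.of_adj hpq hpJ)) ?_⟩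
      rintro ⟨x, y, h1, h2, h3, h4⟩
      exact ⟨x, y, h1, h2, h3, h4.trans (.of_adj hpq hpJ)⟩
    · have hq : q ∈ S := hS.paired.closed _ _ hpq hp
      have hqJ : q ∉ J := fun hq => hpJ (hJ.paired.closed _ _ (G.adj_symm _ _ hpq) hq)
      -- a member of the quotient linked to `q` by a chain
      obtain ⟨t', hat', htq⟩ : ∃ t', Q.Cn (i ⁻¹' S) (Q.vert a) (Q.vert t') ∧
          G.E J (i t') q := by
        rcases ht with ht | ⟨x, y, h1, h2, h3, h4⟩
        · obtain ⟨p', rfl⟩ := hQ.exists_eq (mem_T_of_cn (hQ.mem_T t) hpJ ht)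
          exact ⟨p', hat.trans (.of_eq ((hQ.vert_iff _ _).mpr ht)), .of_adj hpq⟩
        · refine ⟨t, hat, ?_⟩
          rcases h1.eq_or_eq hpJ h4.symm with rfl | rfl
          · exact h3.trans (.of_adj hpq)
          · exact (h3.trans (.of_pt h1)).trans (.of_adj hpq)
      rcases mem_T_or_pt hT hJ hqJ (hS.paired.subset_inn hq) with h | ⟨y, h⟩
      · obtain ⟨q', rfl⟩ := hQ.exists_eq h
        refine ⟨q', ?_, .inl (.refl _)⟩
        by_cases he : i t' = i q'
        · rwa [← hQ.inj he]
        · exact hat'.trans (.of_adj ((hQ.adj_iff _ _).mpr ⟨he, htq⟩)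
            (htq.symm.mem hJ hS ⟨hq, hqJ⟩).1)
      · exact ⟨t', hat', .inr ⟨q, y, h, hq, htq, .refl _⟩⟩

theorem image_lv_preimage (hQ : G.IsQuot J Q i) (hT : G.Trivalent) (hJ : G.Good J)
    (hS : G.Compat J S) (a : Q.H) :
    i '' Q.lv (i ⁻¹' S) (Q.vert a) = G.lv S (G.vert (i a)) := by
  ext x
  constructor
  · rintro ⟨b, ⟨h1, h2⟩, rfl⟩
    exact ⟨h1, (hQ.cn_preimage hT hJ hS).mp h2⟩
  · rintro ⟨h1, h2⟩
    obtain ⟨b, rfl⟩ := hQ.exists_eq (hS.mem_T hT hJ h1 (hQ.mem_T a) h2.symm)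
    exact ⟨b, ⟨h1, (hQ.cn_preimage hT hJ hS).mpr h2⟩, rfl⟩

theorem ncard_lv_preimage (hQ : G.IsQuot J Q i) (hT : G.Trivalent) (hJ : G.Good J)
    (hS : G.Compat J S) (a : Q.H) :
    (Q.lv (i ⁻¹' S) (Q.vert a)).ncard = (G.lv S (G.vert (i a))).ncard := by
  rw [← hQ.image_lv_preimage hT hJ hS, Set.ncard_image_of_injective _ hQ.inj]

/-- `S` without the chain through `x`. -/
def _root_.FGraph.dropChain (G : FGraph.{u}) (J S : Set G.H) (x : G.H) : Set G.H :=
  {y | y ∈ S ∧ (y ∈ J ∨ ¬ G.E J x y)}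

theorem _root_.FGraph.Compat.dropChain (hJ : G.Good J) (hS : G.Compat J S) (x : G.H) :
    G.Compat J (G.dropChain J S x) where
  sub := fun y hy => ⟨hS.sub hy, .inl hy⟩
  paired := by
    rintro y ⟨hy, hy'⟩
    obtain ⟨z, hz, hyz⟩ := hS.paired y hy
    exact ⟨z, ⟨hz, hy'.imp (hJ.paired.closed _ _ hyz)
      fun h k => h (k.trans (.of_adj (G.adj_symm _ _ hyz)))⟩, hyz⟩
  pt := by
    rintro y z ⟨hy, hy'⟩ hyz
    refine ⟨hS.pt _ _ hy hyz, .inr fun k => ?_⟩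
    exact (hy'.resolve_left hyz.2.2.1) (k.trans (.of_pt hyz.symm))
  exists_end := fun y hy hyJ => hS.exists_end y hy.1 hyJ

/-- A chain has only two ends, so deleting all of it in G deletes exactly one edge of Q. -/
theorem preimage_dropChain (hQ : G.IsQuot J Q i) {a b : Q.H} (hab : Q.adj a b) :
    i ⁻¹' G.dropChain J S (i a) = i ⁻¹' S \ {a, b} := by
  obtain ⟨h1, h2⟩ := (hQ.adj_iff a b).mp hab
  ext c
  refine and_congr_right fun _ => ?_
  rw [or_iff_right (hQ.notMem c), not_iff_not]
  constructor
  · intro h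
    by_cases hac : i a = i c
    · exact .inl (hQ.inj hac).symm
    · exact .inr (hQ.inj (h.ends_unique h2 (hQ.mem_T a) (hQ.mem_T c) (hQ.mem_T b) hac h1))
  · rintro (rfl | rfl)
    · exact .refl _
    · exact h2

/-- The legs agree by counting. Irreducibility of S enters twice: it rules out a chain in S with a
single end, and it makes the ends of a chain remain connected when the whole chain is deleted. -/
theorem good_preimage (hQ : G.IsQuot J Q i) (hT : G.Trivalent) (hJ : G.Good J) (hS : G.Good S)
    (hJS : J ⊆ S) : Q.Good (i ⁻¹' S) := by
  have hc := Good.compat hT hJ hS hJS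
  have hinn : ∀ x ∈ S, x ∈ G.inn := fun x hx => hS.paired.subset_inn hx
  refine ⟨?_, ?_, ?_⟩
  · intro k hk
    obtain ⟨m, hm, hkm⟩ := hS.paired _ hk
    by_contra hno
    have hno' : ∀ t ∈ G.T J, G.E J (i k) t → t = i k := by
      intro t ht hkt
      by_contra hne
      obtain ⟨t, rfl⟩ := hQ.exists_eq ht
      exact hno ⟨t, (hkt.mem hJ hc ⟨hk, hQ.notMem k⟩).1,
        (hQ.adj_iff _ _).mpr ⟨Ne.symm hne, hkt⟩⟩
    have hEm : G.E J (i k) m := .of_adj hkm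
    have hmk : m ∉ G.T J := fun h => by
      have := hno' m h hEm
      rw [this] at hkm
      exact G.adj_irrefl _ hkm
    -- A detour from m back to `i k` avoiding the edge between them would stay in two-legged
    -- components of the chain, and so could not reach the three-legged component of `i k`.
    suffices ∃ h, G.E J (i k) h ∧ (h ∈ S ∧ h ∉ J) ∧ h ∉ G.T J ∧
        G.Cn J (G.vert h) (G.vert (i k)) by
      obtain ⟨h, _, h2, hhT, hhk⟩ := this
      exact hhT (mem_T_of_cn (hQ.mem_T k) h2.2 hhk.symm)
    refine (hS.irred _ _ hkm hk).symm.induction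
      (P := fun w => ∃ h, G.E J (i k) h ∧ (h ∈ S ∧ h ∉ J) ∧ h ∉ G.T J ∧ G.Cn J (G.vert h) w)
      (hS.paired.diff hkm).closed ?_
      ⟨m, hEm, hEm.mem hJ hc ⟨hk, hQ.notMem k⟩, hmk, .refl _⟩
    rintro a b hab ⟨haS, ha⟩ ⟨h, h1, h2, h3, h4⟩
    by_cases haJ : a ∈ J
    · exact ⟨h, h1, h2, h3, h4.trans (.of_adj hab haJ)⟩
    · obtain ⟨y, hy⟩ := (mem_T_or_pt hT hJ h2.2 (hinn _ h2.1)).resolve_left h3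
      have hka : G.E J (i k) a := by
        rcases hy.eq_or_eq haJ h4.symm with rfl | rfl
        · exact h1
        · exact h1.trans (.of_pt hy)
      have hkb : G.E J (i k) b := hka.trans (.of_adj hab)
      refine ⟨b, hkb, hkb.mem hJ hc ⟨hk, hQ.notMem k⟩, fun hb => ?_, .refl _⟩
      have hbk := hno' b hb hkb
      rw [hbk] at hab
      exact ha (.inr (G.adj_unique _ _ _ (G.adj_symm _ _ hab) hkm))
  · intro a ha
    rw [hQ.ncard_lv_preimage hT hJ hc]
    exact hS.legs _ ha
  · intro a b hab ha
    have hab' := (hQ.adj_iff a b).mp hab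
    have hd := hc.dropChain hJ (i a)
    rw [← hQ.preimage_dropChain hab, hQ.cn_preimage hT hJ hd]
    obtain ⟨m, hm, ham⟩ := hS.paired _ ha
    by_contra hne
    -- Deleting the chain isolates the two-legged components on it, so among the chain's members
    -- only its ends can be reached from `i a`.
    have aux : ∀ p, G.E J (i a) p → G.Cn (G.dropChain J S (i a)) (G.vert (i a)) (G.vert p) →
        p ∈ G.T J := by
      intro p hap hcp
      have hp := hap.mem hJ hc ⟨ha, hQ.notMem a⟩
      rcases mem_T_or_pt hT hJ hp.2 (hinn _ hp.1) with h | ⟨y, hy⟩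
      · exact h
      · refine mem_T_of_cn (hQ.mem_T a) hp.2 (cn_of_isolated hd.paired ?_ hcp.symm).symm
        intro s hs hsJ hsp
        refine (hs.2.resolve_left hsJ) ?_
        rcases hy.eq_or_eq hsJ hsp with rfl | rfl
        · exact hap
        · exact hap.trans (.of_pt hy)
    have aux' : ∀ p, p ≠ i a → G.E J (i a) p →
        ¬ G.Cn (G.dropChain J S (i a)) (G.vert (i a)) (G.vert p) := by
      intro p hpa hap hcp
      have := hap.ends_unique hab'.2 (hQ.mem_T a) (aux p hap hcp) (hQ.mem_T b) hpa.symm hab'.1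
      exact hne (this ▸ hcp)
    have hm : G.Cn (G.dropChain J S (i a)) (G.vert (i a)) (G.vert m) := by
      refine (hS.irred _ _ ham ha).induction
        (P := fun w => G.Cn (G.dropChain J S (i a)) (G.vert (i a)) w)
        (hS.paired.diff ham).closed ?_ (.refl _)
      rintro p q hpq ⟨hp, hp'⟩ hcp
      by_cases hpd : p ∈ G.dropChain J S (i a)
      · exact hcp.trans (.of_adj hpq hpd)
      · have hap : G.E J (i a) p := by
          by_contra h
          exact hpd ⟨hp, .inr h⟩
        exact absurd hcp (aux' p (fun h => hp' (.inl h)) hap)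
    refine aux' m ?_ (.of_adj ham) hm
    rintro rfl
    exact G.adj_irrefl _ ham

/-- An S-component either contains a chain, and its legs are counted in Q, or is a single
J-component. An edge removed from a chain is bypassed by going out to both ends of the chain and
connecting these by irreducibility of Q. -/
theorem good_of_preimage (hQ : G.IsQuot J Q i) (hT : G.Trivalent) (hJ : G.Good J)
    (hc : G.Compat J S) (hK : Q.Good (i ⁻¹' S)) : G.Good S := by
  refine ⟨hc.paired, ?_, ?_⟩
  · intro a ha
    by_cases hs : ∃ s ∈ S, s ∉ J ∧ G.Cn S (G.vert s) (G.vert a)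
    · obtain ⟨s, hs, hsJ, hsa⟩ := hs
      obtain ⟨t, ht, hts⟩ := hc.exists_end s hs hsJ
      obtain ⟨k, rfl⟩ := hQ.exists_eq ht
      have hka := (hts.symm.cn hJ hc hs hsJ).symm.trans hsa
      rw [← lv_congr hka, ← hQ.ncard_lv_preimage hT hJ hc]
      exact hK.legs k (hts.symm.mem hJ hc ⟨hs, hsJ⟩).1
    · push Not at hs
      rw [lv_of_isolated hc.paired hc.sub fun s hsS hsJ h => hs s hsS hsJ (h.mono hc.sub)]
      exact ncard_lv hT hJ _
  · intro a b hab ha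
    by_cases haJ : a ∈ J
    · exact (hJ.irred a b hab haJ).mono (Set.sdiff_subset_sdiff_left hc.sub)
    have hbJ : b ∉ J := fun hb => haJ (hJ.paired.closed _ _ (G.adj_symm _ _ hab) hb)
    have hb : b ∈ S := hc.paired.closed _ _ hab ha
    obtain ⟨t, ht, hka⟩ := hc.exists_end a ha haJ
    obtain ⟨k, rfl⟩ := hQ.exists_eq ht
    have hk : i k ∈ S := (hka.symm.mem hJ hc ⟨ha, haJ⟩).1
    obtain ⟨k', hk', hkk'⟩ := hK.paired k hk
    obtain ⟨hne, hE⟩ := (hQ.adj_iff _ _).mp hkk'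
    have h1 : G.Cn (S \ {a, b}) (G.vert (i k)) (G.vert (i k')) := by
      have h := hK.irred k k' hkk' hk
      rw [← hQ.preimage_dropChain hkk', hQ.cn_preimage hT hJ (hc.dropChain hJ _)] at h
      refine h.mono ?_
      rintro x ⟨hx, hx'⟩
      refine ⟨hx, ?_⟩
      rintro (rfl | rfl)
      · exact (hx'.resolve_left haJ) hka
      · exact (hx'.resolve_left hbJ) (hka.trans (.of_adj hab))
    -- chains that avoid the edge `{a, b}`
    let A : G.H → G.H → Prop := fun x y => G.adj x y ∧ x ≠ a ∧ x ≠ b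
    have hA : ∀ x y, A x y → A y x := by
      rintro x y ⟨hxy, hxa, hxb⟩
      refine ⟨G.adj_symm _ _ hxy, ?_, ?_⟩
      · rintro rfl
        exact hxb (G.adj_unique _ _ _ (G.adj_symm _ _ hxy) hab)
      · rintro rfl
        exact hxa (G.adj_unique _ _ _ (G.adj_symm _ _ hxy) (G.adj_symm _ _ hab))
    have hcn : ∀ x y, x ∈ S → x ∉ J → ZigEqv A (G.Pt J) x y →
        G.Cn (S \ {a, b}) (G.vert x) (G.vert y) := by
      intro x y hx hxJ h
      refine cn_of_zigEqv hJ hc ?_ hA (fun _ _ h => h.1) ?_ h hx hxJ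
      · intro z hz
        refine ⟨hc.sub hz, ?_⟩
        rintro (rfl | rfl)
        exacts [haJ hz, hbJ hz]
      · rintro x y ⟨_, h2, h3⟩ hx
        exact ⟨hx, by simp [h2, h3]⟩
    have hsplit : ∀ y, G.E J a y → ZigEqv A (G.Pt J) a y ∨ ZigEqv A (G.Pt J) b y := by
      intro y hy
      refine hy.induction (P := fun y => ZigEqv A (G.Pt J) a y ∨ ZigEqv A (G.Pt J) b y) ?_ ?_
        (.inl (.refl _))
      · intro p q hpq hp
        by_cases hpa : p = a
        · subst hpa
          rw [G.adj_unique _ _ _ hpq hab]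
          exact .inr (.refl _)
        by_cases hpb : p = b
        · subst hpb
          rw [G.adj_unique _ _ _ hpq (G.adj_symm _ _ hab)]
          exact .inl (.refl _)
        have : ZigEqv A (G.Pt J) p q := .rel _ _ (.inl ⟨hpq, hpa, hpb⟩)
        exact hp.imp (fun h => .trans _ _ _ h this) fun h => .trans _ _ _ h this
      · intro p q hpq hp
        have : ZigEqv A (G.Pt J) p q := .rel _ _ (.inr hpq)
        exact hp.imp (fun h => .trans _ _ _ h this) fun h => .trans _ _ _ h this
    -- If both ends lay on the same arm of the cut chain, z would be on an alternating path between
    -- ends and would have an A-step, but its only edge was removed.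
    have hno : ∀ z, z = a ∨ z = b → ZigEqv A (G.Pt J) z (i k) → ¬ ZigEqv A (G.Pt J) z (i k') := by
      intro z hz h h'
      obtain ⟨w, hw⟩ := ZigEqv.exists_step (P := G.Pt J) hA (fun _ _ => Pt.symm)
        (fun _ _ _ h k => G.adj_unique _ _ _ h.1 k.1) (fun _ _ _ => Pt.unique)
        (fun _ => not_pt_of_mem_T (hQ.mem_T k)) (fun _ => not_pt_of_mem_T (hQ.mem_T k')) hne
        (.trans _ _ _ (.symm _ _ h) h') (.symm _ _ h)
      rcases hz with rfl | rfl
      · exact hw.2.1 rfl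
      · exact hw.2.2 rfl
    rcases hsplit _ hka.symm with h2 | h2 <;> rcases hsplit _ (hka.symm.trans hE) with h3 | h3
    · exact absurd h3 (hno a (.inl rfl) h2)
    · exact ((hcn _ _ ha haJ h2).trans h1).trans (hcn _ _ hb hbJ h3).symm
    · exact ((hcn _ _ ha haJ h3).trans h1.symm).trans (hcn _ _ hb hbJ h2).symm
    · exact absurd h3 (hno b (.inr rfl) h2)

/-- The set of half-edges in `G` corresponding to a set of half-edges in a quotient. -/
def _root_.FGraph.lift (G : FGraph.{u}) (J : Set G.H) {Y : Type u} (i : Y → G.H) (K : Set Y) :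
    Set G.H := J ∪ {x | ∃ k ∈ K, G.E J (i k) x}

theorem compat_lift (hQ : G.IsQuot J Q i) (hJ : G.Good J) {K : Set Q.H}
    (hK : Q.Paired K) : G.Compat J (G.lift J i K) where
  sub := Set.subset_union_left
  paired := by
    rintro x (hx | ⟨k, hk, hkx⟩)
    · obtain ⟨y, hy, h⟩ := hJ.paired x hx
      exact ⟨y, .inl hy, h⟩
    · obtain ⟨k', hk', hkk'⟩ := hK k hk
      obtain ⟨hne, hE⟩ := (hQ.adj_iff _ _).mp hkk'
      -- The chain through x has two distinct ends, so it cannot stop at x: x is half of an internal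
      -- edge.
      obtain ⟨y, hxy⟩ := hE.mem_inn hkx (hQ.mem_T k) (hQ.mem_T k') hne
      exact ⟨y, .inr ⟨k, hk, hkx.trans (.of_adj hxy)⟩, hxy⟩
  pt := by
    rintro x y (hx | ⟨k, hk, hkx⟩) hxy
    · exact absurd hx hxy.2.2.1
    · exact .inr ⟨k, hk, hkx.trans (.of_pt hxy)⟩
  exists_end := by
    rintro x (hx | ⟨k, hk, hkx⟩) hxJ
    · exact absurd hx hxJ
    · exact ⟨i k, hQ.mem_T k, hkx⟩

theorem preimage_lift (hQ : G.IsQuot J Q i) {K : Set Q.H} (hK : Q.Paired K) :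
    i ⁻¹' G.lift J i K = K := by
  ext c
  constructor
  · rintro (hc | ⟨k, hk, hkc⟩)
    · exact absurd hc (hQ.notMem c)
    · by_cases hne : i k = i c
      · rwa [← hQ.inj hne]
      · exact hK.closed _ _ ((hQ.adj_iff _ _).mpr ⟨hne, hkc⟩) hk
  · intro hc
    exact .inr ⟨c, hc, .refl _⟩

theorem good_lift (hQ : G.IsQuot J Q i) (hT : G.Trivalent) (hJ : G.Good J) {K : Set Q.H}
    (hK : Q.Good K) : G.Good (G.lift J i K) :=
  hQ.good_of_preimage hT hJ (hQ.compat_lift hJ hK.paired) (by rwa [hQ.preimage_lift hK.paired])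

theorem lift_preimage (hQ : G.IsQuot J Q i) (hJ : G.Good J) (hS : G.Compat J S) :
    G.lift J i (i ⁻¹' S) = S := by
  ext x
  constructor
  · rintro (hx | ⟨k, hk, hkx⟩)
    · exact hS.sub hx
    · exact (hkx.mem hJ hS ⟨hk, hQ.notMem k⟩).1
  · intro hx
    by_cases hxJ : x ∈ J
    · exact .inl hxJ
    · obtain ⟨t, ht, htx⟩ := hS.exists_end x hx hxJ
      obtain ⟨k, rfl⟩ := hQ.exists_eq ht
      exact .inr ⟨k, (htx.symm.mem hJ hS ⟨hx, hxJ⟩).1, htx⟩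

theorem trivalent (hQ : G.IsQuot J Q i) : Q.Trivalent := by
  intro v
  obtain ⟨a, rfl⟩ := hQ.surj v
  rw [← (hQ.mem_T a).2.1]
  have : i '' {b | Q.vert b = Q.vert a} = G.lv J (G.vert (i a)) := by
    ext x
    constructor
    · rintro ⟨b, hb, rfl⟩
      exact ⟨hQ.notMem b, (hQ.vert_iff _ _).mp hb⟩
    · rintro ⟨hx, hxa⟩
      obtain ⟨b, rfl⟩ := hQ.exists_eq (mem_T_of_cn (hQ.mem_T a) hx hxa.symm)
      exact ⟨b, (hQ.vert_iff _ _).mpr hxa, rfl⟩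
  rw [← this, Set.ncard_image_of_injective _ hQ.inj]
  rfl

theorem preimage_inn (hQ : G.IsQuot J Q i) (hG : G.IsFeynman) (hJ : G.Good J) :
    i ⁻¹' G.inn = Q.inn := by
  obtain ⟨hT, _, hS⟩ := isFeynman_iff.mp hG
  ext a
  constructor
  · intro ha
    exact (hQ.good_preimage hT hJ hS hJ.paired.subset_inn).paired.subset_inn ha
  · rintro ⟨b, hab⟩
    obtain ⟨h1, h2⟩ := (hQ.adj_iff _ _).mp hab
    exact h2.mem_inn (.refl _) (hQ.mem_T a) (hQ.mem_T b) h1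

/-- The quotient of a Feynman graph by a Feynman subgraph is a Feynman graph. -/
theorem isFeynman (hQ : G.IsQuot J Q i) (hG : G.IsFeynman) (hJ : G.Good J) : Q.IsFeynman := by
  obtain ⟨hT, _, hS⟩ := isFeynman_iff.mp hG
  refine isFeynman_iff.mpr ⟨hQ.trivalent, fun v => ?_, ?_⟩
  · obtain ⟨a, rfl⟩ := hQ.surj v
    obtain ⟨k, ⟨hk, hka⟩, hki⟩ := (hQ.mem_T a).2.2
    obtain ⟨c, rfl⟩ := hQ.exists_eq (mem_T_of_cn (hQ.mem_T a) hk hka.symm)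
    exact ⟨c, hQ.preimage_inn hG hJ ▸ hki, (hQ.vert_iff _ _).mpr hka⟩
  · rw [← hQ.preimage_inn hG hJ]
    exact hQ.good_preimage hT hJ hS hJ.paired.subset_inn

end IsQuot

end FGraph

namespace FGraph

variable {G A : FGraph.{u}} {J S : Set G.H}

/-! ### Quotients and immersions -/

namespace Imm

variable (φ : Imm A G S)
include φ

theorem pt_iff (hJ : G.Paired J) (hJS : J ⊆ S) (a b : A.H) :
    G.Pt J (φ.h a) (φ.h b) ↔ A.Pt (φ.h ⁻¹' J) a b := by
  unfold Pt
  rw [φ.ncard_lv hJ hJS, φ.vert_h, φ.vert_h, φ.cn_iff hJ hJS, φ.h_inj.ne_iff]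
  rfl

theorem E_image (hJ : G.Paired J) (hJS : J ⊆ S) {a b : A.H} (h : A.E (φ.h ⁻¹' J) a b) :
    G.E J (φ.h a) (φ.h b) :=
  h.induction (P := fun b => G.E J (φ.h a) (φ.h b))
    (fun c d hcd h => h.trans (.of_adj (φ.adj_h c d hcd).1))
    (fun c d hcd h => h.trans (.of_pt ((φ.pt_iff hJ hJS c d).mpr hcd))) (.refl _)

theorem exists_of_cn (hJ : G.Paired J) (hJS : J ⊆ S) {a : A.H} {y : G.H}
    (h : G.Cn J (G.vert (φ.h a)) (G.vert y)) : ∃ b, φ.h b = y := by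
  rw [φ.vert_h] at h
  obtain ⟨w, hw, _⟩ := (φ.cn_iff_exists hJ hJS).mp h
  exact φ.full y w hw.symm

theorem exists_of_E (hJ : G.Good J) (hS : G.Compat J S) {a : A.H} {y : G.H}
    (h : G.E J (φ.h a) y) (ha : φ.h a ∈ S) (haJ : φ.h a ∉ J) :
    ∃ b, φ.h b = y ∧ A.E (φ.h ⁻¹' J) a b := by
  refine (h.induction (P := fun y => (y ∈ S ∧ y ∉ J) ∧ ∃ b, φ.h b = y ∧ A.E (φ.h ⁻¹' J) a b)
    ?_ ?_ ⟨⟨ha, haJ⟩, a, rfl, .refl _⟩).2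
  · rintro _ y hxy ⟨hx, b, rfl, hb⟩
    refine ⟨(E.of_adj hxy).mem hJ hS hx, ?_⟩
    obtain ⟨c, rfl, hbc⟩ := φ.lift_adj b y hx.1 hxy
    exact ⟨c, rfl, hb.trans (.of_adj hbc)⟩
  · rintro _ y hxy ⟨hx, b, rfl, hb⟩
    refine ⟨(E.of_pt hxy).mem hJ hS hx, ?_⟩
    obtain ⟨c, rfl⟩ := φ.exists_of_cn hJ.paired hS.sub hxy.2.2.2.2
    exact ⟨c, rfl, hb.trans (.of_pt ((φ.pt_iff hJ.paired hS.sub b c).mp hxy))⟩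

/-- The quotient of an immersed graph, presented inside the larger graph. -/
theorem presents_quot (hJ : G.Good J) (hS : G.Compat J S) {Q : FGraph.{u}} {i : Q.H → A.H}
    (hQ : A.IsQuot (φ.h ⁻¹' J) Q i) :
    Q.Presents (φ.h ∘ i)
      -- The last condition says that the component is not a whole component of A, whose internal
      -- half-edges are those in S.
      {x | x ∈ G.T J ∧ x ∈ Set.range φ.h ∧ ∃ a ∈ S, a ∉ J ∧ G.Cn J (G.vert a) (G.vert x)}
      (fun x y => G.Cn J (G.vert x) (G.vert y)) (fun x y => (x ≠ y ∧ G.E J x y) ∧ x ∈ S) := by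
  have hJS := hS.sub
  have hl := fun v => φ.lv_eq_image hJ.paired hJS v
  have hi := φ.preimage_eq_inn hS.paired
  refine ⟨φ.h_inj.comp hQ.inj, ?_, hQ.surj, ?_, ?_⟩
  · ext x
    constructor
    · rintro ⟨a, rfl⟩
      obtain ⟨h1, h2, k, hk, hki⟩ := hQ.mem_T a
      have hkS : φ.h k ∈ S := hi.ge hki
      have hk' : φ.h k ∈ G.lv J (G.vert (φ.h (i a))) := by
        rw [φ.vert_h, hl]
        exact ⟨k, hk, rfl⟩
      exact ⟨⟨h1, by rw [Function.comp_apply, φ.ncard_lv hJ.paired hJS, h2], _, hk',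
        hS.paired.subset_inn hkS⟩, ⟨_, rfl⟩, _, hkS, hk'⟩
    · rintro ⟨hx, ⟨x, rfl⟩, a, haS, haJ, hax⟩
      obtain ⟨a, rfl⟩ := φ.exists_of_cn hJ.paired hJS hax.symm
      have hxT : x ∈ A.T (φ.h ⁻¹' J) := by
        refine ⟨hx.1, by rw [← φ.ncard_lv hJ.paired hJS, hx.2.1], a, ⟨haJ, ?_⟩, hi ▸ haS⟩
        rwa [φ.vert_h, φ.vert_h, φ.cn_iff hJ.paired hJS] at hax
      obtain ⟨b, rfl⟩ := hQ.exists_eq hxT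
      exact ⟨b, rfl⟩
  · intro a b
    rw [hQ.vert_iff, Function.comp_apply, Function.comp_apply, φ.vert_h, φ.vert_h,
      φ.cn_iff hJ.paired hJS]
  · intro a b
    rw [hQ.adj_iff, Function.comp_apply, Function.comp_apply, φ.h_inj.ne_iff]
    constructor
    · rintro ⟨h1, h2⟩
      exact ⟨⟨h1, φ.E_image hJ.paired hJS h2⟩,
        hi.ge (h2.mem_inn (.refl _) (hQ.mem_T a) (hQ.mem_T b) h1)⟩
    · rintro ⟨⟨h1, h2⟩, h3⟩
      obtain ⟨c, hc, h⟩ := φ.exists_of_E hJ hS h2 h3 (hQ.notMem a)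
      exact ⟨h1, φ.h_inj hc ▸ h⟩

end Imm

/-- `(G / J)` restricted to the image of `S` is `S / J`. -/
theorem quot_part_equiv (hJ : G.Good J) (hS : G.Compat J S) (φ : Imm A G S)
    (hφ : ∀ a ∈ S, a ∈ Set.range φ.h) {P Q : FGraph.{u}} {p : P.H → A.H} {i : Q.H → G.H}
    (hP : A.IsQuot (φ.h ⁻¹' J) P p) (hQ : G.IsQuot J Q i) (δ : Q.Subgraph) (hδ : δ.J = i ⁻¹' S) :
    Nonempty (P.Equiv (Q.part δ.W δ.J)) := by
  refine (φ.presents_quot hJ hS hP).equiv (Presents.part hQ δ) ?_ (fun _ _ _ _ => Iff.rfl) ?_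
  · ext x
    constructor
    · rintro ⟨hx, _, a, haS, haJ, hax⟩
      obtain ⟨b, rfl⟩ := hQ.exists_eq (mem_T_of_cn hx haJ hax.symm)
      exact ⟨hx, b, hδ ▸ haS, hax⟩
    · rintro ⟨hx, b, hb, hbx⟩
      rw [hδ] at hb
      obtain ⟨a, ha⟩ := hφ _ hb
      rw [← ha] at hbx
      obtain ⟨c, rfl⟩ := φ.exists_of_cn hJ.paired hS.sub hbx
      exact ⟨hx, ⟨c, rfl⟩, _, hb, hQ.notMem b, ha ▸ hbx⟩
  · rintro x ⟨hx, _⟩ y _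
    obtain ⟨x, rfl⟩ := hQ.exists_eq hx
    rw [hQ.inj.mem_set_image, hδ]
    rfl

/-- `(G / J) / (S / J)` is `G / S`. -/
theorem quot_quot_equiv (hG : G.IsFeynman) (hJ : G.Good J) (hS : G.Compat J S)
    {P Q R : FGraph.{u}} {p : P.H → G.H} {i : Q.H → G.H} {r : R.H → Q.H} (hP : G.IsQuot S P p)
    (hQ : G.IsQuot J Q i) (hR : Q.IsQuot (i ⁻¹' S) R r) : Nonempty (P.Equiv R) := by
  have hT := (isFeynman_iff.mp hG).1
  have hl := hQ.image_lv_preimage hT hJ hS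
  have hc := fun a => hQ.ncard_lv_preimage hT hJ hS a
  have hcn := fun a b => hQ.cn_preimage hT hJ hS (a := a) (b := b)
  have hi := hQ.preimage_inn hG hJ
  have hadj : ∀ {x y}, G.adj x y → x ∉ S → y ∉ S := fun hxy hx hy =>
    hx (hS.paired.closed _ _ (G.adj_symm _ _ hxy) hy)
  -- Outside S, a J-chain is an S-chain: the two-legged components it passes have no leg in S and
  -- are therefore also components of S.
  have hE : ∀ {x y}, G.E J x y → x ∉ S → G.E S x y ∧ y ∉ S := by
    intro x y h hx
    refine h.induction (P := fun y => G.E S x y ∧ y ∉ S) ?_ ?_ ⟨.refl _, hx⟩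
    · rintro a b hab ⟨h1, h2⟩
      exact ⟨h1.trans (.of_adj hab), hadj hab h2⟩
    · rintro a b hab ⟨h1, h2⟩
      have hb : b ∉ S := fun hb => h2 (hS.pt _ _ hb hab.symm)
      refine ⟨h1.trans (.of_pt ⟨hab.1, ?_, h2, hb, hab.2.2.2.2.mono hS.sub⟩), hb⟩
      rw [lv_of_isolated hS.paired hS.sub]
      · exact hab.2.1
      · intro s hs hsJ hsa
        rcases hab.eq_or_eq hsJ hsa with rfl | rfl
        exacts [h2 hs, hb hs]
  have hEQ : ∀ {z a}, G.E J (i z) (i a) → Q.E (i ⁻¹' S) z a := by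
    intro z a h
    by_cases hza : i z = i a
    · rw [hQ.inj hza]
      exact .refl _
    · exact .of_adj ((hQ.adj_iff _ _).mpr ⟨hza, h⟩)
  have hTR : ∀ x, x ∈ Q.T (i ⁻¹' S) ↔ i x ∈ G.T S := by
    intro x
    unfold T
    rw [Set.mem_ofPred_eq, Set.mem_ofPred_eq, hc, ← hl, Set.exists_mem_image, ← hi]
    rfl
  refine hP.equiv (j := i ∘ r) (D' := i '' Q.T (i ⁻¹' S))
    (s' := fun x y => G.Cn S (G.vert x) (G.vert y)) (e' := fun x y => x ≠ y ∧ G.E S x y)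
    ⟨hQ.inj.comp hR.inj, by rw [Set.range_comp, hR.range_eq], hR.surj, ?_, ?_⟩ ?_
    (fun _ _ _ _ => Iff.rfl) (fun _ _ _ _ => Iff.rfl)
  · intro a b
    rw [hR.vert_iff, hcn]
    rfl
  · intro a b
    rw [hR.adj_iff, Function.comp_apply, Function.comp_apply, hQ.inj.ne_iff]
    refine and_congr_right fun _ => ⟨fun h => ?_, fun h => ?_⟩
    · refine (h.induction (P := fun y => G.E S (i (r a)) (i y) ∧ i y ∉ S) ?_ ?_
        ⟨.refl _, hR.notMem a⟩).1
      · rintro x y hxy ⟨h1, h2⟩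
        have h3 := hE ((hQ.adj_iff _ _).mp hxy).2 h2
        exact ⟨h1.trans h3.1, h3.2⟩
      · rintro x y ⟨h3, h4, h5, h6, h7⟩ ⟨h1, h2⟩
        refine ⟨h1.trans (.of_pt ⟨hQ.inj.ne h3, ?_, h2, h6, (hcn _ _).mp h7⟩), h6⟩
        rw [← hc, h4]
    · suffices (∃ z, Q.E (i ⁻¹' S) (r a) z ∧ G.E J (i z) (i (r b))) ∧ i (r b) ∉ S by
        obtain ⟨⟨z, hz, hzb⟩, -⟩ := this
        exact hz.trans (hEQ hzb)
      refine h.induction (P := fun y =>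
        (∃ z, Q.E (i ⁻¹' S) (r a) z ∧ G.E J (i z) y) ∧ y ∉ S) ?_ ?_
        ⟨⟨r a, .refl _, .refl _⟩, hR.notMem a⟩
      · rintro x y hxy ⟨⟨z, h1, h2⟩, h3⟩
        exact ⟨⟨z, h1, h2.trans (.of_adj hxy)⟩, hadj hxy h3⟩
      · rintro x y hxy ⟨⟨z, h1, h2⟩, h3⟩
        have hy := hxy.2.2.2.1
        refine ⟨?_, hy⟩
        -- A two-legged component of S either involves added chains, and then is a two-legged
        -- component in Q, or is a component of J and is absorbed into a J-chain.
        rcases hS.mem_T_or_isolated hT hJ (x := x) with h4 | h4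
        · obtain ⟨x, rfl⟩ := hQ.exists_eq (h4 x h3 (.refl _))
          obtain ⟨y, rfl⟩ := hQ.exists_eq (h4 y hy hxy.2.2.2.2)
          refine ⟨y, (h1.trans (hEQ h2)).trans (.of_pt ⟨fun h => hxy.1 (h ▸ rfl), ?_, h3, hy, ?_⟩),
            .refl _⟩
          · rw [hc]
            exact hxy.2.1
          · exact (hcn _ _).mpr hxy.2.2.2.2
        · refine ⟨z, h1, h2.trans (.of_pt ⟨hxy.1, ?_, fun h => h3 (hS.sub h),
            fun h => hy (hS.sub h), cn_of_isolated hS.paired h4 hxy.2.2.2.2⟩)⟩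
          rw [← lv_of_isolated hS.paired hS.sub h4]
          exact hxy.2.1
  · ext x
    constructor
    · intro hx
      have hxT : x ∈ G.T J := by
        rcases hS.mem_T_or_isolated hT hJ (x := x) with h | h
        · exact h x hx.1 (.refl _)
        · have := hx.2
          rw [lv_of_isolated hS.paired hS.sub h] at this
          exact ⟨fun h => hx.1 (hS.sub h), this⟩
      obtain ⟨x, rfl⟩ := hQ.exists_eq hxT
      exact ⟨x, (hTR x).mpr hx, rfl⟩
    · rintro ⟨x, hx, rfl⟩
      exact (hTR x).mp hx

/-! ### Flags of Feynman subgraphs -/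

theorem IsFeynman.good (hG : G.IsFeynman) : G.Good G.inn := (isFeynman_iff.mp hG).2.2

theorem IsFeynman.compat (hG : G.IsFeynman) (hJ : G.Good J) : G.Compat J G.inn :=
  Good.compat hG.trivalent hJ hG.good hJ.paired.subset_inn

/-- Two-step flags of Feynman subgraphs are Feynman subgraphs of quotients. -/
theorem IsFeynman.flags (hG : G.IsFeynman) :
    ∃ (T : Type u) (p : (Σ γ : G.Subgraph, (G.part γ.W γ.J).Subgraph) ≃ T)
      (q : (Σ γ : G.Subgraph, γ.quot.Subgraph) ≃ T), ∀ x y, p x = q y →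
      Nonempty (((G.part x.1.W x.1.J).part x.2.W x.2.J).Equiv (G.part y.1.W y.1.J)) ∧
      Nonempty (x.2.quot.Equiv (y.1.quot.part y.2.W y.2.J)) ∧
      Nonempty (x.1.quot.Equiv y.2.quot) := by
  have hT : G.Trivalent := hG.trivalent
  -- Both sides are encoded by nested good sets of half-edges; a subgraph of the quotient is lifted
  -- to the union of J and its chains.
  let T : Type u := {p : Set G.H × Set G.H // G.Good p.1 ∧ G.Good p.2 ∧ p.1 ⊆ p.2}
  let P : (Σ γ : G.Subgraph, (G.part γ.W γ.J).Subgraph) → Set G.H × Set G.H := fun x =>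
    (x.1.imm.h '' x.2.J, x.1.J)
  let Q : (Σ γ : G.Subgraph, γ.quot.Subgraph) → Set G.H × Set G.H := fun x =>
    (x.1.J, G.lift x.1.J x.1.quotH x.2.J)
  have hP : ∀ x, G.Good (P x).1 ∧ G.Good (P x).2 ∧ (P x).1 ⊆ (P x).2 := fun x =>
    ⟨x.1.imm.good_image x.2.good, x.1.good, x.1.imm.image_subset _ x.2.paired⟩
  have hQ : ∀ x, G.Good (Q x).1 ∧ G.Good (Q x).2 ∧ (Q x).1 ⊆ (Q x).2 := fun x =>
    ⟨x.1.good, x.1.isQuot.good_lift hT x.1.good x.2.good, Set.subset_union_left⟩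
  have bP : Function.Bijective fun x => (⟨P x, hP x⟩ : T) := by
    constructor
    · rintro ⟨γ, δ⟩ ⟨γ', δ'⟩ h
      obtain ⟨h1, h2⟩ : γ.imm.h '' δ.J = γ'.imm.h '' δ'.J ∧ γ.J = γ'.J :=
        Prod.mk.inj (congrArg Subtype.val h)
      obtain rfl := Subgraph.ext_J h2
      rw [Subgraph.ext_J (γ.imm.h_inj.image_injective h1)]
    · rintro ⟨⟨U, W⟩, hU, hW, hUW⟩
      dsimp only at hU hW hUW
      let γ := Subgraph.ofGood hT W hW
      refine ⟨⟨γ, Subgraph.ofGood (γ.imm.trivalent hT) (γ.imm.h ⁻¹' U)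
        (γ.imm.good_preimage hU hUW)⟩, Subtype.ext (Prod.ext ?_ rfl)⟩
      refine Set.image_preimage_eq_iff.mpr fun x hx => ?_
      exact γ.exists_imm_eq (γ.vert_mem x (hUW hx))
  have bQ : Function.Bijective fun x => (⟨Q x, hQ x⟩ : T) := by
    constructor
    · rintro ⟨γ, δ⟩ ⟨γ', δ'⟩ h
      obtain ⟨h1, h2⟩ : γ.J = γ'.J ∧ G.lift γ.J γ.quotH δ.J = G.lift γ'.J γ'.quotH δ'.J :=
        Prod.mk.inj (congrArg Subtype.val h)
      obtain rfl := Subgraph.ext_J h1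
      have h3 : δ.J = δ'.J := by
        rw [← γ.isQuot.preimage_lift δ.paired, h2, γ.isQuot.preimage_lift δ'.paired]
      rw [Subgraph.ext_J h3]
    · rintro ⟨⟨U, W⟩, hU, hW, hUW⟩
      dsimp only at hU hW hUW
      let γ := Subgraph.ofGood hT U hU
      refine ⟨⟨γ, Subgraph.ofGood γ.isQuot.trivalent (γ.quotH ⁻¹' W)
        (γ.isQuot.good_preimage hT hU hW hUW)⟩, Subtype.ext (Prod.ext rfl ?_)⟩
      exact γ.isQuot.lift_preimage hU (Good.compat hT hU hW hUW)
  refine ⟨T, _root_.Equiv.ofBijective _ bP, _root_.Equiv.ofBijective _ bQ, ?_⟩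
  rintro ⟨γ, ε⟩ ⟨γ', δ⟩ h
  obtain ⟨h1, h2⟩ : γ.imm.h '' ε.J = γ'.J ∧ γ.J = G.lift γ'.J γ'.quotH δ.J :=
    Prod.mk.inj (congrArg Subtype.val h)
  have hc : G.Compat γ'.J γ.J := by
    rw [h2]
    exact γ'.isQuot.compat_lift γ'.good δ.paired
  have hδ : δ.J = γ'.quotH ⁻¹' γ.J := by rw [h2, γ'.isQuot.preimage_lift δ.paired]
  have hε : ε.J = γ.imm.h ⁻¹' γ'.J := by rw [← h1, Set.preimage_image_eq _ γ.imm.h_inj]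
  have hself := G.presents_self hT.surj
  refine ⟨((hself.part γ).part ε).equiv (hself.part γ') ?_ (fun _ _ _ _ => Iff.rfl) ?_, ?_, ?_⟩
  · rw [← h1]
    ext x
    constructor
    · rintro ⟨_, a, ha, hax⟩
      exact ⟨trivial, _, ⟨a, ha, rfl⟩, hax⟩
    · rintro ⟨_, _, ⟨a, ha, rfl⟩, hax⟩
      obtain ⟨b, hb, hba⟩ := γ.W_eq.le (γ.vert_imm_mem a)
      exact ⟨⟨trivial, b, hb, hba.trans hax⟩, a, ha, hax⟩
  · intro x _ y _
    simp only [Set.image_id, Function.id_comp, h1]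
    exact ⟨fun h => ⟨h.1.1, h.2⟩, fun h => ⟨⟨h.1, hc.sub h.2⟩, h.2⟩⟩
  · have hq := ε.isQuot
    rw [hε] at hq
    exact quot_part_equiv γ'.good hc γ.imm (fun a ha => γ.exists_imm_eq (γ.vert_mem a ha)) hq
      γ'.isQuot δ hδ
  · have hq := δ.isQuot
    rw [hδ] at hq
    exact quot_quot_equiv hG γ'.good hc γ.isQuot γ'.isQuot hq

end FGraph

namespace FGraph

variable {G K A B : FGraph.{u}}

/-! ### Transport along isomorphisms -/

/-- The inverse of an isomorphism of graphs. -/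
def Equiv.symm (f : G.Equiv K) : K.Equiv G where
  eV := f.eV.symm
  eH := f.eH.symm
  vert_eq h := by rw [_root_.Equiv.eq_symm_apply, ← f.vert_eq, _root_.Equiv.apply_symm_apply]
  adj_iff a b := by
    rw [← f.adj_iff, _root_.Equiv.apply_symm_apply, _root_.Equiv.apply_symm_apply]

/-- The composition of isomorphisms of graphs. -/
def Equiv.trans {L : FGraph.{u}} (f : G.Equiv K) (g : K.Equiv L) : G.Equiv L where
  eV := f.eV.trans g.eV
  eH := f.eH.trans g.eH
  vert_eq h := by simp [g.vert_eq, f.vert_eq]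
  adj_iff a b := by simp [g.adj_iff, f.adj_iff]

/-- An isomorphism, regarded as an immersion. -/
def Equiv.imm (f : G.Equiv K) : Imm G K K.inn where
  v := f.eV
  h := f.eH
  v_inj := f.eV.injective
  h_inj := f.eH.injective
  vert_h := f.vert_eq
  full x _ _ := f.eH.surjective x
  adj_h a b h := ⟨(f.adj_iff a b).mpr h, _, (f.adj_iff a b).mpr h⟩
  lift_adj a y _ hy := by
    obtain ⟨b, rfl⟩ := f.eH.surjective y
    exact ⟨b, rfl, (f.adj_iff a b).mp hy⟩

theorem IsFeynman.of_equiv (hK : K.IsFeynman) (f : G.Equiv K) : G.IsFeynman := by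
  obtain ⟨h1, h2, h3⟩ := isFeynman_iff.mp hK
  have hi := f.imm.preimage_eq_inn K.paired_inn
  refine isFeynman_iff.mpr ⟨f.imm.trivalent h1, fun v => ?_, ?_⟩
  · obtain ⟨x, hx, hxv⟩ := h2 (f.eV v)
    obtain ⟨a, rfl⟩ := f.eH.surjective x
    exact ⟨a, hi.le hx, f.eV.injective ((f.vert_eq a).symm.trans hxv)⟩
  · rw [← hi]
    exact f.imm.good_preimage h3 subset_rfl

theorem Equiv.presents (f : G.Equiv K) (hG : Function.Surjective G.vert) :
    G.Presents f.imm.h Set.univ (fun x y => K.vert x = K.vert y) K.adj where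
  inj := f.eH.injective
  range_eq := f.eH.surjective.range_eq
  surj := hG
  vert_iff a b := by
    rw [f.imm.vert_h, f.imm.vert_h, f.imm.v_inj.eq_iff]
  adj_iff a b := (f.adj_iff a b).symm

theorem T_subset_exists_inn {J : Set G.H} {x : G.H} (hx : x ∈ G.T J) :
    ∃ a ∈ G.inn, a ∉ J ∧ G.Cn J (G.vert a) (G.vert x) := by
  obtain ⟨_, _, k, hk, hki⟩ := hx
  exact ⟨k, hki, hk⟩

/-- An isomorphism is an immersion onto, so the general comparison of parts and quotients applies.
Subgraphs are pulled back, hence the bijection runs against f. -/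
theorem Equiv.transport (f : G.Equiv K) (hK : K.IsFeynman) :
    ∃ e : K.Subgraph ≃ G.Subgraph, ∀ γ,
      Nonempty ((K.part γ.W γ.J).Equiv (G.part (e γ).W (e γ).J)) ∧
      Nonempty (γ.quot.Equiv (e γ).quot) := by
  have hG := hK.of_equiv f
  have hT : K.Trivalent := hK.trivalent
  have hTG : G.Trivalent := hG.trivalent
  have hsurj : Function.Surjective f.imm.h := f.eH.surjective
  let e : K.Subgraph → G.Subgraph := fun γ => Subgraph.ofGood hTG (f.imm.h ⁻¹' γ.J)
    (f.imm.good_preimage γ.good γ.paired.subset_inn)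
  have he : Function.Bijective e := by
    constructor
    · intro γ δ h
      exact Subgraph.ext_J (hsurj.preimage_injective (congrArg Subgraph.J h))
    · intro δ
      refine ⟨Subgraph.ofGood hT _ (f.imm.good_image δ.good), Subgraph.ext_J ?_⟩
      exact Set.preimage_image_eq _ f.imm.h_inj
  refine ⟨_root_.Equiv.ofBijective e he, fun γ => ⟨?_, ?_⟩⟩
  · refine ((K.presents_self hT.surj).part γ).equiv ((f.presents hTG.surj).part (e γ)) ?_
      (fun _ _ _ _ => Iff.rfl) ?_
    · ext x
      refine and_congr_right fun _ => ⟨?_, ?_⟩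
      · rintro ⟨a, ha, hax⟩
        obtain ⟨a, rfl⟩ := hsurj a
        exact ⟨a, ha, hax⟩
      · rintro ⟨a, ha, hax⟩
        exact ⟨f.imm.h a, ha, hax⟩
    · intro x _ y _
      rw [Set.image_id]
      change _ ↔ _ ∧ x ∈ f.imm.h '' (f.imm.h ⁻¹' γ.J)
      rw [Set.image_preimage_eq _ hsurj]
  · refine γ.isQuot.equiv (f.imm.presents_quot γ.good (hK.compat γ.good) (e γ).isQuot) ?_
      (fun _ _ _ _ => Iff.rfl) ?_
    · ext x
      exact ⟨fun hx => ⟨hx, hsurj x, T_subset_exists_inn hx⟩, fun hx => hx.1⟩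
    · intro x hx y hy
      exact ⟨fun h => ⟨h, h.2.mem_inn (.refl _) hx hy h.1⟩, fun h => h.1⟩

/-! ### Disjoint unions -/

/-- The inclusion of the first summand. -/
def inlImm (A B : FGraph.{u}) : Imm A (A.disjUnion B) (A.disjUnion B).inn where
  v := Sum.inl
  h := Sum.inl
  v_inj := Sum.inl_injective
  h_inj := Sum.inl_injective
  vert_h _ := rfl
  full := by
    rintro (x | x) w h
    · exact ⟨x, rfl⟩
    · exact absurd h Sum.inr_ne_inl
  adj_h _ _ h := ⟨.inl h, _, .inl h⟩
  lift_adj := by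
    rintro a _ _ (⟨h⟩ | _)
    exact ⟨_, rfl, h⟩

/-- The inclusion of the second summand. -/
def inrImm (A B : FGraph.{u}) : Imm B (A.disjUnion B) (A.disjUnion B).inn where
  v := Sum.inr
  h := Sum.inr
  v_inj := Sum.inr_injective
  h_inj := Sum.inr_injective
  vert_h _ := rfl
  full := by
    rintro (x | x) w h
    · exact absurd h Sum.inl_ne_inr
    · exact ⟨x, rfl⟩
  adj_h _ _ h := ⟨.inr h, _, .inr h⟩
  lift_adj := by
    rintro a _ _ (_ | ⟨h⟩)
    exact ⟨_, rfl, h⟩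

theorem Imm.presents (φ : Imm A G G.inn) (hA : Function.Surjective A.vert) :
    A.Presents φ.h (Set.range φ.h) (fun x y => G.vert x = G.vert y) G.adj where
  inj := φ.h_inj
  range_eq := rfl
  surj := hA
  vert_iff a b := by rw [φ.vert_h, φ.vert_h, φ.v_inj.eq_iff]
  adj_iff a b := (φ.adj_iff a b).trans (and_iff_left_of_imp fun h => ⟨_, h⟩)

/-- The subgraphs of a graph covered by two disjoint immersed graphs. -/
theorem IsFeynman.sum (hG : G.IsFeynman) (φ : Imm A G G.inn) (ψ : Imm B G G.inn)
    (hcov : ∀ x, x ∈ Set.range φ.h ∨ x ∈ Set.range ψ.h) (hdis : ∀ a b, φ.h a ≠ ψ.h b) :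
    ∃ e : G.Subgraph ≃ A.Subgraph × B.Subgraph, ∀ γ,
      Nonempty ((G.part γ.W γ.J).Equiv
        ((A.part (e γ).1.W (e γ).1.J).disjUnion (B.part (e γ).2.W (e γ).2.J))) ∧
      Nonempty (γ.quot.Equiv ((e γ).1.quot.disjUnion (e γ).2.quot)) := by
  have hT : G.Trivalent := hG.trivalent
  have hA := φ.trivalent hT
  have hB := ψ.trivalent hT
  let e : G.Subgraph → A.Subgraph × B.Subgraph := fun γ =>
    (Subgraph.ofGood hA (φ.h ⁻¹' γ.J) (φ.good_preimage γ.good γ.paired.subset_inn),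
      Subgraph.ofGood hB (ψ.h ⁻¹' γ.J) (ψ.good_preimage γ.good γ.paired.subset_inn))
  have he : Function.Bijective e := by
    constructor
    · intro γ δ h
      have h1 : φ.h ⁻¹' γ.J = φ.h ⁻¹' δ.J := congrArg (fun p => p.1.J) h
      have h2 : ψ.h ⁻¹' γ.J = ψ.h ⁻¹' δ.J := congrArg (fun p => p.2.J) h
      refine Subgraph.ext_J (Set.ext fun x => ?_)
      rcases hcov x with ⟨a, rfl⟩ | ⟨a, rfl⟩
      exacts [Set.ext_iff.mp h1 a, Set.ext_iff.mp h2 a]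
    · rintro ⟨α, β⟩
      have h1 : φ.h ⁻¹' (φ.h '' α.J ∪ ψ.h '' β.J) = α.J := by
        ext a
        constructor
        · rintro (⟨b, hb, h⟩ | ⟨b, _, h⟩)
          · rwa [← φ.h_inj h]
          · exact absurd h.symm (hdis a b)
        · exact fun ha => .inl ⟨a, ha, rfl⟩
      have h2 : ψ.h ⁻¹' (φ.h '' α.J ∪ ψ.h '' β.J) = β.J := by
        ext a
        constructor
        · rintro (⟨b, _, h⟩ | ⟨b, hb, h⟩)
          · exact absurd h (hdis b a)
          · rwa [← ψ.h_inj h]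
        · exact fun ha => .inr ⟨a, ha, rfl⟩
      -- The two preimages of the union are the given good sets, since the images are disjoint.
      have hg : G.Good (φ.h '' α.J ∪ ψ.h '' β.J) :=
        φ.good_of_cover ψ (Set.union_subset (φ.image_subset _ α.paired)
          (ψ.image_subset _ β.paired)) (h1.symm ▸ α.good) (h2.symm ▸ β.good) fun x _ => hcov x
      exact ⟨Subgraph.ofGood hT _ hg, Prod.ext (Subgraph.ext_J h1) (Subgraph.ext_J h2)⟩
  have hadj : ∀ a b, ¬ G.adj (φ.h a) (ψ.h b) := fun a b h => by
    obtain ⟨c, hc, _⟩ := φ.lift_adj a _ ⟨_, h⟩ h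
    exact hdis c b hc
  have hvert : ∀ a b, G.vert (φ.h a) ≠ G.vert (ψ.h b) := fun a b h => by
    obtain ⟨c, hc⟩ := φ.full (ψ.h b) _ (h.symm.trans (φ.vert_h a))
    exact hdis c b hc
  refine ⟨_root_.Equiv.ofBijective e he, fun γ => ⟨?_, ?_⟩⟩
  · have hφ : ∀ x ∈ Set.range φ.h, (G.adj x · ∧ x ∈ φ.h '' (φ.h ⁻¹' γ.J)) =
        (G.adj x · ∧ x ∈ γ.J) := by
      rintro _ ⟨a, rfl⟩
      funext y
      rw [φ.h_inj.mem_set_image]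
      rfl
    have hψ : ∀ x ∈ Set.range ψ.h, (G.adj x · ∧ x ∈ ψ.h '' (ψ.h ⁻¹' γ.J)) =
        (G.adj x · ∧ x ∈ γ.J) := by
      rintro _ ⟨a, rfl⟩
      funext y
      rw [ψ.h_inj.mem_set_image]
      rfl
    have h1 := ((φ.presents hA.surj).part (e γ).1).congr (e' := fun x y => G.adj x y ∧ x ∈ γ.J)
      rfl (fun _ _ _ _ => Iff.rfl) fun x hx y _ => Iff.of_eq (congrFun (hφ x hx.1) y)
    have h2 := ((ψ.presents hB.surj).part (e γ).2).congr (e' := fun x y => G.adj x y ∧ x ∈ γ.J)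
      rfl (fun _ _ _ _ => Iff.rfl) fun x hx y _ => Iff.of_eq (congrFun (hψ x hx.1) y)
    refine ((G.presents_self hT.surj).part γ).equiv (h1.disjUnion h2 ?_) ?_
      (fun _ _ _ _ => Iff.rfl) ?_
    · rintro _ ⟨⟨a, rfl⟩, _⟩ _ ⟨⟨b, rfl⟩, _⟩
      exact ⟨hvert a b, (hvert a b).symm, fun h => hadj a b h.1,
        fun h => hadj a b (G.adj_symm _ _ h.1)⟩
    · ext x
      constructor
      · rintro ⟨_, y, hy, hyx⟩
        rcases hcov x with ⟨a, rfl⟩ | ⟨a, rfl⟩ <;> rcases hcov y with ⟨b, rfl⟩ | ⟨b, rfl⟩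
        · exact .inl ⟨⟨a, rfl⟩, b, hy, hyx⟩
        · exact absurd hyx.symm (hvert a b)
        · exact absurd hyx (hvert b a)
        · exact .inr ⟨⟨a, rfl⟩, b, hy, hyx⟩
      · rintro (⟨_, a, ha, hax⟩ | ⟨_, a, ha, hax⟩)
        exacts [⟨trivial, _, ha, hax⟩, ⟨trivial, _, ha, hax⟩]
    · intro x _ y _
      rw [Set.image_id]
  · have hc := hG.compat γ.good
    have h1 := φ.presents_quot γ.good hc (e γ).1.isQuot
    have h2 := ψ.presents_quot γ.good hc (e γ).2.isQuot
    refine γ.isQuot.equiv (h1.disjUnion h2 ?_) ?_ (fun _ _ _ _ => Iff.rfl) ?_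
    · rintro _ ⟨hx, ⟨a, rfl⟩, _⟩ _ ⟨hy, ⟨b, rfl⟩, _⟩
      have hcn : ¬ G.Cn γ.J (G.vert (φ.h a)) (G.vert (ψ.h b)) := fun h => by
        obtain ⟨c, h⟩ := φ.exists_of_cn γ.paired hc.sub h
        exact hdis _ _ h
      refine ⟨hcn, fun h => hcn h.symm, ?_, ?_⟩
      · rintro ⟨⟨_, h⟩, hi⟩
        obtain ⟨c, h, _⟩ := φ.exists_of_E γ.good hc h hi hx.1
        exact hdis _ _ h
      · rintro ⟨⟨_, h⟩, hi⟩
        obtain ⟨c, h, _⟩ := ψ.exists_of_E γ.good hc h hi hy.1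
        exact hdis _ _ h.symm
    · ext x
      constructor
      · intro hx
        have h3 := T_subset_exists_inn hx
        exact (hcov x).imp (fun h => ⟨hx, h, h3⟩) fun h => ⟨hx, h, h3⟩
      · rintro (h | h)
        exacts [h.1, h.1]
    · intro x hx y hy
      exact ⟨fun h => ⟨h, h.2.mem_inn (.refl _) hx hy h.1⟩, fun h => h.1⟩

theorem IsFeynman.sum_disjUnion (hG : G.IsFeynman) (f : G.Equiv (A.disjUnion B)) :
    ∃ e : G.Subgraph ≃ A.Subgraph × B.Subgraph, ∀ γ,
      Nonempty ((G.part γ.W γ.J).Equiv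
        ((A.part (e γ).1.W (e γ).1.J).disjUnion (B.part (e γ).2.W (e γ).2.J))) ∧
      Nonempty (γ.quot.Equiv ((e γ).1.quot.disjUnion (e γ).2.quot)) := by
  obtain ⟨e, he⟩ := f.symm.transport hG
  obtain ⟨e', he'⟩ := (hG.of_equiv f.symm).sum (inlImm A B) (inrImm A B)
    (by rintro (a | a); exacts [.inl ⟨a, rfl⟩, .inr ⟨a, rfl⟩]) fun _ _ => Sum.inl_ne_inr
  refine ⟨e.trans e', fun γ => ?_⟩
  obtain ⟨⟨h1⟩, ⟨h2⟩⟩ := he γ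
  obtain ⟨⟨h3⟩, ⟨h4⟩⟩ := he' (e γ)
  exact ⟨⟨h1.trans h3⟩, ⟨h2.trans h4⟩⟩

/-! ### The smallest and the largest subgraph -/

theorem good_empty (G : FGraph.{u}) : G.Good ∅ :=
  ⟨fun _ h => h.elim, fun _ h => h.elim, fun _ _ _ h => h.elim⟩

theorem cn_empty {v w : G.V} : G.Cn ∅ v w ↔ v = w := by
  refine ⟨fun h => ?_, .of_eq⟩
  exact h.induction (P := fun w => v = w) (fun _ _ _ h => h) (fun _ _ _ h => h.elim) rfl

theorem lv_empty (v : G.V) : G.lv ∅ v = {h | G.vert h = v} := by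
  ext x
  exact ⟨fun h => cn_empty.mp h.2, fun h => ⟨id, cn_empty.mpr h⟩⟩

/-- For empty J every vertex is a three-legged class and meets an internal edge, so nothing is
deleted or contracted. -/
theorem IsFeynman.T_empty (hG : G.IsFeynman) : G.T ∅ = Set.univ := by
  refine Set.eq_univ_of_forall fun x => ⟨id, ?_, ?_⟩
  · rw [lv_empty]
    exact hG.trivalent _
  · obtain ⟨k, hk, hkx⟩ := (isFeynman_iff.mp hG).2.1 (G.vert x)
    exact ⟨k, lv_empty (G.vert x) ▸ hkx, hk⟩

theorem IsFeynman.E_empty (hG : G.IsFeynman) {x y : G.H} : G.E ∅ x y ↔ x = y ∨ G.adj x y := by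
  constructor
  · intro h
    refine h.induction (P := fun y => x = y ∨ G.adj x y) ?_ ?_ (.inl rfl)
    · rintro a b hab (rfl | h)
      · exact .inr hab
      · exact .inl (G.adj_unique _ _ _ (G.adj_symm _ _ h) hab)
    · intro a b hab _
      exact absurd hab (not_pt_of_mem_T (hG.T_empty ▸ trivial))
  · rintro (rfl | h)
    exacts [.refl _, .of_adj h]

theorem IsFeynman.quot_empty (hG : G.IsFeynman) {γ : G.Subgraph} (hγ : γ.J = ∅) :
    Nonempty (γ.quot.Equiv G) := by
  have h := γ.isQuot
  rw [hγ] at h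
  have hT : G.Trivalent := hG.trivalent
  refine h.equiv (G.presents_self hT.surj) hG.T_empty (fun _ _ _ _ => cn_empty) ?_
  intro x _ y _
  rw [hG.E_empty]
  constructor
  · rintro ⟨h1, h2⟩
    exact h2.resolve_left h1
  · intro h
    exact ⟨fun e => G.adj_irrefl _ (e ▸ h), .inr h⟩

theorem Presents.equiv_empty_iff {P : FGraph.{u}} {X : Type u} {i : P.H → X} {D : Set X}
    {s e : X → X → Prop} (h : P.Presents i D s e) : Nonempty (P.Equiv FGraph.empty) ↔ D = ∅ := by
  rw [← h.range_eq, Set.range_eq_empty_iff]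
  constructor
  · rintro ⟨f⟩
    exact ⟨fun a => (f.eH a).elim⟩
  · intro hH
    have hV : IsEmpty P.V := ⟨fun v => let ⟨a, _⟩ := h.surj v; hH.elim a⟩
    exact ⟨⟨_root_.Equiv.equivPEmpty _, _root_.Equiv.equivPEmpty _, fun a => hH.elim a,
      fun a => hH.elim a⟩⟩

theorem Subgraph.part_equiv_empty_iff (hG : G.IsFeynman) (γ : G.Subgraph) :
    Nonempty ((G.part γ.W γ.J).Equiv FGraph.empty) ↔ γ.J = ∅ := by
  have hT : G.Trivalent := hG.trivalent
  rw [((G.presents_self hT.surj).part γ).equiv_empty_iff, Set.eq_empty_iff_forall_notMem,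
    Set.eq_empty_iff_forall_notMem]
  constructor
  · exact fun h x hx => h x ⟨trivial, x, hx, rfl⟩
  · rintro h x ⟨_, a, ha, _⟩
    exact h a ha

/-- An internal edge outside J lies on a chain with an end in the quotient. Conversely, a half-edge
of the quotient requires an internal half-edge leaving its component. -/
theorem Subgraph.quot_equiv_empty_iff (hG : G.IsFeynman) (γ : G.Subgraph) :
    Nonempty (γ.quot.Equiv FGraph.empty) ↔ γ.J = G.inn := by
  rw [γ.isQuot.equiv_empty_iff]
  constructor
  · intro h
    refine γ.paired.subset_inn.antisymm fun x hx => ?_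
    by_contra hxJ
    obtain ⟨t, ht, _⟩ := (hG.compat γ.good).exists_end x hx hxJ
    exact h.le ht
  · intro h
    refine Set.eq_empty_of_forall_notMem fun x hx => ?_
    obtain ⟨a, ha, haJ, _⟩ := T_subset_exists_inn hx
    exact haJ (h ▸ ha)

theorem IsFeynman.part_inn (hG : G.IsFeynman) {γ : G.Subgraph} (hγ : γ.J = G.inn) :
    Nonempty ((G.part γ.W γ.J).Equiv G) := by
  obtain ⟨hT, h2, _⟩ := isFeynman_iff.mp hG
  have h := G.presents_self hT.surj
  refine (h.part γ).equiv h ?_ (fun _ _ _ _ => Iff.rfl) ?_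
  · refine Set.eq_univ_of_forall fun x => ⟨trivial, ?_⟩
    obtain ⟨k, hk, hkx⟩ := h2 (G.vert x)
    exact ⟨k, hγ ▸ hk, hkx⟩
  · intro x _ y _
    rw [Set.image_id, hγ]
    exact and_iff_left_of_imp fun h => ⟨y, h⟩

end FGraph

/-! ### The laws for labeled Feynman graphs and the conclusion -/

/-- The quotient of a labeled Feynman graph, labeled by its own half-edges. -/
def LabeledFeynmanGraph.quo (G : LabeledFeynmanGraph.{u}) (γ : G.graph.Subgraph) :
    LabeledFeynmanGraph.{u} where
  graph := γ.quot
  isFeynman := γ.isQuot.isFeynman G.isFeynman γ.good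
  S := γ.quot.H
  label := Equiv.refl _

/-- The structural laws of the category of labeled Feynman graphs. -/
def LFG.laws : LFG.{u}.Laws where
  quo := LabeledFeynmanGraph.quo
  isQuot_iff _ _ _ := Iff.rfl
  transport := fun M _ ⟨f⟩ => f.symm.transport M.isFeynman
  flags G := G.isFeynman.flags
  sum := fun _ _ M ⟨f⟩ => M.isFeynman.sum_disjUnion f
  bot := fun G => by
    have hG := G.isFeynman
    have hT : G.graph.Trivalent := hG.trivalent
    let γ := FGraph.Subgraph.ofGood hT ∅ (FGraph.good_empty _)
    exact ⟨γ, (γ.part_equiv_empty_iff hG).mpr rfl, hG.quot_empty rfl, fun δ hδ =>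
      FGraph.Subgraph.ext_J ((FGraph.Subgraph.part_equiv_empty_iff hG δ).mp hδ)⟩
  top := fun G => by
    have hG := G.isFeynman
    have hT : G.graph.Trivalent := hG.trivalent
    let γ := FGraph.Subgraph.ofGood hT _ hG.good
    exact ⟨γ, (γ.quot_equiv_empty_iff hG).mpr rfl, hG.part_inn rfl, fun δ hδ =>
      FGraph.Subgraph.ext_J ((FGraph.Subgraph.quot_equiv_empty_iff hG δ).mp hδ)⟩

end

theorem mainTheorem3 (S : Type u) [Infinite S] (C : HallCat.{u}) (hC : C = LRF S ∨ C = LFG)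
    (M : C.Iso) :
    -- the primitive elements form a Lie algebra under the commutator
    (∀ X ∈ C.n, ∀ Y ∈ C.n, C.bracket X Y ∈ C.n) ∧
    (∀ X ∈ C.n, ∀ Y ∈ C.n, ∀ Z ∈ C.n,
      C.bracket X (C.bracket Y Z) + C.bracket Y (C.bracket Z X)
        + C.bracket Z (C.bracket X Y) = 0) ∧
    -- the formula for the top-elimination action on the restricted dual
    (∀ A B : C.Iso, C.topElim (C.phi B) (C.delta A) =
      -∑ᶠ N ∈ C.subsWithQuot B A, C.phi (C.cls (C.sub B.out N))) ∧
    -- the restricted dual is a (right) representation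
    (∀ φ ∈ C.restrictedDual, ∀ X ∈ C.n, C.topElim φ X ∈ C.restrictedDual) ∧
    (∀ φ ∈ C.restrictedDual, ∀ X ∈ C.n, ∀ Y ∈ C.n,
      C.topElim φ (C.bracket X Y) = C.topElim (C.topElim φ X) Y - C.topElim (C.topElim φ Y) X) ∧
    -- `H_{≤ M}` is a finite-dimensional subrepresentation
    C.below M ≤ C.restrictedDual ∧
    FiniteDimensional ℚ (C.below M) ∧
    (∀ φ ∈ C.below M, ∀ X ∈ C.n, C.topElim φ X ∈ C.below M) := by
  obtain ⟨L⟩ : Nonempty C.Laws := by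
    rcases hC with rfl | rfl
    exacts [⟨LRF.laws S⟩, ⟨LFG.laws⟩]
  exact ⟨fun _ hX _ hY => L.bracket_mem hX hY, fun X _ Y _ Z _ => L.jacobi X Y Z,
    HallCat.topElim_phi_delta, fun _ hφ X _ => HallCat.topElim_mem_restrictedDual hφ X,
    fun φ _ X _ Y _ => L.topElim_bracket φ X Y, HallCat.below_le M,
    HallCat.below_finiteDimensional M, fun _ hφ X _ => L.topElim_mem_below hφ X⟩
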